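/- Let $M$ be a smooth manifold and let $I_+, I_-$ be two complex structures on $M$; write $X_\pm=(M,I_\pm)$ and $\mathbb{T}_{1,0}X_\pm = T_{1,0}X_\pm\oplus T^*_{1,0}X_\pm$, and use the pairing $\langle X+\alpha,Y+\beta\rangle=\iota_X\beta+\iota_Y\alpha$. Over each $X_\pm$ let a holomorphic exact Manin triple $(\mathcal{E}_\pm,\mathcal{A}_\pm,\mathcal{B}_\pm)$ be given, with $\mathcal{E}_\pm$ in normal form: there is a closed complex 3-form $\mathcal{H}_\pm=\mathcal{H}_\pm^{2,1}+\mathcal{H}_\pm^{3,0}$ with components of types $(2,1)$ and $(3,0)$ for $I_\pm$, and $\mathcal{E}_\pm$ is $\mathbb{T}_{1,0}X_\pm$ with the Dolbeault operator $$\overline D(Y+\beta)=\bar\partial Y+\bar\partial\beta+\iota_Y\mathcal{H}_\pm^{2,1}$$ and the bracket on holomorphic sections $$[X+\alpha,Y+\beta]=[X,Y]+(\partial\iota_X+\iota_X\partial)\beta-\iota_Y\partial\alpha+\iota_X\iota_Y\mathcal{H}_\pm^{3,0};$$ $\mathcal{A}_\pm,\mathcal{B}_\pm\subset\mathcal{E}_\pm$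 are holomorphic Dirac structures (maximal isotropic holomorphic subbundles closed under the bracket) with $\mathcal{E}_\pm=\mathcal{A}_\pm\oplus\mathcal{B}_\pm$. Let $L_{\mathcal{A}_\pm}=\mathcal{A}_\pm\oplus T_{0,1}X_\pm$ and $L_{\mathcal{B}_\pm}=\mathcal{B}_\pm\oplus T_{0,1}X_\pm$ be their matched pairs in $(TM\oplus T^*M)\otimes\mathbb{C}$. Suppose that $F_1,F_2$ are real 2-forms on $M$ with $$\mathcal{H}_+-\mathcal{H}_-=d(iF_1),\qquad \overline{\mathcal{H}_-}-\mathcal{H}_+=d(iF_2),$$ $$L_{\mathcal{A}_+}=e^{iF_1}L_{\mathcal{A}_-},\qquad \overline{L_{\mathcal{B}_-}}=e^{iF_2}L_{\mathcal{B}_+},$$ where $e^{B}(X+\alpha)=X+\alpha+\iota_XB$. Put $F_\pm=\tfrac12(-F_1\pm F_2)$, regarded as maps $TM\to T^*M$, $X\mapsto\iota_XF_\pm$, and let $$\omega_\pm=\tfrac12(F_\pm+I_\pm^*F_\pm I_\pm),\qquad \beta_\pm=\tfrac12(F_\pm-I_\pm^*F_\pm I_\pm)$$ be their components of type $(1,1)$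 and $(2,0)+(0,2)$ with respect to $I_\pm$. Then there are a smooth symmetric 2-tensor $g$ and a smooth real 2-form $b$ such that $$-\omega_\pm I_\pm=g,\qquad -\beta_\pm I_\pm=\pm b,\qquad -F_\pm I_\pm=g\pm b .$$ Thus the symmetric parts of $-F_+I_+$ and $-F_-I_-$ coincide and their skew parts are opposite. The tensor $g$ satisfies $g(I_\pm\cdot,I_\pm\cdot)=g$ and $\omega_\pm=gI_\pm$. With $d^c_\pm=i(\bar\partial_\pm-\partial_\pm)$, the real 3-form $H=\operatorname{Re}(\mathcal{H}_+)-db=\operatorname{Re}(\mathcal{H}_-)-db$ satisfies $$\pm d^c_\pm\omega_\pm=H .$$ Consequently, if $g$ is positive definite, these data define a generalized Kähler structure on $(M,H)$: the endomorphisms $$\mathbb{J}_A=\frac12\begin{pmatrix}I_++I_-&(I_+-I_-)g^{-1}\\ g(I_+-I_-)&-(I_+^*+I_-^*)\end{pmatrix},\qquad \mathbb{J}_B=\frac12\begin{pmatrix}I_+-I_-&(I_++I_-)g^{-1}\\ g(I_++I_-)&-(I_+^*-I_-^*)\end{pmatrix}$$ of $TM\oplus T^*M$ are commuting generalized complex structures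 on $(M,H)$, i.e. each squares to $-1$ and has a maximal isotropic $+i$-eigenbundle that is involutive for the Courant bracket $$[X+\alpha,Y+\beta]_H=[X,Y]+L_X\beta-\iota_Yd\alpha+\iota_X\iota_YH,$$ and $\langle\mathbb{J}_A\cdot,\mathbb{J}_B\cdot\rangle$ is a positive definite metric on $TM\oplus T^*M$. -/

import Mathlib

open scoped Manifold ContDiff Bundle

noncomputable section

/-! ## Complexification of a real vector space -/

/-- The complexification `V ⊗ ℂ` of a real vector space; the pair `(x, y)` stands for `x + i y`. -/
def Cplx (V : Type*) : Type _ := V × V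

namespace Cplx

/-- The real part of `x + i y`. -/
def re {V : Type*} (z : Cplx V) : V := z.1

/-- The imaginary part of `x + i y`. -/
def im {V : Type*} (z : Cplx V) : V := z.2

/-- The vector `x + i y`. -/
def mk {V : Type*} (x y : V) : Cplx V := (x, y)

@[ext] theorem ext {V : Type*} {z w : Cplx V} (h₁ : z.re = w.re) (h₂ : z.im = w.im) : z = w :=
  Prod.ext h₁ h₂

@[simp] theorem re_mk {V : Type*} (x y : V) : (mk x y).re = x := rfl
@[simp] theorem im_mk {V : Type*} (x y : V) : (mk x y).im = y := rfl

instance {V : Type*} [AddCommGroup V] : AddCommGroup (Cplx V) :=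
  inferInstanceAs (AddCommGroup (V × V))

@[simp] theorem re_add {V : Type*} [AddCommGroup V] (z w : Cplx V) :
    (z + w).re = z.re + w.re := rfl
@[simp] theorem im_add {V : Type*} [AddCommGroup V] (z w : Cplx V) :
    (z + w).im = z.im + w.im := rfl
@[simp] theorem re_zero {V : Type*} [AddCommGroup V] : (0 : Cplx V).re = 0 := rfl
@[simp] theorem im_zero {V : Type*} [AddCommGroup V] : (0 : Cplx V).im = 0 := rfl

/-- `(a + i b) • (x + i y) = (a x - b y) + i (a y + b x)`. -/
instance {V : Type*} [AddCommGroup V] [Module ℝ V] : SMul ℂ (Cplx V) :=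
  ⟨fun c z => mk (c.re • z.re - c.im • z.im) (c.re • z.im + c.im • z.re)⟩

@[simp] theorem re_smul {V : Type*} [AddCommGroup V] [Module ℝ V] (c : ℂ) (z : Cplx V) :
    (c • z).re = c.re • z.re - c.im • z.im := rfl
@[simp] theorem im_smul {V : Type*} [AddCommGroup V] [Module ℝ V] (c : ℂ) (z : Cplx V) :
    (c • z).im = c.re • z.im + c.im • z.re := rfl

instance {V : Type*} [AddCommGroup V] [Module ℝ V] : Module ℂ (Cplx V) where
  one_smul z := by ext <;> simp
  mul_smul a b z := by ext <;> simp <;> module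
  smul_zero a := by ext <;> simp
  smul_add a z w := by ext <;> simp <;> module
  add_smul a b z := by ext <;> simp <;> module
  zero_smul z := by ext <;> simp

/-- The complex-linear extension of a real-linear endomorphism. -/
def map {V : Type*} [AddCommGroup V] [Module ℝ V] (f : V →ₗ[ℝ] V) : Cplx V →ₗ[ℂ] Cplx V where
  toFun z := mk (f z.re) (f z.im)
  map_add' z w := by ext <;> simp
  map_smul' c z := by ext <;> simp

/-- Complex conjugation `x + i y ↦ x - i y`. -/
def conj {V : Type*} [AddCommGroup V] [Module ℝ V] : Cplx V →ₛₗ[starRingEnd ℂ] Cplx V where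
  toFun z := mk z.re (-z.im)
  map_add' z w := by
    ext
    · rfl
    · simp [add_comm]
  map_smul' c z := by
    ext
    · simp
    · simp [add_comm]

end Cplx

/-! ## Forms, types and generalized tangent vectors on a real vector space -/

section Pointwise

/-- Contraction `ι_v α = α(v, ·, …, ·)` of a form with a real vector. -/
def contractR {V F : Type*} [AddCommGroup V] [Module ℝ V] [TopologicalSpace V]
    [AddCommGroup F] [Module ℝ F] [TopologicalSpace F] {k : ℕ}
    (v : V) (α : V [⋀^Fin (k + 1)]→L[ℝ] F) : V [⋀^Fin k]→L[ℝ] F :=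
  { α.toAlternatingMap.curryLeft v with
    cont := α.cont.comp (continuous_const.matrixVecCons continuous_id) }

theorem contractR_apply {V F : Type*} [AddCommGroup V] [Module ℝ V] [TopologicalSpace V]
    [AddCommGroup F] [Module ℝ F] [TopologicalSpace F] {k : ℕ}
    (v : V) (α : V [⋀^Fin (k + 1)]→L[ℝ] F) (w : Fin k → V) :
    contractR v α w = α (Matrix.vecCons v w) := rfl

theorem contractR_add_left {V F : Type*} [AddCommGroup V] [Module ℝ V] [TopologicalSpace V]
    [AddCommGroup F] [Module ℝ F] [TopologicalSpace F] [ContinuousAdd F] {k : ℕ}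
    (v w : V) (α : V [⋀^Fin (k + 1)]→L[ℝ] F) :
    contractR (v + w) α = contractR v α + contractR w α := by
  ext u
  exact α.toMultilinearMap.cons_add u v w

theorem contractR_smul_left {V : Type*} [AddCommGroup V] [Module ℝ V] [TopologicalSpace V] {k : ℕ}
    (r : ℝ) (v : V) (α : V [⋀^Fin (k + 1)]→L[ℝ] ℂ) :
    contractR (r • v) α = (r : ℂ) • contractR v α := by
  ext u
  have h := α.toMultilinearMap.cons_smul u r v
  rw [Complex.real_smul] at h
  exact h

/-- Contraction `ι_Z α = ι_X α + i ι_Y α` of a complex form with `Z = X + i Y`, as a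
complex-bilinear map. -/
def contract {V : Type*} [AddCommGroup V] [Module ℝ V] [TopologicalSpace V] {k : ℕ} :
    Cplx V →ₗ[ℂ] (V [⋀^Fin (k + 1)]→L[ℝ] ℂ) →ₗ[ℂ] (V [⋀^Fin k]→L[ℝ] ℂ) :=
  LinearMap.mk₂ ℂ (fun Z α => contractR Z.re α + Complex.I • contractR Z.im α)
    (fun Z W α => by
      simp only [Cplx.re_add, Cplx.im_add, contractR_add_left]; module)
    (fun c Z α => by
      have hc : ∀ (r s : ℝ) (v w : V),
          contractR (r • v - s • w) α = (r : ℂ) • contractR v α - (s : ℂ) • contractR w α := by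
        intro r s v w
        rw [sub_eq_add_neg, ← neg_smul, contractR_add_left, contractR_smul_left,
          contractR_smul_left]
        push_cast
        module
      simp only [Cplx.re_smul, Cplx.im_smul, hc, contractR_add_left, contractR_smul_left]
      ext u
      simp only [ContinuousAlternatingMap.add_apply, ContinuousAlternatingMap.sub_apply,
        ContinuousAlternatingMap.smul_apply, smul_eq_mul]
      conv_rhs => rw [← Complex.re_add_im c]
      linear_combination (-(c.im : ℂ) * contractR Z.im α u) * Complex.I_mul_I)
    (fun Z α β => by
      ext u
      simp [contractR_apply]
      ring)
    (fun c Z α => by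
      ext u
      simp [contractR_apply]
      ring)

/-- The pullback `J^* α = α(J·, …, J·)` of complex forms, as a complex-linear map. -/
def pullC {V : Type*} [AddCommGroup V] [Module ℝ V] [TopologicalSpace V] {k : ℕ}
    (J : V →L[ℝ] V) : (V [⋀^Fin k]→L[ℝ] ℂ) →ₗ[ℂ] (V [⋀^Fin k]→L[ℝ] ℂ) where
  toFun α := α.compContinuousLinearMap J
  map_add' _ _ := rfl
  map_smul' _ _ := rfl

/-- A real form regarded as a complex form. -/
def toC {V : Type*} [AddCommGroup V] [Module ℝ V] [TopologicalSpace V] {k : ℕ}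
    (α : V [⋀^Fin k]→L[ℝ] ℝ) : V [⋀^Fin k]→L[ℝ] ℂ :=
  Complex.ofRealCLM.compContinuousAlternatingMap α

/-- The real part of a complex form. -/
def reForm {V : Type*} [AddCommGroup V] [Module ℝ V] [TopologicalSpace V] {k : ℕ}
    (α : V [⋀^Fin k]→L[ℝ] ℂ) : V [⋀^Fin k]→L[ℝ] ℝ :=
  Complex.reCLM.compContinuousAlternatingMap α

/-- The imaginary part of a complex form. -/
def imForm {V : Type*} [AddCommGroup V] [Module ℝ V] [TopologicalSpace V] {k : ℕ}
    (α : V [⋀^Fin k]→L[ℝ] ℂ) : V [⋀^Fin k]→L[ℝ] ℝ :=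
  Complex.imCLM.compContinuousAlternatingMap α

/-- The complex conjugate of a complex form. -/
def conjForm {V : Type*} [AddCommGroup V] [Module ℝ V] [TopologicalSpace V] {k : ℕ}
    (α : V [⋀^Fin k]→L[ℝ] ℂ) : V [⋀^Fin k]→L[ℝ] ℂ :=
  (Complex.conjCLE : ℂ →L[ℝ] ℂ).compContinuousAlternatingMap α

/-- A complex form `α` has type `(p, q)` for the complex structure `J` if the rotation
`a + b J` acts on it as multiplication by `(a + i b) ^ p * (a - i b) ^ q`. -/
def IsOfType {V : Type*} [AddCommGroup V] [Module ℝ V] [TopologicalSpace V] {k : ℕ}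
    (J : V →L[ℝ] V) (p q : ℕ) (α : V [⋀^Fin k]→L[ℝ] ℂ) : Prop :=
  ∀ (a b : ℝ) (v : Fin k → V),
    α (fun i => a • v i + b • J (v i)) =
      ((a : ℂ) + b * Complex.I) ^ p * ((a : ℂ) - b * Complex.I) ^ q * α v

/-- The real generalized tangent space `V ⊕ V^*`. -/
abbrev Gen (V : Type*) [AddCommGroup V] [Module ℝ V] [TopologicalSpace V] : Type _ :=
  V × (V [⋀^Fin 1]→L[ℝ] ℝ)

/-- The complexified generalized tangent space `(V ⊕ V^*) ⊗ ℂ`. -/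
abbrev GenC (V : Type*) [AddCommGroup V] [Module ℝ V] [TopologicalSpace V] : Type _ :=
  Cplx V × (V [⋀^Fin 1]→L[ℝ] ℂ)

/-- The pairing `⟨X + α, Y + β⟩ = ι_X β + ι_Y α` on `V ⊕ V^*`. -/
def pair {V : Type*} [AddCommGroup V] [Module ℝ V] [TopologicalSpace V] (x y : Gen V) : ℝ :=
  contractR x.1 y.2 ![] + contractR y.1 x.2 ![]

/-- The pairing `⟨X + α, Y + β⟩ = ι_X β + ι_Y α` on `(V ⊕ V^*) ⊗ ℂ`. -/
def pairC {V : Type*} [AddCommGroup V] [Module ℝ V] [TopologicalSpace V] (x y : GenC V) : ℂ :=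
  contract x.1 y.2 ![] + contract y.1 x.2 ![]

/-- Isotropic subspaces of `(V ⊕ V^*) ⊗ ℂ`. -/
def IsIsotropic {V : Type*} [AddCommGroup V] [Module ℝ V] [TopologicalSpace V]
    (L : Submodule ℂ (GenC V)) : Prop :=
  ∀ x ∈ L, ∀ y ∈ L, pairC x y = 0

/-- The `(1,0)`-vectors, i.e. the `i`-eigenspace of `J`. -/
def tangent10 {V : Type*} [AddCommGroup V] [Module ℝ V] [TopologicalSpace V]
    (J : V →L[ℝ] V) : Submodule ℂ (Cplx V) :=
  Module.End.eigenspace (Cplx.map (J : V →ₗ[ℝ] V)) Complex.I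

/-- The `(0,1)`-vectors, i.e. the `-i`-eigenspace of `J`. -/
def tangent01 {V : Type*} [AddCommGroup V] [Module ℝ V] [TopologicalSpace V]
    (J : V →L[ℝ] V) : Submodule ℂ (Cplx V) :=
  Module.End.eigenspace (Cplx.map (J : V →ₗ[ℝ] V)) (-Complex.I)

/-- The `(1,0)`-covectors, i.e. those with `α ∘ J = i α`. -/
def cotangent10 {V : Type*} [AddCommGroup V] [Module ℝ V] [TopologicalSpace V]
    (J : V →L[ℝ] V) : Submodule ℂ (V [⋀^Fin 1]→L[ℝ] ℂ) :=
  Module.End.eigenspace (pullC J) Complex.I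

/-- `𝕋_{1,0} = T_{1,0} ⊕ T^*_{1,0}`. -/
def gen10 {V : Type*} [AddCommGroup V] [Module ℝ V] [TopologicalSpace V]
    (J : V →L[ℝ] V) : Submodule ℂ (GenC V) :=
  (tangent10 J).prod (cotangent10 J)

/-- The projection `(1 - i J) / 2` of complex vectors to their `(1,0)`-component. -/
def proj10 {V : Type*} [AddCommGroup V] [Module ℝ V] [TopologicalSpace V]
    (J : V →L[ℝ] V) (Z : Cplx V) : Cplx V :=
  (1 / 2 : ℂ) • (Z - Complex.I • Cplx.map (J : V →ₗ[ℝ] V) Z)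

/-- The projection `(1 - i J^*) / 2` of complex covectors to their `(1,0)`-component. -/
def coproj10 {V : Type*} [AddCommGroup V] [Module ℝ V] [TopologicalSpace V]
    (J : V →L[ℝ] V) (α : V [⋀^Fin 1]→L[ℝ] ℂ) : V [⋀^Fin 1]→L[ℝ] ℂ :=
  (1 / 2 : ℂ) • (α - Complex.I • pullC J α)

/-- The matched pair `L_A = A ⊕ T_{0,1}` of a subspace `A` of `𝕋_{1,0}`. -/
def matchedPair {V : Type*} [AddCommGroup V] [Module ℝ V] [TopologicalSpace V]
    (J : V →L[ℝ] V) (A : Submodule ℂ (GenC V)) : Submodule ℂ (GenC V) :=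
  A ⊔ (tangent01 J).prod ⊥

/-- The gauge transformation `e^B (X + α) = X + α + ι_X B`. -/
def gaugeMap {V : Type*} [AddCommGroup V] [Module ℝ V] [TopologicalSpace V]
    (B : V [⋀^Fin 2]→L[ℝ] ℂ) : GenC V →ₗ[ℂ] GenC V where
  toFun x := (x.1, x.2 + contract x.1 B)
  map_add' x y := by
    refine Prod.ext rfl ?_
    simp only [Prod.fst_add, Prod.snd_add, map_add, LinearMap.add_apply]
    abel
  map_smul' c x := by
    refine Prod.ext rfl ?_
    simp only [Prod.smul_fst, Prod.smul_snd, map_smul, LinearMap.smul_apply, smul_add,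
      RingHom.id_apply]

/-- Complex conjugation on `(V ⊕ V^*) ⊗ ℂ`. -/
def conjGen {V : Type*} [AddCommGroup V] [Module ℝ V] [TopologicalSpace V] :
    GenC V →ₛₗ[starRingEnd ℂ] GenC V where
  toFun x := (Cplx.conj x.1, conjForm x.2)
  map_add' x y := by
    refine Prod.ext (map_add _ _ _) ?_
    ext v
    simp [conjForm]
  map_smul' c x := by
    refine Prod.ext (Cplx.conj.map_smulₛₗ c x.1) ?_
    ext v
    simp [conjForm]

/-- The real part of an element of `(V ⊕ V^*) ⊗ ℂ`. -/
def reGen {V : Type*} [AddCommGroup V] [Module ℝ V] [TopologicalSpace V] (x : GenC V) : Gen V :=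
  (x.1.re, reForm x.2)

/-- The imaginary part of an element of `(V ⊕ V^*) ⊗ ℂ`. -/
def imGen {V : Type*} [AddCommGroup V] [Module ℝ V] [TopologicalSpace V] (x : GenC V) : Gen V :=
  (x.1.im, imForm x.2)

/-- The `i`-eigenspace in `(V ⊕ V^*) ⊗ ℂ` of a real endomorphism `𝕁` of `V ⊕ V^*`: the equation
`𝕁 (u + i v) = i (u + i v)` reads `𝕁 u = -v` and `𝕁 v = u`. -/
def plusEigen {V : Type*} [AddCommGroup V] [Module ℝ V] [TopologicalSpace V]
    (𝕁 : Gen V →ₗ[ℝ] Gen V) : Submodule ℂ (GenC V) where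
  carrier := {x | 𝕁 (reGen x) = -imGen x ∧ 𝕁 (imGen x) = reGen x}
  zero_mem' := by
    have h₁ : reGen (0 : GenC V) = 0 := Prod.ext rfl (by ext v; simp [reGen, reForm])
    have h₂ : imGen (0 : GenC V) = 0 := Prod.ext rfl (by ext v; simp [imGen, imForm])
    simp [h₁, h₂]
  add_mem' := by
    rintro x y ⟨hx₁, hx₂⟩ ⟨hy₁, hy₂⟩
    have h₁ : reGen (x + y) = reGen x + reGen y :=
      Prod.ext rfl (by ext v; simp [reGen, reForm])
    have h₂ : imGen (x + y) = imGen x + imGen y :=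
      Prod.ext rfl (by ext v; simp [imGen, imForm])
    refine ⟨?_, ?_⟩
    · rw [h₁, h₂, map_add, hx₁, hy₁]; abel
    · rw [h₁, h₂, map_add, hx₂, hy₂]
  smul_mem' := by
    rintro c x ⟨hx₁, hx₂⟩
    have h₁ : reGen (c • x) = c.re • reGen x - c.im • imGen x :=
      Prod.ext rfl (by ext v; simp [reGen, imGen, reForm, imForm])
    have h₂ : imGen (c • x) = c.re • imGen x + c.im • reGen x :=
      Prod.ext rfl (by ext v; simp [reGen, imGen, reForm, imForm])
    refine ⟨?_, ?_⟩
    · rw [h₁, h₂, map_sub, map_smul, map_smul, hx₁, hx₂]; module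
    · rw [h₁, h₂, map_add, map_smul, map_smul, hx₁, hx₂]; module

/-- The covector `g Y = g(Y, ·)`. -/
def flat {V : Type*} [AddCommGroup V] [Module ℝ V] [TopologicalSpace V]
    (g : V →L[ℝ] V →L[ℝ] ℝ) (Y : V) : V [⋀^Fin 1]→L[ℝ] ℝ :=
  ContinuousAlternatingMap.ofSubsingleton ℝ V ℝ (0 : Fin 1) (g Y)

/-- The `(1,1)`-part `ω = (F + I^* F I) / 2` of a real 2-form, where `I^* F I = F(I·, I·)`. -/
def omegaPart {V : Type*} [AddCommGroup V] [Module ℝ V] [TopologicalSpace V]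
    (I : V →L[ℝ] V) (F : V [⋀^Fin 2]→L[ℝ] ℝ) : V [⋀^Fin 2]→L[ℝ] ℝ :=
  (1 / 2 : ℝ) • (F + F.compContinuousLinearMap I)

/-- The `(2,0) + (0,2)`-part `β = (F - I^* F I) / 2` of a real 2-form. -/
def betaPart {V : Type*} [AddCommGroup V] [Module ℝ V] [TopologicalSpace V]
    (I : V →L[ℝ] V) (F : V [⋀^Fin 2]→L[ℝ] ℝ) : V [⋀^Fin 2]→L[ℝ] ℝ :=
  (1 / 2 : ℝ) • (F - F.compContinuousLinearMap I)

/-- The value at `X + g Y` of the endomorphism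
`𝕁_A = (1/2) [[I₊ + I₋, (I₊ - I₋) g⁻¹], [g (I₊ - I₋), -(I₊^* + I₋^*)]]` of `V ⊕ V^*`.
When `g` is nondegenerate every element of `V ⊕ V^*` has the form `X + g Y`. -/
def formulaA {V : Type*} [AddCommGroup V] [Module ℝ V] [TopologicalSpace V]
    [ContinuousAdd V] (g : V →L[ℝ] V →L[ℝ] ℝ) (Ip Im : V →L[ℝ] V) (X Y : V) : Gen V :=
  (1 / 2 : ℝ) • (((Ip X + Im X) + (Ip Y - Im Y),
    flat g (Ip X - Im X) -
      ((flat g Y).compContinuousLinearMap Ip + (flat g Y).compContinuousLinearMap Im)) : Gen V)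

/-- The value at `X + g Y` of the endomorphism
`𝕁_B = (1/2) [[I₊ - I₋, (I₊ + I₋) g⁻¹], [g (I₊ + I₋), -(I₊^* - I₋^*)]]` of `V ⊕ V^*`. -/
def formulaB {V : Type*} [AddCommGroup V] [Module ℝ V] [TopologicalSpace V]
    [ContinuousAdd V] (g : V →L[ℝ] V →L[ℝ] ℝ) (Ip Im : V →L[ℝ] V) (X Y : V) : Gen V :=
  (1 / 2 : ℝ) • (((Ip X - Im X) + (Ip Y + Im Y),
    flat g (Ip X + Im X) -
      ((flat g Y).compContinuousLinearMap Ip - (flat g Y).compContinuousLinearMap Im)) : Gen V)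

end Pointwise

/-! ## Differential calculus on a manifold modelled on `E` -/

section Manifold

/-- Fields of alternating `k`-forms on `M` with values in `F` (no smoothness). -/
abbrev FormField (E M F : Type*) [NormedAddCommGroup E] [NormedSpace ℝ E]
    [TopologicalSpace M] [ChartedSpace E M] [NormedAddCommGroup F] [NormedSpace ℝ F]
    (k : ℕ) : Type _ :=
  (p : M) → TangentSpace 𝓘(ℝ, E) p [⋀^Fin k]→L[ℝ] F

/-- Fields of endomorphisms of the tangent bundle (no smoothness). -/
abbrev EndField (E M : Type*) [NormedAddCommGroup E] [NormedSpace ℝ E]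
    [TopologicalSpace M] [ChartedSpace E M] : Type _ :=
  (p : M) → TangentSpace 𝓘(ℝ, E) p →L[ℝ] TangentSpace 𝓘(ℝ, E) p

/-- Fields of bilinear forms on the tangent bundle (no smoothness). -/
abbrev BilinField (E M : Type*) [NormedAddCommGroup E] [NormedSpace ℝ E]
    [TopologicalSpace M] [ChartedSpace E M] : Type _ :=
  (p : M) → TangentSpace 𝓘(ℝ, E) p →L[ℝ] TangentSpace 𝓘(ℝ, E) p →L[ℝ] ℝ

/-- Real vector fields (no smoothness). -/
abbrev VField (E M : Type*) [NormedAddCommGroup E] [NormedSpace ℝ E]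
    [TopologicalSpace M] [ChartedSpace E M] : Type _ :=
  (p : M) → TangentSpace 𝓘(ℝ, E) p

/-- Complex vector fields (no smoothness). -/
abbrev VFieldC (E M : Type*) [NormedAddCommGroup E] [NormedSpace ℝ E]
    [TopologicalSpace M] [ChartedSpace E M] : Type _ :=
  (p : M) → Cplx (TangentSpace 𝓘(ℝ, E) p)

/-- Sections of `𝕋M = TM ⊕ T^*M` (no smoothness). -/
abbrev GenField (E M : Type*) [NormedAddCommGroup E] [NormedSpace ℝ E]
    [TopologicalSpace M] [ChartedSpace E M] : Type _ :=
  (p : M) → Gen (TangentSpace 𝓘(ℝ, E) p)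

/-- Sections of `𝕋_ℂ M` (no smoothness). -/
abbrev GenFieldC (E M : Type*) [NormedAddCommGroup E] [NormedSpace ℝ E]
    [TopologicalSpace M] [ChartedSpace E M] : Type _ :=
  (p : M) → GenC (TangentSpace 𝓘(ℝ, E) p)

/-- Families of complex subspaces of the fibres of `𝕋_ℂ M` (no smoothness). -/
abbrev SubField (E M : Type*) [NormedAddCommGroup E] [NormedSpace ℝ E]
    [TopologicalSpace M] [ChartedSpace E M] : Type _ :=
  (p : M) → Submodule ℂ (GenC (TangentSpace 𝓘(ℝ, E) p))

variable {E M F : Type*} [NormedAddCommGroup E] [NormedSpace ℝ E]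
  [TopologicalSpace M] [ChartedSpace E M] [NormedAddCommGroup F] [NormedSpace ℝ F]

/-- The form `η` in the chart around `x`, as a form on the model space. -/
def formInChart {k : ℕ} (η : FormField E M F k) (x : M) (y : E) : E [⋀^Fin k]→L[ℝ] F :=
  (η ((extChartAt 𝓘(ℝ, E) x).symm y)).compContinuousLinearMap
    (mfderiv 𝓘(ℝ, E) 𝓘(ℝ, E) (extChartAt 𝓘(ℝ, E) x).symm y)

/-- Smoothness of a form on an open set `U`: smoothness in every chart. -/
def SmoothFormOn {k : ℕ} (U : Set M) (η : FormField E M F k) : Prop :=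
  ∀ x : M, ContDiffOn ℝ ∞ (formInChart η x)
    ((extChartAt 𝓘(ℝ, E) x).target ∩ (extChartAt 𝓘(ℝ, E) x).symm ⁻¹' U)

/-- The exterior derivative, computed at `p` in the chart around `p`. -/
def extD {k : ℕ} (η : FormField E M F k) : FormField E M F (k + 1) := fun p =>
  (extDeriv (formInChart η p) (extChartAt 𝓘(ℝ, E) p p)).compContinuousLinearMap
    (mfderiv 𝓘(ℝ, E) 𝓘(ℝ, E) (extChartAt 𝓘(ℝ, E) p) p)

variable [IsManifold 𝓘(ℝ, E) ∞ M]

/-- Smoothness of a real vector field on an open set `U`. -/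
def SmoothVOn (U : Set M) (X : VField E M) : Prop :=
  ContMDiffOn 𝓘(ℝ, E) 𝓘(ℝ, E).tangent ∞ (fun p => (⟨p, X p⟩ : TangentBundle 𝓘(ℝ, E) M)) U

/-- Smoothness of a complex vector field on an open set `U`. -/
def SmoothVCOn (U : Set M) (Z : VFieldC E M) : Prop :=
  SmoothVOn U (fun p => (Z p).re) ∧ SmoothVOn U (fun p => (Z p).im)

/-- Smoothness of a section of `𝕋M` on an open set `U`. -/
def SmoothGenOn (U : Set M) (s : GenField E M) : Prop :=
  SmoothVOn U (fun p => (s p).1) ∧ SmoothFormOn U (fun p => (s p).2)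

/-- Smoothness of a section of `𝕋_ℂ M` on an open set `U`. -/
def SmoothGenCOn (U : Set M) (s : GenFieldC E M) : Prop :=
  SmoothVCOn U (fun p => (s p).1) ∧ SmoothFormOn U (fun p => (s p).2)

/-- The complex-bilinear extension of the Lie bracket to complex vector fields. -/
def lieC (Z W : VFieldC E M) : VFieldC E M := fun p =>
  Cplx.mk
    (VectorField.mlieBracket 𝓘(ℝ, E) (fun q => (Z q).re) (fun q => (W q).re) p -
      VectorField.mlieBracket 𝓘(ℝ, E) (fun q => (Z q).im) (fun q => (W q).im) p)
    (VectorField.mlieBracket 𝓘(ℝ, E) (fun q => (Z q).re) (fun q => (W q).im) p +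
      VectorField.mlieBracket 𝓘(ℝ, E) (fun q => (Z q).im) (fun q => (W q).re) p)

/-- The `H`-twisted Courant bracket
`[X + α, Y + β]_H = [X, Y] + L_X β - ι_Y dα + ι_X ι_Y H` on sections of `𝕋_ℂ M`, with
`L_X β = d ι_X β + ι_X dβ`. -/
def courant (H : FormField E M ℂ 3) (s t : GenFieldC E M) : GenFieldC E M := fun p =>
  (lieC (fun q => (s q).1) (fun q => (t q).1) p,
    extD (fun q => contract (s q).1 (t q).2) p + contract (s p).1 (extD (fun q => (t q).2) p)
      - contract (t p).1 (extD (fun q => (s q).2) p)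
      + contract (s p).1 (contract (t p).1 (H p)))

/-! ## Complex manifolds and holomorphic Manin triples -/

variable (E M) in
/-- A complex structure on `M`: a smooth endomorphism field with `J² = -1` and vanishing
Nijenhuis tensor. -/
structure ComplexStructure where
  /-- The endomorphism field. -/
  J : EndField E M
  smooth : ContMDiff 𝓘(ℝ, E) (𝓘(ℝ, E).prod 𝓘(ℝ, E →L[ℝ] E)) ∞
    (fun p => Bundle.TotalSpace.mk' (E →L[ℝ] E)
      (E := fun p : M => TangentSpace 𝓘(ℝ, E) p →L[ℝ] TangentSpace 𝓘(ℝ, E) p) p (J p))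
  sq : ∀ (p : M) (v : TangentSpace 𝓘(ℝ, E) p), J p (J p v) = -v
  integrable : ∀ (U : Set M), IsOpen U → ∀ X Y : VField E M, SmoothVOn U X → SmoothVOn U Y →
    ∀ p ∈ U, VectorField.mlieBracket 𝓘(ℝ, E) (fun q => J q (X q)) (fun q => J q (Y q)) p
      - J p (VectorField.mlieBracket 𝓘(ℝ, E) (fun q => J q (X q)) Y p)
      - J p (VectorField.mlieBracket 𝓘(ℝ, E) X (fun q => J q (Y q)) p)
      - VectorField.mlieBracket 𝓘(ℝ, E) X Y p = 0

/-- The Dolbeault operator `D̄ = [[∂̄, 0], [H^{2,1}, ∂̄]]` of `𝕋_{1,0}`, in the direction of a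
`(0,1)`-field `X`: on `Y + β` it is `∂̄_X Y + ∂̄_X β + ι_X ι_Y H^{2,1}`, where `∂̄_X Y` is the
`(1,0)`-part of `[X, Y]` and `∂̄_X β = ι_X (dβ)^{1,1}` is the `(1,0)`-part of `ι_X dβ`. -/
def dolbeault (J : EndField E M) (H21 : FormField E M ℂ 3) (X : VFieldC E M)
    (s : GenFieldC E M) : GenFieldC E M := fun p =>
  (proj10 (J p) (lieC X (fun q => (s q).1) p),
    coproj10 (J p) (contract (X p) (extD (fun q => (s q).2) p))
      + contract (X p) (contract (s p).1 (H21 p)))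

/-- The bracket `[X, Y] + (∂ ι_X + ι_X ∂) β - ι_Y ∂α + ι_X ι_Y H^{3,0}` on sections `X + α`,
`Y + β` of `𝕋_{1,0}`; here `∂f` is the `(1,0)`-part of `df`, and `ι_X ∂β = ι_X (dβ)^{2,0}` is the
`(1,0)`-part of `ι_X dβ`. -/
def bracket10 (J : EndField E M) (H30 : FormField E M ℂ 3)
    (s t : GenFieldC E M) : GenFieldC E M := fun p =>
  (lieC (fun q => (s q).1) (fun q => (t q).1) p,
    coproj10 (J p) (extD (fun q => contract (s q).1 (t q).2) p)
      + coproj10 (J p) (contract (s p).1 (extD (fun q => (t q).2) p))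
      - coproj10 (J p) (contract (t p).1 (extD (fun q => (s q).2) p))
      + contract (s p).1 (contract (t p).1 (H30 p)))

/-- `s` restricts to a `D̄`-holomorphic section of `𝕋_{1,0}` on the open set `U`. -/
def IsHolSection (J : EndField E M) (H21 : FormField E M ℂ 3) (U : Set M)
    (s : GenFieldC E M) : Prop :=
  SmoothGenCOn U s ∧ (∀ p ∈ U, s p ∈ gen10 (J p)) ∧
    ∀ W ⊆ U, IsOpen W → ∀ X : VFieldC E M, SmoothVCOn W X → (∀ p ∈ W, X p ∈ tangent01 (J p)) →
      ∀ p ∈ W, dolbeault J H21 X s p = 0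

/-- Holomorphic Dirac structures in `(𝕋_{1,0}, D̄, [·,·]_{1,0})`: maximal isotropic holomorphic
subbundles whose holomorphic sections are closed under the bracket. -/
structure IsHolDirac (J : EndField E M) (H21 H30 : FormField E M ℂ 3) (A : SubField E M) :
    Prop where
  maximal : ∀ p, Maximal (fun L => L ≤ gen10 (J p) ∧ IsIsotropic L) (A p)
  /-- Local frames of holomorphic sections. -/
  frame : ∀ p : M, ∃ U : Set M, IsOpen U ∧ p ∈ U ∧ ∃ (r : ℕ) (s : Fin r → GenFieldC E M),
    (∀ i, IsHolSection J H21 U (s i)) ∧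
      ∀ q ∈ U, LinearIndependent ℂ (fun i => s i q) ∧
        Submodule.span ℂ (Set.range fun i => s i q) = A q
  closed : ∀ U : Set M, IsOpen U → ∀ s t : GenFieldC E M,
    IsHolSection J H21 U s → IsHolSection J H21 U t →
      (∀ q ∈ U, s q ∈ A q) → (∀ q ∈ U, t q ∈ A q) → ∀ q ∈ U, bracket10 J H30 s t q ∈ A q

variable (E M) in
/-- A complex structure on `M` together with a holomorphic exact Manin triple `(ℰ, 𝒜, ℬ)` over the
complex manifold. The holomorphic exact Courant algebroid `ℰ = (𝕋_{1,0}, D̄, [·,·]_{1,0})` is in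
the normal form given by a closed 3-form `ℋ = H^{2,1} + H^{3,0}`. -/
structure HolManinTriple extends ComplexStructure E M where
  /-- The `(2,1)`-component of `ℋ`. -/
  H21 : FormField E M ℂ 3
  /-- The `(3,0)`-component of `ℋ`. -/
  H30 : FormField E M ℂ 3
  smooth21 : SmoothFormOn Set.univ H21
  smooth30 : SmoothFormOn Set.univ H30
  type21 : ∀ p, IsOfType (J p) 2 1 (H21 p)
  type30 : ∀ p, IsOfType (J p) 3 0 (H30 p)
  closed : extD (fun p => H21 p + H30 p) = 0
  /-- The first holomorphic Dirac structure. -/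
  A : SubField E M
  /-- The second holomorphic Dirac structure. -/
  B : SubField E M
  diracA : IsHolDirac J H21 H30 A
  diracB : IsHolDirac J H21 H30 B
  inf_eq : ∀ p, A p ⊓ B p = ⊥
  sup_eq : ∀ p, A p ⊔ B p = gen10 (J p)

/-- The closed 3-form `ℋ = H^{2,1} + H^{3,0}`. -/
def HolManinTriple.H (T : HolManinTriple E M) : FormField E M ℂ 3 :=
  fun p => T.H21 p + T.H30 p

/-! ## Generalized Kähler geometry -/

/-- The operator `d^c = i(∂̄ - ∂) = (J^*)⁻¹ d J^*` on forms; note `(J^*)⁻¹ = (-J)^*`. -/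
def dc {k : ℕ} (J : EndField E M) (η : FormField E M F k) : FormField E M F (k + 1) := fun p =>
  (extD (fun q => (η q).compContinuousLinearMap (J q)) p).compContinuousLinearMap (-(J p))

/-- Consistency of the sign convention: if `η` has type `(1,1)` and `dη = ∂η + ∂̄η` with `∂η` of
type `(2,1)` and `∂̄η` of type `(1,2)`, then `d^c η = i (∂̄η - ∂η)`. -/
theorem dc_eq_of_type (J : EndField E M) (η : FormField E M ℂ 2) (del delbar : FormField E M ℂ 3)
    (hη : ∀ p, IsOfType (J p) 1 1 (η p)) (h : ∀ p, extD η p = del p + delbar p)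
    (hdel : ∀ p, IsOfType (J p) 2 1 (del p)) (hdelbar : ∀ p, IsOfType (J p) 1 2 (delbar p)) (p : M) :
    dc J η p = Complex.I • (delbar p - del p) := by
  have h₁ : (fun q => (η q).compContinuousLinearMap (J q)) = η := by
    funext q
    ext v
    have := hη q 0 1 v
    simp only [zero_smul, one_smul, zero_add] at this
    simpa [Function.comp_def] using this
  ext v
  have h₂ := hdel p 0 (-1) v
  have h₃ := hdelbar p 0 (-1) v
  simp only [zero_smul, neg_smul, one_smul, zero_add] at h₂ h₃
  have h₄ : dc J η p v = del p (fun i => -(J p (v i))) + delbar p (fun i => -(J p (v i))) := by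
    unfold dc
    rw [h₁, h p]
    rfl
  rw [h₄, h₂, h₃]
  simp only [ContinuousAlternatingMap.smul_apply, ContinuousAlternatingMap.sub_apply, smul_eq_mul]
  push_cast
  linear_combination (Complex.I * (del p v - delbar p v)) * Complex.I_sq

/-- Smoothness of a field of bilinear forms. -/
def SmoothBilin (g : BilinField E M) : Prop :=
  ContMDiff 𝓘(ℝ, E) (𝓘(ℝ, E).prod 𝓘(ℝ, E →L[ℝ] E →L[ℝ] ℝ)) ∞
    (fun p => Bundle.TotalSpace.mk' (E →L[ℝ] E →L[ℝ] ℝ)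
      (E := fun p : M => TangentSpace 𝓘(ℝ, E) p →L[ℝ] TangentSpace 𝓘(ℝ, E) p →L[ℝ] ℝ) p (g p))

/-- A generalized complex structure on `(M, H)`. -/
structure IsGeneralizedComplex (H : FormField E M ℝ 3)
    (𝕁 : (p : M) → Gen (TangentSpace 𝓘(ℝ, E) p) →ₗ[ℝ] Gen (TangentSpace 𝓘(ℝ, E) p)) : Prop where
  smooth : ∀ U : Set M, IsOpen U → ∀ s : GenField E M, SmoothGenOn U s →
    SmoothGenOn U (fun p => 𝕁 p (s p))
  sq : ∀ p x, 𝕁 p (𝕁 p x) = -x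
  maximal : ∀ p, Maximal IsIsotropic (plusEigen (𝕁 p))
  involutive : ∀ U : Set M, IsOpen U → ∀ s t : GenFieldC E M,
    SmoothGenCOn U s → SmoothGenCOn U t →
      (∀ p ∈ U, s p ∈ plusEigen (𝕁 p)) → (∀ p ∈ U, t p ∈ plusEigen (𝕁 p)) →
        ∀ p ∈ U, courant (fun q => toC (H q)) s t p ∈ plusEigen (𝕁 p)

/-- A generalized Kähler structure on `(M, H)`: a closed 3-form `H` and commuting generalized
complex structures `𝕁_A`, `𝕁_B` such that `⟨𝕁_A ·, 𝕁_B ·⟩` is a positive definite metric. -/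
structure IsGeneralizedKahler (H : FormField E M ℝ 3)
    (𝕁A 𝕁B : (p : M) → Gen (TangentSpace 𝓘(ℝ, E) p) →ₗ[ℝ] Gen (TangentSpace 𝓘(ℝ, E) p)) :
    Prop where
  smoothH : SmoothFormOn Set.univ H
  closedH : extD H = 0
  complexA : IsGeneralizedComplex H 𝕁A
  complexB : IsGeneralizedComplex H 𝕁B
  comm : ∀ p x, 𝕁A p (𝕁B p x) = 𝕁B p (𝕁A p x)
  symm : ∀ p x y, pair (𝕁A p x) (𝕁B p y) = pair (𝕁A p y) (𝕁B p x)
  pos : ∀ p x, x ≠ 0 → 0 < pair (𝕁A p x) (𝕁B p x)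

end Manifold

end

/-! The proof has a linear-algebraic, a differential and a generalized-geometric stage.

Linear algebra. `L_{𝒜₊}` contains the `(0,1)`-vectors of `X₊`, while every covector occurring in
`L_{𝒜₋}` is of type `(1,0)` for `I₋`. Applying `L_{𝒜₊} = e^{iF₁} L_{𝒜₋}` to `X + i I₊X` therefore
makes `ι_{X + i I₊X} F₁` a `(1,0)`-covector for `I₋`, that is, `F₁(X, I₋Y) = -F₁(I₊X, Y)`
(`gauge_relation`). The conjugated condition gives `F₂(X, I₋Y) = F₂(I₊X, Y)`
(`gauge_conj_relation`). Together they say `F₊(I₊X, Y) = -F₋(X, I₋Y)`: the bilinear forms `-F₊I₊`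
and `-F₋I₋` are transposes of each other. Hence they share a symmetric part `g` and have opposite
skew parts `±b`.

The operator `d^c`. Real and imaginary parts of the gauge equations give `Re ℋ₊ = Re ℋ₋`, `dF₊ = -Im
ℋ₊` and `dF₋ = Im ℋ₋`. For integrable `J` one has `J^* d J^* = i_J d - d i_J` on 2-forms
(`altSum_pull_eq`), so the `(1,1)`-part `ω` of `F` satisfies `d^c ω = d(i_J F)/2 - (i_J + J^*) dF /
2`. On types `(2,1)` and `(3,0)` alike, `i_J + J^*` is multiplication by `2i`
(`insert_add_pull_of_mem`), so it turns `Im ℋ` into `2 Re ℋ`. Since `i_{I_±} F_± = ∓2b`, this yields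
`±d^c_± ω_± = Re ℋ_± - db = H`.

Generalized Kähler structure. If `g` is a metric, `TM ⊕ T^*M` is the orthogonal sum of the graphs of
`g` and `-g`. There `𝕁_A` acts by `I₊` and `I₋`, and `𝕁_B` by `I₊` and `-I₋`, which makes the
algebraic claims block computations. Involutivity amounts to the vanishing of `⟨[𝕁x, 𝕁y] - [x, y],
z⟩ + ⟨[𝕁x, y] + [x, 𝕁y], 𝕁z⟩`. If `x, y, z` are not all in the same graph, `⟨[x, y], z⟩` is, up to
sign, `2g(∇u, v)`: here `u, v` are the two arguments in a common graph, `u` is differentiated along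
the third, and `∇` is the metric connection with torsion `H` or `-H`. The expression then vanishes
because `±d^c_± ω_± = H` makes `I_±` parallel (`IsHermitianJet.isParallelJet`). If all three lie in
one graph, a Lie bracket term is added and the Nijenhuis tensor disposes of it.

All differential identities are checked at a point `p` in the chart around `p`, whose derivative at
`p` is the identity. There they become linear identities between the 1-jets `J, J', g, g'` and `H`.
-/

noncomputable section

/-! ## Matched pairs and types at a point -/

section Pointwise

variable {V : Type*} [AddCommGroup V] [Module ℝ V] [TopologicalSpace V]

/-- The vector `X + i J X` is of type `(0,1)`. -/
theorem mk_mem_tangent01 {J : V →L[ℝ] V} (hJ : ∀ v, J (J v) = -v) (X : V) :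
    Cplx.mk X (J X) ∈ tangent01 J := by
  rw [tangent01, Module.End.mem_eigenspace_iff]
  rw [neg_smul]
  apply Cplx.ext
  · change J X = -(0 • X - 1 • J X)
    simp
  · change J (J X) = -(0 • J X + 1 • X)
    simp [hJ]

/-- A matched pair contains the `(0,1)`-vectors. -/
theorem mk_mem_matchedPair {J : V →L[ℝ] V} (hJ : ∀ v, J (J v) = -v)
    (A : Submodule ℂ (GenC V)) (X : V) :
    ((Cplx.mk X (J X), 0) : GenC V) ∈ matchedPair J A :=
  Submodule.mem_sup_right ⟨mk_mem_tangent01 hJ X, by simp⟩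

/-- The covectors in a matched pair are of type `(1,0)`. -/
theorem snd_mem_cotangent10_of_mem_matchedPair {J : V →L[ℝ] V} {A : Submodule ℂ (GenC V)}
    (hA : A ≤ gen10 J) {x : GenC V} (hx : x ∈ matchedPair J A) : x.2 ∈ cotangent10 J := by
  obtain ⟨y, hy, z, hz, rfl⟩ := Submodule.mem_sup.1 hx
  have hz0 : z.2 = 0 := by simpa using hz.2
  simpa [hz0] using (hA hy).2

theorem apply_of_mem_cotangent10 {J : V →L[ℝ] V} {α : V [⋀^Fin 1]→L[ℝ] ℂ}
    (hα : α ∈ cotangent10 J) (v : V) : α ![J v] = Complex.I * α ![v] := by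
  rw [cotangent10, Module.End.mem_eigenspace_iff] at hα
  have h : α (fun i => J ((![v] : Fin 1 → V) i)) = Complex.I * α ![v] :=
    DFunLike.congr_fun hα ![v]
  have e : (fun i => J ((![v] : Fin 1 → V) i)) = ![J v] := by
    ext i; fin_cases i; rfl
  rwa [e] at h

theorem contract_mk_I_toC_apply (F : V [⋀^Fin 2]→L[ℝ] ℝ) (X Y W : V) :
    contract (Cplx.mk X Y) (Complex.I • toC F) ![W] =
      Complex.I * (F ![X, W] + Complex.I * F ![Y, W]) := by
  have : contract (Cplx.mk X Y) (Complex.I • toC F) ![W]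
    = (Complex.I • toC F) ![X, W] + Complex.I * (Complex.I • toC F) ![Y, W] := rfl
  rw [this]
  simp [toC]
  ring

/-- If the gauge transformation `e^{iF}` carries a matched pair for `J₂` to one for `J₁`, then
`ι_{X + i J₁ X} F` is a `(1,0)`-covector for `J₂`. -/
theorem gauge_relation {J₁ J₂ : V →L[ℝ] V} (hJ₁ : ∀ v, J₁ (J₁ v) = -v)
    {A₁ A₂ : Submodule ℂ (GenC V)} (hA₂ : A₂ ≤ gen10 J₂) (F : V [⋀^Fin 2]→L[ℝ] ℝ)
    (h : matchedPair J₁ A₁ = (matchedPair J₂ A₂).map (gaugeMap (Complex.I • toC F))) (X Y : V) :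
    F ![X, J₂ Y] = -F ![J₁ X, Y] := by
  -- The gauge transformation fixes vector parts, so `z` has vector part `X + i J₁X`, and its
  -- covector must be `-ι_{X + i J₁X}(iF)` to cancel the gauge term.
  obtain ⟨z, hz, hzx⟩ := h ▸ mk_mem_matchedPair hJ₁ A₁ X
  have h1 : z.1 = Cplx.mk X (J₁ X) := congrArg Prod.fst hzx
  have h2 : z.2 + contract z.1 (Complex.I • toC F) = 0 := congrArg Prod.snd hzx
  have h3 : z.2 = -contract (Cplx.mk X (J₁ X)) (Complex.I • toC F) := by
    rw [← h1]; exact eq_neg_of_add_eq_zero_left h2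
  have h4 := apply_of_mem_cotangent10 (snd_mem_cotangent10_of_mem_matchedPair hA₂ hz) Y
  rw [h3, ContinuousAlternatingMap.neg_apply, ContinuousAlternatingMap.neg_apply,
    contract_mk_I_toC_apply, contract_mk_I_toC_apply] at h4
  -- `F` is real, so the imaginary part isolates the terms with exactly one of `J₁`, `J₂`.
  have := congrArg Complex.im h4
  simp at this
  linarith

/-- If `e^{iF}` carries a matched pair for `J₁` to the conjugate of one for `J₂`, then
`ι_{X + i J₁ X} F` is a `(0,1)`-covector for `J₂`. -/
theorem gauge_conj_relation {J₁ J₂ : V →L[ℝ] V} (hJ₁ : ∀ v, J₁ (J₁ v) = -v)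
    {B₁ B₂ : Submodule ℂ (GenC V)} (hB₂ : B₂ ≤ gen10 J₂) (F : V [⋀^Fin 2]→L[ℝ] ℝ)
    (h : (matchedPair J₂ B₂).map conjGen =
      (matchedPair J₁ B₁).map (gaugeMap (Complex.I • toC F))) (X Y : V) :
    F ![X, J₂ Y] = F ![J₁ X, Y] := by
  obtain ⟨z, hz, hzx⟩ := h.symm ▸ Submodule.mem_map_of_mem (mk_mem_matchedPair hJ₁ B₁ X)
  have h2 : conjForm z.2 = 0 + contract (Cplx.mk X (J₁ X)) (Complex.I • toC F) :=
    congrArg Prod.snd hzx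
  -- The hypothesis controls the conjugate of `z.2`; conjugating back gives the `(1,0)`-covector
  -- itself and is responsible for the sign opposite to `gauge_relation`.
  have h3 : ∀ W, z.2 ![W] = star (Complex.I * (F ![X, W] + Complex.I * F ![J₁ X, W])) := by
    intro W
    have h4 : star (z.2 ![W]) = _ := DFunLike.congr_fun h2 ![W]
    rw [zero_add, contract_mk_I_toC_apply] at h4
    rw [← h4, star_star]
  have h4 := apply_of_mem_cotangent10 (snd_mem_cotangent10_of_mem_matchedPair hB₂ hz) Y
  rw [h3, h3] at h4
  have := congrArg Complex.im h4
  simp at this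
  linarith

theorem two_form_swap {F : Type*} [AddCommGroup F] [Module ℝ F] [TopologicalSpace F]
    (α : V [⋀^Fin 2]→L[ℝ] F) (X Y : V) : α ![X, Y] = -α ![Y, X] := by
  have h := α.toAlternatingMap.map_swap ![Y, X] (i := 0) (j := 1) (by decide)
  have e : ![Y, X] ∘ Equiv.swap (0 : Fin 2) 1 = ![X, Y] := by
    ext i; fin_cases i <;> rfl
  rwa [e] at h

theorem three_form_rotate {F : Type*} [AddCommGroup F] [Module ℝ F] [TopologicalSpace F]
    (α : V [⋀^Fin 3]→L[ℝ] F) (x y z : V) : α ![x, y, z] = α ![y, z, x] := by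
  have h1 : α (![x, y, z] ∘ Equiv.swap (0 : Fin 3) 1) = -α ![x, y, z] :=
    α.toAlternatingMap.map_swap ![x, y, z] (i := 0) (j := 1) (by decide)
  have h2 : α (![y, x, z] ∘ Equiv.swap (1 : Fin 3) 2) = -α ![y, x, z] :=
    α.toAlternatingMap.map_swap ![y, x, z] (i := 1) (j := 2) (by decide)
  have e1 : ![x, y, z] ∘ Equiv.swap (0 : Fin 3) 1 = ![y, x, z] := by
    ext i; fin_cases i <;> rfl
  have e2 : ![y, x, z] ∘ Equiv.swap (1 : Fin 3) 2 = ![y, z, x] := by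
    ext i; fin_cases i <;> rfl
  rw [e1] at h1; rw [e2] at h2
  rw [h2, h1, neg_neg]

theorem three_form_swap {F : Type*} [AddCommGroup F] [Module ℝ F] [TopologicalSpace F]
    (α : V [⋀^Fin 3]→L[ℝ] F) (x y z : V) : α ![x, y, z] = -α ![y, x, z] := by
  have h1 : α (![y, x, z] ∘ Equiv.swap (0 : Fin 3) 1) = -α ![y, x, z] :=
    α.toAlternatingMap.map_swap ![y, x, z] (i := 0) (j := 1) (by decide)
  have e1 : ![y, x, z] ∘ Equiv.swap (0 : Fin 3) 1 = ![x, y, z] := by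
    ext i; fin_cases i <;> rfl
  rwa [e1] at h1

/-- The sum of a multilinear form of type `(2,1)` and one of type `(3,0)` is an eigenvector for
the eigenvalue `2i` of the operator inserting `J` in one slot or in all slots. -/
theorem insert_add_pull_of_mem {J : V →L[ℝ] V} {α : V [⋀^Fin 3]→L[ℝ] ℂ}
    (h : IsOfType J 2 1 α ∨ IsOfType J 3 0 α) (X Y Z : V) :
    α ![J X, Y, Z] + α ![X, J Y, Z] + α ![X, Y, J Z] + α ![J X, J Y, J Z] =
      2 * Complex.I * α ![X, Y, Z] := by
  -- The form evaluated on `(1 + bJ)X, (1 + bJ)Y, (1 + bJ)Z` is a cubic polynomial in `b`, whose odd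
  -- coefficients are exactly the insertions of `J` in one slot and in all slots.
  have key : ∀ b : ℝ, α (fun i => (1 : ℝ) • ![X, Y, Z] i + b • J (![X, Y, Z] i)) =
      α ![X, Y, Z] + b * (α ![J X, Y, Z] + α ![X, J Y, Z] + α ![X, Y, J Z]) +
      b ^ 2 * (α ![J X, J Y, Z] + α ![X, J Y, J Z] + α ![J X, Y, J Z]) +
      b ^ 3 * α ![J X, J Y, J Z] := by
    intro b
    have e : (fun i => (1 : ℝ) • ![X, Y, Z] i + b • J (![X, Y, Z] i)) =
        ![X + b • J X, Y + b • J Y, Z + b • J Z] := by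
      ext i; fin_cases i <;> simp
    have a0 : ∀ (x x' y z : V), α ![x + b • x', y, z] = α ![x, y, z] + b * α ![x', y, z] := by
      intro x x' y z
      have h1 := α.toMultilinearMap.cons_add ![y, z] x (b • x')
      have h2 := α.toMultilinearMap.cons_smul ![y, z] b x'
      rw [Complex.real_smul] at h2
      exact h1.trans (congrArg (fun t => α ![x, y, z] + t) h2)
    have p1 := three_form_rotate α
    have a1 : ∀ (x y y' z : V), α ![x, y + b • y', z] = α ![x, y, z] + b * α ![x, y', z] := by
      intro x y y' z
      rw [p1 x, a0, p1 x, p1 x]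
    have a2 : ∀ (x y z z' : V), α ![x, y, z + b • z'] = α ![x, y, z] + b * α ![x, y, z'] := by
      intro x y z z'
      rw [p1 x, a1, p1 x, p1 x]
    rw [e]
    simp only [a0, a1, a2]
    ring
  -- Half the difference of the values at `b = 1` and `b = -1` is the odd part. The type condition
  -- evaluates it through `((1+i)²(1-i) - (1-i)²(1+i))/2 = 2i` and `((1+i)³ - (1-i)³)/2 = 2i`.
  have k1 := key 1
  have k2 := key (-1)
  rcases h with h | h
  · rw [h] at k1 k2
    push_cast at k1 k2
    linear_combination (-1 / 2) * k1 + (1 / 2) * k2 + (-α ![X, Y, Z] * Complex.I) * Complex.I_sq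
  · rw [h] at k1 k2
    push_cast at k1 k2
    linear_combination (-1 / 2) * k1 + (1 / 2) * k2 + (α ![X, Y, Z] * Complex.I) * Complex.I_sq

end Pointwise

/-! ## Identities between first-order jets at a point -/

section Jets

variable {E : Type*} [AddCommGroup E] [Module ℝ E]

/-- The 1-jet of an integrable almost complex structure: `J' X` is the derivative in direction
`X`, and the last condition is the vanishing of the Nijenhuis tensor. -/
structure IsComplexJet (J : E →ₗ[ℝ] E) (J' : E →ₗ[ℝ] E →ₗ[ℝ] E) : Prop where
  sq : ∀ X, J (J X) = -X
  sq' : ∀ X Y, J' X (J Y) = -J (J' X Y)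
  nijenhuis : ∀ X Y, J' (J X) Y - J' (J Y) X = J (J' X Y - J' Y X)

theorem IsComplexJet.neg {J : E →ₗ[ℝ] E} {J' : E →ₗ[ℝ] E →ₗ[ℝ] E} (h : IsComplexJet J J') :
    IsComplexJet (-J) (-J') where
  sq X := by simp [h.sq]
  sq' X Y := by simp [h.sq']
  nijenhuis X Y := by
    have := h.nijenhuis X Y
    simp only [LinearMap.neg_apply, map_neg, neg_neg, map_sub, map_add, sub_neg_eq_add] at this ⊢
    rw [this]
    abel

/-- Apply `J` to the Nijenhuis identity and move `J` through `J'` by `J'J = -JJ'`. This form has no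
outer `J`, so it can be contracted directly with a 2-form or a metric. -/
theorem IsComplexJet.nijenhuis' {J : E →ₗ[ℝ] E} {J' : E →ₗ[ℝ] E →ₗ[ℝ] E} (h : IsComplexJet J J')
    (X Y : E) : J' (J X) (J Y) - J' (J Y) (J X) = J' X Y - J' Y X := by
  have h1 := congrArg J (h.nijenhuis X Y)
  rw [map_sub, h.sq] at h1
  rw [h.sq', h.sq', neg_sub_neg, ← neg_sub, h1, neg_neg]

/-- The exterior derivative of a 2-form with derivative `B'`. -/
def altSum (B' : E → E → E → ℝ) (X Y Z : E) : ℝ := B' X Y Z - B' Y X Z + B' Z X Y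

/-- For an integrable `J` the operators `J^* d J^*` and `i_J d - d i_J` agree on 2-forms. -/
theorem altSum_pull_eq {J : E →ₗ[ℝ] E} {J' : E →ₗ[ℝ] E →ₗ[ℝ] E} (h : IsComplexJet J J')
    (F : E →ₗ[ℝ] E →ₗ[ℝ] ℝ) (F' : E →ₗ[ℝ] E →ₗ[ℝ] E →ₗ[ℝ] ℝ)
    (hF : ∀ X Y, F X Y = -F Y X) (X Y Z : E) :
    altSum (fun X Y Z => F' X (J Y) (J Z) + F (J' X Y) (J Z) + F (J Y) (J' X Z))
        (J X) (J Y) (J Z) =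
      altSum (fun X Y Z => F' X Y Z) (J X) Y Z + altSum (fun X Y Z => F' X Y Z) X (J Y) Z +
        altSum (fun X Y Z => F' X Y Z) X Y (J Z) -
      altSum (fun X Y Z => F' X (J Y) Z + F' X Y (J Z) + F (J' X Y) Z + F Y (J' X Z)) X Y Z := by
  simp only [altSum, h.sq, map_neg, LinearMap.neg_apply]
  -- The terms in `F'` cancel identically. What remains is the Nijenhuis identity contracted with
  -- `F` for each of the three pairs of arguments.
  have n1 := congrArg (fun t => F t Z) (h.nijenhuis' X Y)
  have n2 := congrArg (fun t => F t Y) (h.nijenhuis' X Z)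
  have n3 := congrArg (fun t => F t X) (h.nijenhuis' Y Z)
  simp only [map_sub, LinearMap.sub_apply] at n1 n2 n3
  linarith [hF Z (J' (J X) (J Y)), hF Z (J' (J Y) (J X)), hF Y (J' (J X) (J Z)),
    hF Y (J' (J Z) (J X)), hF X (J' (J Y) (J Z)), hF X (J' (J Z) (J Y)),
    hF Z (J' X Y), hF Z (J' Y X), hF Y (J' X Z), hF Y (J' Z X), hF X (J' Y Z), hF X (J' Z Y)]

/-- The 1-jet of a metric `g` which is Hermitian for `J`. -/
structure IsHermitianJet (g : E →ₗ[ℝ] E →ₗ[ℝ] ℝ) (g' : E →ₗ[ℝ] E →ₗ[ℝ] E →ₗ[ℝ] ℝ)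
    (J : E →ₗ[ℝ] E) (J' : E →ₗ[ℝ] E →ₗ[ℝ] E) : Prop extends IsComplexJet J J' where
  symm : ∀ X Y, g X Y = g Y X
  symm' : ∀ W X Y, g' W X Y = g' W Y X
  skew : ∀ X Y, g (J X) Y = -g X (J Y)
  skew' : ∀ W X Y, g' W (J X) Y + g (J' W X) Y = -(g' W X (J Y) + g X (J' W Y))

/-- No positivity is part of a Hermitian jet, so statements about the graph of `g` apply to the
graph of `-g` as well. -/
theorem IsHermitianJet.neg_left {g : E →ₗ[ℝ] E →ₗ[ℝ] ℝ} {g' : E →ₗ[ℝ] E →ₗ[ℝ] E →ₗ[ℝ] ℝ}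
    {J : E →ₗ[ℝ] E} {J' : E →ₗ[ℝ] E →ₗ[ℝ] E} (h : IsHermitianJet g g' J J') :
    IsHermitianJet ((-1 : ℝ) • g) ((-1 : ℝ) • g') J J' where
  toIsComplexJet := h.toIsComplexJet
  symm X Y := by simp [h.symm X Y]
  symm' W X Y := by simp [h.symm' W X Y]
  skew X Y := by simp [h.skew X Y]
  skew' W X Y := by
    have := h.skew' W X Y
    simp only [LinearMap.smul_apply, smul_eq_mul]
    linarith

/-- Needed for `𝕁_B`, which acts by `-I₋` on the graph of `-g`. -/
theorem IsHermitianJet.neg_right {g : E →ₗ[ℝ] E →ₗ[ℝ] ℝ} {g' : E →ₗ[ℝ] E →ₗ[ℝ] E →ₗ[ℝ] ℝ}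
    {J : E →ₗ[ℝ] E} {J' : E →ₗ[ℝ] E →ₗ[ℝ] E} (h : IsHermitianJet g g' J J') :
    IsHermitianJet g g' (-J) (-J') where
  toIsComplexJet := h.toIsComplexJet.neg
  symm := h.symm
  symm' := h.symm'
  skew X Y := by simp [h.skew X Y]
  skew' W X Y := by
    have := h.skew' W X Y
    simp only [LinearMap.neg_apply, map_neg]
    linarith

/-- The expression `g'_X(Y, Z) - g'_Y(X, Z) + g'_Z(X, Y) - H(X, Y, Z)`: the lowered Christoffel
symbol of the metric connection with torsion `H`. -/
def christoffel (g' : E →ₗ[ℝ] E →ₗ[ℝ] E →ₗ[ℝ] ℝ) (H : E → E → E → ℝ) (X Y Z : E) : ℝ :=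
  altSum (fun X Y Z => g' X Y Z) X Y Z - H X Y Z

/-- `J` is parallel for the metric connection with torsion `H`. -/
def IsParallelJet (g : E →ₗ[ℝ] E →ₗ[ℝ] ℝ) (g' : E →ₗ[ℝ] E →ₗ[ℝ] E →ₗ[ℝ] ℝ)
    (H : E → E → E → ℝ) (J : E →ₗ[ℝ] E) (J' : E →ₗ[ℝ] E →ₗ[ℝ] E) : Prop :=
  ∀ X Y Z, 2 * g (J' Z X) (J Y) + christoffel g' H (J X) (J Y) Z - christoffel g' H X Y Z = 0

/-- The terms of the parallelism condition involving `J` are quadratic in the pair `(J, J')`, so the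
sign cancels. -/
theorem IsParallelJet.neg {g : E →ₗ[ℝ] E →ₗ[ℝ] ℝ} {g' : E →ₗ[ℝ] E →ₗ[ℝ] E →ₗ[ℝ] ℝ}
    {H : E →ₗ[ℝ] E →ₗ[ℝ] E →ₗ[ℝ] ℝ} {J : E →ₗ[ℝ] E} {J' : E →ₗ[ℝ] E →ₗ[ℝ] E}
    (h : IsParallelJet g g' (fun X Y Z => H X Y Z) J J') :
    IsParallelJet g g' (fun X Y Z => H X Y Z) (-J) (-J') := by
  intro X Y Z
  have := h X Y Z
  simp only [christoffel, altSum, LinearMap.neg_apply, map_neg] at this ⊢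
  linarith

/-- The condition `d^c ω = H` with `ω = g J` makes `J` parallel for the connection with
torsion `H`. -/
theorem IsHermitianJet.isParallelJet {g : E →ₗ[ℝ] E →ₗ[ℝ] ℝ}
    {g' : E →ₗ[ℝ] E →ₗ[ℝ] E →ₗ[ℝ] ℝ} {J : E →ₗ[ℝ] E} {J' : E →ₗ[ℝ] E →ₗ[ℝ] E}
    (h : IsHermitianJet g g' J J') (H : E →ₗ[ℝ] E →ₗ[ℝ] E →ₗ[ℝ] ℝ)
    (hH : ∀ X Y Z, H X Y Z =
      -altSum (fun X Y Z => g' X (J Y) Z + g (J' X Y) Z) (J X) (J Y) (J Z)) :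
    IsParallelJet g g' (fun X Y Z => H X Y Z) J J' := by
  intro X Y Z
  simp only [christoffel, hH, altSum, h.sq, map_neg, LinearMap.neg_apply]
  -- This is the classical expression of `g((∇_Z J)X, ·)` through `dω` and the Nijenhuis tensor. The
  -- identities `n1` to `n3` remove the Nijenhuis terms; `q1` to `q6`, derivatives of the skewness
  -- of `J`, bring the terms in `g'` to a common form.
  have n1 := congrArg (fun t => g t (J Z)) (h.nijenhuis' X Y)
  have n1' := congrArg (fun t => g t Z) (h.nijenhuis X Y)
  have n2 := congrArg (fun t => g t Y) (h.nijenhuis Z X)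
  have n3 := congrArg (fun t => g t X) (h.nijenhuis Z Y)
  simp only [map_sub, LinearMap.sub_apply, h.skew] at n1 n1' n2 n3
  have q1 := h.skew' X Y (J Z)
  have q2 := h.skew' Y X (J Z)
  have q3 := h.skew' (J X) Y Z
  have q4 := h.skew' (J Y) X Z
  have q5 := h.skew' Z X (J Y)
  have q6 := h.skew' (J Z) X Y
  simp only [h.sq, h.sq', map_neg] at q1 q2 q5
  have s : ∀ X Y, g X (J Y) = - g (J X) Y := fun X Y => by rw [h.skew]; ring
  have t1 := h.sq' (J Z) X
  simp only [h.sq', map_neg, LinearMap.neg_apply, h.skew, h.sq, neg_neg] at *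
  linarith [h.symm Y (J' (J X) Z), h.symm X (J' (J Y) Z), h.symm X (J' (J Z) Y),
    h.symm Y (J (J' X Z)), h.symm X (J (J' Y Z)), h.symm X (J (J' Z Y)), h.symm Y (J (J' Z X)),
    s (J' X Z) Y, s (J' Z X) Y, s (J' Y Z) X, s (J' Z Y) X, h.symm (J' Z X) (J Y),
    h.symm (J' X Z) (J Y), h.symm (J' Y Z) (J X), h.symm (J' Z Y) (J X),
    h.skew Y (J' X Z), h.skew X (J' Y Z), h.skew X (J' Z Y), h.skew Y (J' Z X),
    h.symm' Z X Y, h.symm' X (J Y) Z, h.symm' Y (J X) Z]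

/-- The value of `⟨[x, y]_H, z⟩` for the sections `x = X + a g X`, `y = Y + b g Y` and the vector
`z = Z + c g Z`, in terms of the 1-jets of `X`, `Y` and `g`. -/
def courantJet (g : E →ₗ[ℝ] E →ₗ[ℝ] ℝ) (g' : E →ₗ[ℝ] E →ₗ[ℝ] E →ₗ[ℝ] ℝ) (H : E → E → E → ℝ)
    (a b c : ℝ) (X : E) (X' : E → E) (Y : E) (Y' : E → E) (Z : E) : ℝ :=
  (b + c) * g (Y' X) Z - (a + c) * g (X' Y) Z + (a + b) * g (X' Z) Y +
    b * g' X Y Z - a * g' Y X Z + a * g' Z X Y - H X Y Z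

/-- The Courant-Nijenhuis tensor of the endomorphism acting by `Ja`, `Jb`, `Jc` on the graphs of
`a g`, `b g`, `c g`. -/
def nijenhuisJet (g : E →ₗ[ℝ] E →ₗ[ℝ] ℝ) (g' : E →ₗ[ℝ] E →ₗ[ℝ] E →ₗ[ℝ] ℝ) (H : E → E → E → ℝ)
    (a b c : ℝ) (Ja : E →ₗ[ℝ] E) (Ja' : E →ₗ[ℝ] E →ₗ[ℝ] E) (Jb : E →ₗ[ℝ] E)
    (Jb' : E →ₗ[ℝ] E →ₗ[ℝ] E) (Jc : E →ₗ[ℝ] E)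
    (X : E) (X' : E → E) (Y : E) (Y' : E → E) (Z : E) : ℝ :=
  courantJet g g' H a b c (Ja X) (fun W => Ja' W X + Ja (X' W)) (Jb Y)
      (fun W => Jb' W Y + Jb (Y' W)) Z -
    courantJet g g' H a b c X X' Y Y' Z +
    courantJet g g' H a b c (Ja X) (fun W => Ja' W X + Ja (X' W)) Y Y' (Jc Z) +
    courantJet g g' H a b c X X' (Jb Y) (fun W => Jb' W Y + Jb (Y' W)) (Jc Z)

/-! ### Vanishing of the Courant-Nijenhuis tensor for each pattern of signs -/

section Vanishing

variable {g : E →ₗ[ℝ] E →ₗ[ℝ] ℝ} {g' : E →ₗ[ℝ] E →ₗ[ℝ] E →ₗ[ℝ] ℝ}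
  {J : E →ₗ[ℝ] E} {J' : E →ₗ[ℝ] E →ₗ[ℝ] E}
  {H : E →ₗ[ℝ] E →ₗ[ℝ] E →ₗ[ℝ] ℝ}

/-- For signs `(1, 1, -1)` the Courant expression is `2g(∇_Z X, Y)` with `∇` of torsion `H`. The
four terms are then parallelism in direction `Z` and in direction `KZ`; the third endomorphism only
moves the direction, so any `K` will do. -/
theorem nijenhuisJet_eq_zero₁ (h : IsHermitianJet g g' J J')
    (hp : IsParallelJet g g' (fun X Y Z => H X Y Z) J J')
    (K : E →ₗ[ℝ] E) (X : E) (X' : E → E) (Y : E) (Y' : E → E) (Z : E) :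
    nijenhuisJet g g' (fun X Y Z => H X Y Z) 1 1 (-1) J J' J J' K X X' Y Y' Z = 0 := by
  have h1 := hp X Y Z
  have h2 := hp (J X) Y (K Z)
  simp only [nijenhuisJet, courantJet, christoffel, altSum, map_add, LinearMap.add_apply, h.sq,
    h.sq', h.skew, map_neg, LinearMap.neg_apply] at h1 h2 ⊢
  linarith

/-- For signs `(1, -1, 1)` the Courant expression is `-2g(∇_Y X, Z)`, by the skewness of `H` in its
last two arguments. Parallelism is used along `Y` and along `KY`. -/
theorem nijenhuisJet_eq_zero₂ (h : IsHermitianJet g g' J J')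
    (hp : IsParallelJet g g' (fun X Y Z => H X Y Z) J J')
    (hH : ∀ X Y Z, H X Y Z = -H X Z Y)
    (K : E →ₗ[ℝ] E) (K' : E →ₗ[ℝ] E →ₗ[ℝ] E) (X : E) (X' : E → E) (Y : E) (Y' : E → E) (Z : E) :
    nijenhuisJet g g' (fun X Y Z => H X Y Z) 1 (-1) 1 J J' K K' J X X' Y Y' Z = 0 := by
  have h1 := hp X Z Y
  have h2 := hp X Z (K Y)
  have h3 := hp (J X) Z (K Y)
  simp only [nijenhuisJet, courantJet, christoffel, altSum, map_add, LinearMap.add_apply, h.sq,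
    h.sq', h.skew, map_neg, LinearMap.neg_apply] at h1 h2 h3 ⊢
  linarith [hH X Y Z, hH (J X) (K Y) Z, hH (J X) Y (J Z), hH X (K Y) (J Z),
    h.symm' (J X) (J Z) Y, h.symm' X Z Y, h.symm' (J X) Z (K Y), h.symm' X (J Z) (K Y)]

/-- For signs `(-1, 1, 1)` the Courant expression is `2g(∇_X Y, Z)`, by the cyclic symmetry of `H`.
Parallelism is used along `X` and along `KX`. -/
theorem nijenhuisJet_eq_zero₃ (h : IsHermitianJet g g' J J')
    (hp : IsParallelJet g g' (fun X Y Z => H X Y Z) J J')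
    (hH : ∀ X Y Z, H X Y Z = H Y Z X)
    (K : E →ₗ[ℝ] E) (K' : E →ₗ[ℝ] E →ₗ[ℝ] E) (X : E) (X' : E → E) (Y : E) (Y' : E → E) (Z : E) :
    nijenhuisJet g g' (fun X Y Z => H X Y Z) (-1) 1 1 K K' J J' J X X' Y Y' Z = 0 := by
  have h1 := hp Y Z X
  have h2 := hp Y Z (K X)
  have h3 := hp (J Y) Z (K X)
  simp only [nijenhuisJet, courantJet, christoffel, altSum, map_add, LinearMap.add_apply, h.sq,
    h.sq', h.skew, map_neg, LinearMap.neg_apply] at h1 h2 h3 ⊢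
  linarith [hH X Y Z, hH (K X) (J Y) Z, hH (K X) Y (J Z), hH X (J Y) (J Z),
    h.symm' (J Y) (J Z) X, h.symm' (J Z) (J Y) X, h.symm' Y Z X, h.symm' Z Y X,
    h.symm' Y (J Z) (K X), h.symm' (J Z) Y (K X), h.symm' (J Y) Z (K X), h.symm' Z (J Y) (K X)]

/-- With equal signs the Courant expression is `2g([X, Y], Z) + 2g(∇_Z X, Y)`. Parallelism handles
the second term, and the first contributes the Nijenhuis tensor of `J`. -/
theorem nijenhuisJet_eq_zero₄ (h : IsHermitianJet g g' J J')
    (hp : IsParallelJet g g' (fun X Y Z => H X Y Z) J J')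
    (X : E) (X' : E →ₗ[ℝ] E) (Y : E) (Y' : E →ₗ[ℝ] E) (Z : E) :
    nijenhuisJet g g' (fun X Y Z => H X Y Z) 1 1 1 J J' J J' J X X' Y Y' Z = 0 := by
  have h1 := hp X Y Z
  have h2 := hp (J X) Y (J Z)
  have n1 := congrArg (fun t => g t Z) (h.nijenhuis X Y)
  simp only [nijenhuisJet, courantJet, christoffel, altSum, map_add, LinearMap.add_apply, h.sq,
    h.sq', h.skew, map_neg, LinearMap.neg_apply, map_sub, LinearMap.sub_apply] at h1 h2 n1 ⊢
  linarith

end Vanishing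

/-- Replacing `g` by `e g` for a sign `e` permutes the graphs of `g` and `-g`. -/
theorem courantJet_smul (g : E →ₗ[ℝ] E →ₗ[ℝ] ℝ) (g' : E →ₗ[ℝ] E →ₗ[ℝ] E →ₗ[ℝ] ℝ)
    (H : E → E → E → ℝ) (a b c : ℝ) (X : E) (X' : E → E) (Y : E) (Y' : E → E) (Z : E) :
    courantJet ((-1 : ℝ) • g) ((-1 : ℝ) • g') H a b c X X' Y Y' Z =
      courantJet g g' H (-a) (-b) (-c) X X' Y Y' Z := by
  simp only [courantJet, LinearMap.smul_apply, smul_eq_mul]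
  ring

end Jets

/-! ## Tensors in charts -/

section Charts

variable {E M F : Type*} [NormedAddCommGroup E] [NormedSpace ℝ E]
  [TopologicalSpace M] [ChartedSpace E M] [NormedAddCommGroup F] [NormedSpace ℝ F]

/-- The derivative of the chart around `x`. -/
def dChart (x q : M) : TangentSpace 𝓘(ℝ, E) q →L[ℝ] E :=
  mfderiv 𝓘(ℝ, E) 𝓘(ℝ, E) (extChartAt 𝓘(ℝ, E) x) q

/-- The derivative of the inverse of the chart around `x`. -/
def dChartSymm (x : M) (y : E) :
    E →L[ℝ] TangentSpace 𝓘(ℝ, E) ((extChartAt 𝓘(ℝ, E) x).symm y) :=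
  mfderiv 𝓘(ℝ, E) 𝓘(ℝ, E) (extChartAt 𝓘(ℝ, E) x).symm y

/-- A vector field in the chart around `x`. -/
def vecInChart (X : VField E M) (x : M) (y : E) : E :=
  dChart x _ (X ((extChartAt 𝓘(ℝ, E) x).symm y))

/-- An endomorphism field in the chart around `x`. -/
def endInChart (J : EndField E M) (x : M) (y : E) : E →L[ℝ] E :=
  (dChart x _).comp ((J ((extChartAt 𝓘(ℝ, E) x).symm y)).comp (dChartSymm x y))

/-- A field of bilinear forms in the chart around `x`. -/
def bilinInChart (g : BilinField E M) (x : M) (y : E) : E →L[ℝ] E →L[ℝ] ℝ :=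
  let B : E →L[ℝ] E →L[ℝ] ℝ := g ((extChartAt 𝓘(ℝ, E) x).symm y)
  let A : E →L[ℝ] E := dChartSymm x y
  B.bilinearComp A A

/-- The part of the image of the chart around `x` corresponding to `U`. -/
def chartDomain (E : Type*) [NormedAddCommGroup E] [NormedSpace ℝ E] [ChartedSpace E M]
    (x : M) (U : Set M) : Set E :=
  (extChartAt 𝓘(ℝ, E) x).target ∩ (extChartAt 𝓘(ℝ, E) x).symm ⁻¹' U

theorem isOpen_chartDomain (x : M) {U : Set M} (hU : IsOpen U) :
    IsOpen (chartDomain E x U) :=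
  (continuousOn_extChartAt_symm x).isOpen_inter_preimage (isOpen_extChartAt_target x) hU

theorem chartDomain_univ (x : M) :
    chartDomain E x Set.univ = (extChartAt 𝓘(ℝ, E) x).target := by
  simp [chartDomain]

theorem mem_chartDomain_self (x : M) {U : Set M} (hU : x ∈ U) :
    extChartAt 𝓘(ℝ, E) x x ∈ chartDomain E x U :=
  ⟨mem_extChartAt_target x, by simpa using hU⟩

theorem formInChart_apply {k : ℕ} (η : FormField E M F k) (x : M) (y : E) (v : Fin k → E) :
    formInChart η x y v =
      η ((extChartAt 𝓘(ℝ, E) x).symm y) (fun i => dChartSymm x y (v i)) := rfl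

theorem bilinInChart_apply (g : BilinField E M) (x : M) (y : E) (v w : E) :
    bilinInChart g x y v w =
      g ((extChartAt 𝓘(ℝ, E) x).symm y) (dChartSymm x y v) (dChartSymm x y w) := rfl

theorem endInChart_apply (J : EndField E M) (x : M) (y : E) (v : E) :
    endInChart J x y v =
      dChart x _ (J ((extChartAt 𝓘(ℝ, E) x).symm y) (dChartSymm x y v)) := rfl

variable [IsManifold 𝓘(ℝ, E) ∞ M]

omit [IsManifold 𝓘(ℝ, E) ∞ M] in
theorem dChartSymm_eq (x : M) (y : E) :
    dChartSymm x y = mfderivWithin 𝓘(ℝ, E) 𝓘(ℝ, E) (extChartAt 𝓘(ℝ, E) x).symm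
      (Set.range 𝓘(ℝ, E)) y := by
  rw [ModelWithCorners.range_eq_univ, mfderivWithin_univ, dChartSymm]

theorem dChart_dChartSymm (x : M) {y : E} (hy : y ∈ (extChartAt 𝓘(ℝ, E) x).target) (v : E) :
    dChart x _ (dChartSymm x y v) = v := by
  have : IsManifold 𝓘(ℝ, E) 1 M := IsManifold.of_le (n := ∞) (by simp)
  have h := mfderiv_extChartAt_comp_mfderivWithin_extChartAt_symm (I := 𝓘(ℝ, E)) hy
  rw [← dChartSymm_eq] at h
  exact DFunLike.congr_fun h v

theorem dChartSymm_dChart (x : M) {y : E} (hy : y ∈ (extChartAt 𝓘(ℝ, E) x).target)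
    (v : TangentSpace 𝓘(ℝ, E) ((extChartAt 𝓘(ℝ, E) x).symm y)) :
    dChartSymm x y (dChart x _ v) = v := by
  have : IsManifold 𝓘(ℝ, E) 1 M := IsManifold.of_le (n := ∞) (by simp)
  have h := mfderivWithin_extChartAt_symm_comp_mfderiv_extChartAt (I := 𝓘(ℝ, E)) hy
  rw [← dChartSymm_eq] at h
  exact DFunLike.congr_fun h v

/-- The tangent space at `x` is the model space `E` through the preferred chart at `x`. This is what
permits computing with honest derivatives at `p` and reading the results as tensors at `p`. -/
theorem dChart_self (x : M) (v : TangentSpace 𝓘(ℝ, E) x) : dChart x x v = v := by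
  have : IsManifold 𝓘(ℝ, E) 1 M := IsManifold.of_le (n := ∞) (by simp)
  exact DFunLike.congr_fun (mfderiv_extChartAt_self (I := 𝓘(ℝ, E)) (x := x)) v

theorem dChartSymm_self (x : M) (v : E) : dChartSymm x (extChartAt 𝓘(ℝ, E) x x) v = v := by
  have : IsManifold 𝓘(ℝ, E) 1 M := IsManifold.of_le (n := ∞) (by simp)
  rw [dChartSymm_eq]
  exact DFunLike.congr_fun (mfderivWithin_range_extChartAt_symm (I := 𝓘(ℝ, E)) (x := x)) v

theorem formInChart_self {k : ℕ} (η : FormField E M F k) (p : M) :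
    formInChart η p (extChartAt 𝓘(ℝ, E) p p) = η p := by
  ext v
  rw [formInChart_apply]
  simp only [dChartSymm_self]
  -- The chart inverse returns a base point merely equal to `p`, so the fibre is transported along
  -- that equality.
  have key : ∀ q : M, q = p → η q v = η p v := by rintro q rfl; rfl
  exact key _ (extChartAt_to_inv p)

theorem vecInChart_self (X : VField E M) (p : M) :
    vecInChart X p (extChartAt 𝓘(ℝ, E) p p) = X p := by
  have key : ∀ q : M, q = p → dChart p q (X q) = X p := by rintro q rfl; exact dChart_self _ _
  exact key _ (extChartAt_to_inv p)

theorem endInChart_self (J : EndField E M) (p : M) :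
    endInChart J p (extChartAt 𝓘(ℝ, E) p p) = J p := by
  ext v
  rw [endInChart_apply, dChartSymm_self]
  have key : ∀ q : M, q = p → dChart p q (J q v) = J p v := by
    rintro q rfl; exact dChart_self _ _
  exact key _ (extChartAt_to_inv p)

theorem bilinInChart_self (g : BilinField E M) (p : M) :
    bilinInChart g p (extChartAt 𝓘(ℝ, E) p p) = g p := by
  ext v w
  rw [bilinInChart_apply, dChartSymm_self, dChartSymm_self]
  have key : ∀ q : M, q = p → g q v w = g p v w := by rintro q rfl; rfl
  exact key _ (extChartAt_to_inv p)

theorem extD_eq {k : ℕ} (η : FormField E M F k) (p : M) :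
    extD η p = extDeriv (formInChart η p) (extChartAt 𝓘(ℝ, E) p p) := by
  ext v
  have h : ∀ w : TangentSpace 𝓘(ℝ, E) p,
      mfderiv 𝓘(ℝ, E) 𝓘(ℝ, E) (extChartAt 𝓘(ℝ, E) p) p w = w := dChart_self p
  exact congrArg (extDeriv (formInChart η p) (extChartAt 𝓘(ℝ, E) p p)) (funext fun i => h (v i))

end Charts

/-! ### Bundle smoothness expressed through charts -/

section ChartSmoothness

variable {E M F : Type*} [NormedAddCommGroup E] [NormedSpace ℝ E]
  [TopologicalSpace M] [ChartedSpace E M] [NormedAddCommGroup F] [NormedSpace ℝ F]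
  [IsManifold 𝓘(ℝ, E) ∞ M]

/-- The chart and its inverse are smooth, so one may compose with either. -/
theorem contMDiffOn_iff_contDiffOn_chartDomain (f : M → F) (x : M) (U : Set M) :
    ContMDiffOn 𝓘(ℝ, E) 𝓘(ℝ, F) ∞ f ((chartAt E x).source ∩ U) ↔
      ContDiffOn ℝ ∞ (fun y => f ((extChartAt 𝓘(ℝ, E) x).symm y)) (chartDomain E x U) := by
  rw [← contMDiffOn_iff_contDiffOn]
  constructor
  · intro h
    refine h.comp ((contMDiffOn_extChartAt_symm x).mono Set.inter_subset_left) ?_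
    intro y hy
    refine ⟨?_, hy.2⟩
    rw [← extChartAt_source 𝓘(ℝ, E)]
    exact (extChartAt 𝓘(ℝ, E) x).map_target hy.1
  · intro h
    have h2 : ContMDiffOn 𝓘(ℝ, E) 𝓘(ℝ, F) ∞
        (fun q => f ((extChartAt 𝓘(ℝ, E) x).symm (extChartAt 𝓘(ℝ, E) x q)))
        ((chartAt E x).source ∩ U) := by
      refine h.comp (contMDiffOn_extChartAt.mono Set.inter_subset_left) ?_
      intro q hq
      have hq' : q ∈ (extChartAt 𝓘(ℝ, E) x).source := by
        rw [extChartAt_source]; exact hq.1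
      refine ⟨(extChartAt 𝓘(ℝ, E) x).map_source hq', ?_⟩
      rw [Set.mem_preimage, (extChartAt 𝓘(ℝ, E) x).left_inv hq']
      exact hq.2
    refine h2.congr ?_
    intro q hq
    have hq' : q ∈ (extChartAt 𝓘(ℝ, E) x).source := by
      rw [extChartAt_source]; exact hq.1
    rw [(extChartAt 𝓘(ℝ, E) x).left_inv hq']

/-- Smoothness of a section on an open set can be checked in the trivializations at all points,
read in the corresponding charts. -/
theorem contMDiffOn_section_iff_chartDomain {G : Type*} [NormedAddCommGroup G] [NormedSpace ℝ G]
    {B : M → Type*} [∀ q, AddCommGroup (B q)] [∀ q, Module ℝ (B q)]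
    [TopologicalSpace (Bundle.TotalSpace G B)] [∀ q, TopologicalSpace (B q)]
    [FiberBundle G B] [VectorBundle ℝ G B] [ContMDiffVectorBundle ∞ G B 𝓘(ℝ, E)]
    (hbase : ∀ x : M, (trivializationAt G B x).baseSet = (chartAt E x).source)
    (s : ∀ q, B q) {U : Set M} (hU : IsOpen U) :
    ContMDiffOn 𝓘(ℝ, E) (𝓘(ℝ, E).prod 𝓘(ℝ, G)) ∞
      (fun q => (⟨q, s q⟩ : Bundle.TotalSpace G B)) U ↔
      ∀ x : M, ContDiffOn ℝ ∞ (fun y => (trivializationAt G B x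
        ⟨(extChartAt 𝓘(ℝ, E) x).symm y, s ((extChartAt 𝓘(ℝ, E) x).symm y)⟩).2)
        (chartDomain E x U) := by
  have key : ∀ x : M, ContMDiffOn 𝓘(ℝ, E) (𝓘(ℝ, E).prod 𝓘(ℝ, G)) ∞
      (fun q => (⟨q, s q⟩ : Bundle.TotalSpace G B)) ((chartAt E x).source ∩ U) ↔
      ContDiffOn ℝ ∞ (fun y => (trivializationAt G B x
        ⟨(extChartAt 𝓘(ℝ, E) x).symm y, s ((extChartAt 𝓘(ℝ, E) x).symm y)⟩).2)
        (chartDomain E x U) := by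
    intro x
    rw [← contMDiffOn_iff_contDiffOn_chartDomain (fun q => (trivializationAt G B x ⟨q, s q⟩).2) x U]
    exact Bundle.Trivialization.contMDiffOn_section_iff _
      ((chartAt E x).open_source.inter hU) (by rw [hbase]; exact Set.inter_subset_left)
  constructor
  · exact fun h x => (key x).1 (h.mono Set.inter_subset_right)
  · intro h q hq
    have := ((key q).2 (h q)) q ⟨mem_chart_source E q, hq⟩
    exact this.mono_of_mem_nhdsWithin (Filter.inter_mem
      (mem_nhdsWithin_of_mem_nhds ((chartAt E q).open_source.mem_nhds (mem_chart_source E q)))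
      self_mem_nhdsWithin)

omit [IsManifold 𝓘(ℝ, E) ∞ M] in
theorem extChartAt_symm_mem_source {x : M} {y : E} (hy : y ∈ (extChartAt 𝓘(ℝ, E) x).target) :
    (extChartAt 𝓘(ℝ, E) x).symm y ∈ (chartAt E x).source := by
  rw [← extChartAt_source 𝓘(ℝ, E)]
  exact (extChartAt 𝓘(ℝ, E) x).map_target hy

theorem trivializationAt_eq_dChart (x q : M) (hq : q ∈ (chartAt E x).source)
    (v : TangentSpace 𝓘(ℝ, E) q) :
    (trivializationAt E (TangentSpace 𝓘(ℝ, E)) x ⟨q, v⟩).2 = dChart x q v := by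
  have : IsManifold 𝓘(ℝ, E) 1 M := IsManifold.of_le (n := ∞) (by simp)
  have h := TangentBundle.continuousLinearMapAt_trivializationAt (I := 𝓘(ℝ, E)) hq
  have h2 := DFunLike.congr_fun h v
  rw [Bundle.Trivialization.continuousLinearMapAt_apply,
    Bundle.Trivialization.coe_linearMapAt_of_mem] at h2
  · exact h2
  · simpa using hq

theorem symmL_trivializationAt_eq_dChartSymm (x : M) {y : E}
    (hy : y ∈ (extChartAt 𝓘(ℝ, E) x).target) :
    (trivializationAt E (TangentSpace 𝓘(ℝ, E)) x).symmL ℝ ((extChartAt 𝓘(ℝ, E) x).symm y) =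
      dChartSymm x y := by
  have : IsManifold 𝓘(ℝ, E) 1 M := IsManifold.of_le (n := ∞) (by simp)
  rw [dChartSymm_eq, TangentBundle.symmL_trivializationAt (I := 𝓘(ℝ, E))
    (extChartAt_symm_mem_source hy), (extChartAt 𝓘(ℝ, E) x).right_inv hy]

theorem smoothVOn_iff (X : VField E M) {U : Set M} (hU : IsOpen U) :
    SmoothVOn U X ↔ ∀ x : M, ContDiffOn ℝ ∞ (vecInChart X x) (chartDomain E x U) := by
  rw [SmoothVOn]
  refine (contMDiffOn_section_iff_chartDomain (fun x => by simp) X hU).trans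
    (forall_congr' fun x => contDiffOn_congr ?_)
  intro y hy
  exact trivializationAt_eq_dChart x _ (extChartAt_symm_mem_source hy.1) _

/-- The trivialization of the endomorphism bundle at `x` conjugates by the tangent trivialization,
which is the derivative of the chart. -/
theorem contDiffOn_endInChart {J : EndField E M}
    (hJ : ContMDiff 𝓘(ℝ, E) (𝓘(ℝ, E).prod 𝓘(ℝ, E →L[ℝ] E)) ∞
      (fun p => Bundle.TotalSpace.mk' (E →L[ℝ] E)
        (E := fun p : M => TangentSpace 𝓘(ℝ, E) p →L[ℝ] TangentSpace 𝓘(ℝ, E) p) p (J p)))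
    (x : M) : ContDiffOn ℝ ∞ (endInChart J x) (extChartAt 𝓘(ℝ, E) x).target := by
  have h := (contMDiffOn_section_iff_chartDomain (E := E) (M := M) (G := E →L[ℝ] E)
    (B := fun p : M => TangentSpace 𝓘(ℝ, E) p →L[ℝ] TangentSpace 𝓘(ℝ, E) p)
    (fun x => by simp) J isOpen_univ).1 (contMDiffOn_univ.2 hJ) x
  rw [chartDomain_univ] at h
  refine h.congr ?_
  intro y hy
  rw [hom_trivializationAt_apply]
  ext v
  rw [endInChart_apply, ← symmL_trivializationAt_eq_dChartSymm x hy]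
  rw [← trivializationAt_eq_dChart x _ (extChartAt_symm_mem_source hy)]
  have hb : (extChartAt 𝓘(ℝ, E) x).symm y ∈
      (trivializationAt E (TangentSpace 𝓘(ℝ, E)) x).baseSet := by
    simpa using extChartAt_symm_mem_source hy
  exact (congrFun (Bundle.Trivialization.coe_linearMapAt_of_mem (R := ℝ) _ hb) _).symm

-- Bilinear forms live in a nested homomorphism bundle, so its trivialization is unfolded twice,
-- once per argument.
set_option synthInstance.maxHeartbeats 400000 in
set_option maxHeartbeats 1000000 in
theorem smoothBilin_of_contDiffOn {g : BilinField E M}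
    (hg : ∀ x : M, ContDiffOn ℝ ∞ (bilinInChart g x) (extChartAt 𝓘(ℝ, E) x).target) :
    SmoothBilin g := by
  rw [SmoothBilin, ← contMDiffOn_univ]
  refine (contMDiffOn_section_iff_chartDomain (E := E) (M := M) (G := E →L[ℝ] E →L[ℝ] ℝ)
    (B := fun p : M => TangentSpace 𝓘(ℝ, E) p →L[ℝ] TangentSpace 𝓘(ℝ, E) p →L[ℝ] ℝ)
    (fun x => by simp) g isOpen_univ).2 fun x => ?_
  rw [chartDomain_univ]
  refine (hg x).congr ?_
  intro y hy
  rw [hom_trivializationAt_apply]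
  ext v w
  rw [bilinInChart_apply, ← symmL_trivializationAt_eq_dChartSymm x hy]
  have hb : (extChartAt 𝓘(ℝ, E) x).symm y ∈
      (trivializationAt E (TangentSpace 𝓘(ℝ, E)) x).baseSet := by
    simpa using extChartAt_symm_mem_source hy
  have hb2 : (extChartAt 𝓘(ℝ, E) x).symm y ∈
      (trivializationAt (E →L[ℝ] ℝ) (fun p : M => TangentSpace 𝓘(ℝ, E) p →L[ℝ] ℝ) x).baseSet := by
    simpa using extChartAt_symm_mem_source hy
  rw [ContinuousLinearMap.inCoordinates, ContinuousLinearMap.comp_apply,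
    Bundle.Trivialization.continuousLinearMapAt_apply,
    Bundle.Trivialization.coe_linearMapAt_of_mem (R := ℝ) _ hb2]
  beta_reduce
  rw [hom_trivializationAt_apply]
  simp [ContinuousLinearMap.inCoordinates]
  rfl

end ChartSmoothness

/-! ### Alternating forms as multilinear maps, and their exterior derivative -/

section FormSmoothness

variable {E F G : Type*} [NormedAddCommGroup E] [NormedSpace ℝ E] [FiniteDimensional ℝ E]
  [NormedAddCommGroup F] [NormedSpace ℝ F] [FiniteDimensional ℝ F]
  [NormedAddCommGroup G] [NormedSpace ℝ G]

/-- A form-valued function is smooth if its values on constant vectors are smooth. -/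
theorem contDiffOn_form_of_apply {k : ℕ} {n : WithTop ℕ∞} {f : G → E [⋀^Fin k]→L[ℝ] F} {s : Set G}
    (h : ∀ v : Fin k → E, ContDiffOn ℝ n (fun y => f y v) s) : ContDiffOn ℝ n f s := by
  let b := Module.finBasis ℝ E
  -- Evaluation on tuples of basis vectors is injective. Its linear left inverse is continuous by
  -- finite dimensionality, so it recovers `f` smoothly from finitely many values.
  let ev : (E [⋀^Fin k]→L[ℝ] F) →ₗ[ℝ] ((Fin k → Fin (Module.finrank ℝ E)) → F) :=
    { toFun := fun α j => α (fun i => b (j i))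
      map_add' := fun _ _ => rfl
      map_smul' := fun _ _ => rfl }
  have hinj : Function.Injective ev := by
    intro α β hαβ
    have : α.toMultilinearMap = β.toMultilinearMap :=
      Module.Basis.ext_multilinear (fun _ => b) (fun j => congrFun hαβ j)
    ext v
    exact DFunLike.congr_fun this v
  obtain ⟨l, hl⟩ := ev.exists_leftInverse_of_injective (LinearMap.ker_eq_bot.2 hinj)
  have hf : f = fun y => LinearMap.toContinuousLinearMap l (ev (f y)) := by
    funext y
    exact (DFunLike.congr_fun hl (f y)).symm
  rw [hf]
  refine (ContinuousLinearMap.contDiff _).comp_contDiffOn (contDiffOn_pi.2 fun j => ?_)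
  exact h _

/-- A 1-form as a linear functional. -/
def toDual (E : Type*) [NormedAddCommGroup E] [NormedSpace ℝ E] :
    (E [⋀^Fin 1]→L[ℝ] ℝ) ≃ₗᵢ[ℝ] (E →L[ℝ] ℝ) :=
  (ContinuousAlternatingMap.ofSubsingletonLIE (0 : Fin 1)).symm

/-- A 2-form as a bilinear form. -/
def toBilin (E : Type*) [NormedAddCommGroup E] [NormedSpace ℝ E] :
    (E [⋀^Fin 2]→L[ℝ] ℝ) →L[ℝ] (E →L[ℝ] E →L[ℝ] ℝ) :=
  (ContinuousLinearMap.compL ℝ E (E [⋀^Fin 1]→L[ℝ] ℝ) (E →L[ℝ] ℝ)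
      (toDual E).toContinuousLinearEquiv.toContinuousLinearMap).comp
    ContinuousAlternatingMap.curryLeftLI.toContinuousLinearMap

omit [FiniteDimensional ℝ E] in
theorem toDual_apply (α : E [⋀^Fin 1]→L[ℝ] ℝ) (X : E) : toDual E α X = α ![X] := by
  have : (fun _ : Fin 1 => X) = ![X] := by ext i; fin_cases i; rfl
  rw [← this]
  rfl

omit [FiniteDimensional ℝ E] in
theorem toBilin_apply (α : E [⋀^Fin 2]→L[ℝ] ℝ) (X Y : E) : toBilin E α X Y = α ![X, Y] :=
  toDual_apply (α.curryLeft X) Y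

omit [FiniteDimensional ℝ E] in
theorem flat_eq (g : E →L[ℝ] E →L[ℝ] ℝ) (X : E) : flat g X = (toDual E).symm (g X) := rfl

omit [FiniteDimensional ℝ E] in
theorem extDeriv_two_form {α : E → E [⋀^Fin 2]→L[ℝ] ℝ} {y : E}
    (X Y Z : E) : extDeriv α y ![X, Y, Z] =
      altSum (fun X Y Z => toBilin E (fderiv ℝ α y X) Y Z) X Y Z := by
  rw [extDeriv, ContinuousAlternatingMap.alternatizeUncurryFin_apply, Fin.sum_univ_three, altSum]
  have e0 : (0 : Fin 3).removeNth ![X, Y, Z] = ![Y, Z] := by ext i; fin_cases i <;> rfl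
  have e1 : (1 : Fin 3).removeNth ![X, Y, Z] = ![X, Z] := by ext i; fin_cases i <;> rfl
  have e2 : (2 : Fin 3).removeNth ![X, Y, Z] = ![X, Y] := by ext i; fin_cases i <;> rfl
  rw [e0, e1, e2]
  simp only [toBilin_apply]
  simp
  ring

omit [FiniteDimensional ℝ E] in
theorem extDeriv_one_form {α : E → E [⋀^Fin 1]→L[ℝ] ℝ} {y : E} (X Y : E) :
    extDeriv α y ![X, Y] = toDual E (fderiv ℝ α y X) Y - toDual E (fderiv ℝ α y Y) X := by
  rw [extDeriv, ContinuousAlternatingMap.alternatizeUncurryFin_apply, Fin.sum_univ_two]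
  have e0 : (0 : Fin 2).removeNth ![X, Y] = ![Y] := by ext i; fin_cases i; rfl
  have e1 : (1 : Fin 2).removeNth ![X, Y] = ![X] := by ext i; fin_cases i; rfl
  rw [e0, e1]
  simp only [toDual_apply]
  simp
  ring

end FormSmoothness

/-! ### Chart independence of the exterior derivative; Lie brackets in a chart -/

section Charts

variable {E M F : Type*} [NormedAddCommGroup E] [NormedSpace ℝ E]
  [TopologicalSpace M] [ChartedSpace E M] [NormedAddCommGroup F] [NormedSpace ℝ F]
  [IsManifold 𝓘(ℝ, E) ∞ M]

theorem two_le_infty : (2 : WithTop ℕ∞) ≤ ∞ := by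
  exact WithTop.coe_le_coe.2 (le_top : (2 : ℕ∞) ≤ ⊤)

theorem form_dChartSymm_dChart {k : ℕ} (η : FormField E M F k) (x q : M)
    (hq : q ∈ (extChartAt 𝓘(ℝ, E) x).source) (v : Fin k → TangentSpace 𝓘(ℝ, E) q) :
    formInChart η x (extChartAt 𝓘(ℝ, E) x q) (fun i => dChart x q (v i)) = η q v := by
  rw [formInChart_apply]
  have h := dChartSymm_dChart x ((extChartAt 𝓘(ℝ, E) x).map_source hq)
  have key : ∀ (r : M) (_ : r = q) (S : E → E),
      (∀ w : TangentSpace 𝓘(ℝ, E) r, S (dChart x r w) = w) →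
      (η r fun i => S (dChart x q (v i))) = η q v := by
    rintro r rfl S hS
    exact congrArg (η r) (funext fun i => hS (v i))
  exact key _ ((extChartAt 𝓘(ℝ, E) x).left_inv hq) _ h

/-- The exterior derivative does not depend on the chart. -/
theorem formInChart_extD {k : ℕ} {η : FormField E M F k} {U : Set M} (hU : IsOpen U)
    (hη : SmoothFormOn U η) (x : M) {y : E} (hy : y ∈ chartDomain E x U) :
    formInChart (extD η) x y = extDeriv (formInChart η x) y := by
  have : IsManifold 𝓘(ℝ, E) 1 M := IsManifold.of_le (n := ∞) (by simp)
  set q := (extChartAt 𝓘(ℝ, E) x).symm y with hqdef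
  -- `τ` is the transition from the chart at `x` to the chart at `q`, in which `extD` is computed at
  -- `q`. The claim is naturality of `extDeriv` under pullback by `τ`.
  let τ : E → E := fun y' => extChartAt 𝓘(ℝ, E) q ((extChartAt 𝓘(ℝ, E) x).symm y')
  have hdom : chartDomain E x (extChartAt 𝓘(ℝ, E) q).source ∈ nhds y :=
    (isOpen_chartDomain x (isOpen_extChartAt_source q)).mem_nhds
      ⟨hy.1, mem_extChartAt_source q⟩
  have hτ' : ∀ y' ∈ chartDomain E x (extChartAt 𝓘(ℝ, E) q).source, ∀ v : E,
      fderiv ℝ τ y' v = dChart q ((extChartAt 𝓘(ℝ, E) x).symm y') (dChartSymm x y' v) := by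
    intro y' hy' v
    have h1 : MDifferentiableAt 𝓘(ℝ, E) 𝓘(ℝ, E) (extChartAt 𝓘(ℝ, E) q)
        ((extChartAt 𝓘(ℝ, E) x).symm y') :=
      mdifferentiableAt_extChartAt (by rw [← extChartAt_source 𝓘(ℝ, E)]; exact hy'.2)
    have h2 : MDifferentiableAt 𝓘(ℝ, E) 𝓘(ℝ, E) (extChartAt 𝓘(ℝ, E) x).symm y' := by
      have := mdifferentiableWithinAt_extChartAt_symm (I := 𝓘(ℝ, E)) hy'.1
      rwa [ModelWithCorners.range_eq_univ, mdifferentiableWithinAt_univ] at this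
    have h3 := mfderiv_comp y' h1 h2
    rw [← mfderiv_eq_fderiv]
    exact DFunLike.congr_fun h3 v
  have hτs : ContDiffAt ℝ ∞ τ y := by
    have h1 : ContMDiffOn 𝓘(ℝ, E) 𝓘(ℝ, E) ∞ (extChartAt 𝓘(ℝ, E) q)
        ((chartAt E q).source ∩ Set.univ) :=
      contMDiffOn_extChartAt.mono Set.inter_subset_left
    have h2 : ContMDiffOn 𝓘(ℝ, E) 𝓘(ℝ, E) ∞ τ (chartDomain E x (extChartAt 𝓘(ℝ, E) q).source) :=
      contMDiffOn_extChartAt.comp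
        ((contMDiffOn_extChartAt_symm x).mono Set.inter_subset_left)
        (fun y' hy' => by rw [← extChartAt_source 𝓘(ℝ, E)]; exact hy'.2)
    exact (contMDiffOn_iff_contDiffOn.1 h2).contDiffAt hdom
  have hloc : formInChart η x =ᶠ[nhds y]
      fun y' => (formInChart η q (τ y')).compContinuousLinearMap (fderiv ℝ τ y') := by
    filter_upwards [hdom] with y' hy'
    ext v
    rw [ContinuousAlternatingMap.compContinuousLinearMap_apply]
    have : (fderiv ℝ τ y' ∘ v) = fun i => dChart q _ (dChartSymm x y' (v i)) :=
      funext fun i => hτ' y' hy' (v i)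
    rw [this]
    exact (form_dChartSymm_dChart η q _ hy'.2 (fun i => dChartSymm x y' (v i))).symm
  have hd : DifferentiableAt ℝ (formInChart η q) (τ y) :=
    ((hη q).contDiffAt ((isOpen_chartDomain q hU).mem_nhds
      (mem_chartDomain_self q hy.2))).differentiableAt (by simp)
  rw [hloc.extDeriv_eq, extDeriv_pullback hd hτs (by simpa using two_le_infty)]
  ext v
  rw [formInChart_apply, ContinuousAlternatingMap.compContinuousLinearMap_apply]
  change extD η q _ = _
  rw [extD_eq]
  refine congrArg _ (funext fun i => ?_)
  exact ((hτ' y (mem_of_mem_nhds hdom) (v i)).trans (dChart_self q _)).symm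

-- `extD` uses a different chart at every point; chart independence replaces all of them by one
-- fixed chart, where smoothness is visible.
set_option synthInstance.maxHeartbeats 200000 in
theorem SmoothFormOn.extD {k : ℕ} {η : FormField E M F k} {U : Set M} (hU : IsOpen U)
    (hη : SmoothFormOn U η) : SmoothFormOn U (extD η) := by
  intro x
  have h : ContDiffOn ℝ ∞ (extDeriv (formInChart η x)) (chartDomain E x U) := by
    have h1 := (hη x).fderiv_of_isOpen (isOpen_chartDomain x hU) (m := ∞) (by simp)
    exact (ContinuousAlternatingMap.alternatizeUncurryFinCLM (n := k) ℝ E F).contDiff.comp_contDiffOn h1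
  exact h.congr fun y hy => formInChart_extD hU hη x hy

theorem extD_extD {k : ℕ} {η : FormField E M F k} (hη : SmoothFormOn Set.univ η) (p : M) :
    extD (extD η) p = 0 := by
  have hp := mem_chartDomain_self (E := E) p (Set.mem_univ p)
  have hn := (isOpen_chartDomain (E := E) p isOpen_univ).mem_nhds hp
  rw [extD_eq]
  have : formInChart (extD η) p =ᶠ[nhds (extChartAt 𝓘(ℝ, E) p p)]
      extDeriv (formInChart η p) := by
    filter_upwards [hn] with y hy
    exact formInChart_extD isOpen_univ hη p hy
  rw [this.extDeriv_eq]
  exact extDeriv_extDeriv_apply ((hη p).contDiffAt hn) (by simpa using two_le_infty)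

/-- The manifold bracket is defined by pulling back along the inverse chart. Near `p` the
pulled-back fields are `vecInChart`, and the derivative used to return to `p` is the identity. -/
theorem mlieBracket_eq (X Y : VField E M) (p : M) :
    VectorField.mlieBracket 𝓘(ℝ, E) X Y p =
      VectorField.lieBracket ℝ (vecInChart X p) (vecInChart Y p) (extChartAt 𝓘(ℝ, E) p p) := by
  have : IsManifold 𝓘(ℝ, E) 1 M := IsManifold.of_le (n := ∞) (by simp)
  have hpb : ∀ X : VField E M,
      VectorField.mpullbackWithin 𝓘(ℝ, E) 𝓘(ℝ, E) (extChartAt 𝓘(ℝ, E) p).symm X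
        (Set.range 𝓘(ℝ, E)) =ᶠ[nhds (extChartAt 𝓘(ℝ, E) p p)] vecInChart X p := by
    intro X
    filter_upwards [(isOpen_extChartAt_target (I := 𝓘(ℝ, E)) p).mem_nhds
      (mem_extChartAt_target p)] with y hy
    have h2 := ContinuousLinearMap.inverse_eq
      (mfderivWithin_extChartAt_symm_comp_mfderiv_extChartAt (I := 𝓘(ℝ, E)) hy)
      (mfderiv_extChartAt_comp_mfderivWithin_extChartAt_symm (I := 𝓘(ℝ, E)) hy)
    rw [VectorField.mpullbackWithin_apply, h2]
    rfl
  rw [← VectorField.mlieBracketWithin_univ, VectorField.mlieBracketWithin_apply,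
    mfderiv_extChartAt_self]
  have h3 : ((extChartAt 𝓘(ℝ, E) p).symm ⁻¹' Set.univ ∩ Set.range 𝓘(ℝ, E)) = Set.univ := by
    simp
  rw [h3]
  have h4 := (hpb X).lieBracket_vectorField_eq (𝕜 := ℝ) (E := E) (hpb Y)
  have h5 : ∀ w : E, (ContinuousLinearMap.id ℝ E).inverse w = w := fun w => by
    rw [ContinuousLinearMap.inverse_id]; rfl
  exact (h5 _).trans ((congrFun (VectorField.lieBracketWithin_univ (𝕜 := ℝ) (E := E)) _).trans h4)

/-- The vector field which is constant in the chart around `x`. -/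
def constField (x : M) (v : E) : VField E M := fun q =>
  (dChartSymm x (extChartAt 𝓘(ℝ, E) x q) v : E)

end Charts

set_option synthInstance.maxHeartbeats 200000

/-! ## First-order jets of tensor fields -/

section Bilinear

variable {E F : Type*} [NormedAddCommGroup E] [NormedSpace ℝ E]
  [NormedAddCommGroup F] [NormedSpace ℝ F]

/-- A continuous bilinear map as a bilinear map. -/
def lin₂ (A : E →L[ℝ] E →L[ℝ] F) : E →ₗ[ℝ] E →ₗ[ℝ] F :=
  (ContinuousLinearMap.coeLM ℝ).comp (A : E →ₗ[ℝ] E →L[ℝ] F)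

/-- The passage from continuous bilinear maps to bilinear maps. -/
def lin₂Linear (E F : Type*) [NormedAddCommGroup E] [NormedSpace ℝ E]
    [NormedAddCommGroup F] [NormedSpace ℝ F] : (E →L[ℝ] E →L[ℝ] F) →ₗ[ℝ] E →ₗ[ℝ] E →ₗ[ℝ] F where
  toFun A := lin₂ A
  map_add' _ _ := rfl
  map_smul' _ _ := rfl

/-- A continuous trilinear map as a trilinear map. -/
def lin₃ (A : E →L[ℝ] E →L[ℝ] E →L[ℝ] F) : E →ₗ[ℝ] E →ₗ[ℝ] E →ₗ[ℝ] F :=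
  (lin₂Linear E F).comp A.toLinearMap

/-- The derivative of a bilinear form evaluated on two vector fields. -/
theorem fderiv_bilin_apply {B : E → E →L[ℝ] E →L[ℝ] ℝ} {a b : E → E} {y : E}
    (hB : DifferentiableAt ℝ B y) (ha : DifferentiableAt ℝ a y) (hb : DifferentiableAt ℝ b y)
    (X : E) : fderiv ℝ (fun z => B z (a z) (b z)) y X =
      fderiv ℝ B y X (a y) (b y) + B y (fderiv ℝ a y X) (b y) + B y (a y) (fderiv ℝ b y X) := by
  rw [fderiv_clm_apply (hB.clm_apply ha) hb, fderiv_clm_apply hB ha]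
  simp only [add_apply, ContinuousLinearMap.comp_apply, ContinuousLinearMap.flip_apply]
  ring

theorem fderiv_apply_const {A : E → E →L[ℝ] F} {y : E} (hA : DifferentiableAt ℝ A y) (X v : E) :
    fderiv ℝ (fun z => A z v) y X = fderiv ℝ A y X v := by
  rw [fderiv_clm_apply hA (differentiableAt_const v)]
  simp

end Bilinear

section ToBilin

variable {E : Type*} [NormedAddCommGroup E] [NormedSpace ℝ E]

theorem contDiff_toBilin : ContDiff ℝ ∞ (fun α => toBilin E α) := by
  apply ContinuousLinearMap.contDiff

theorem hasFDerivAt_toBilin (α : E [⋀^Fin 2]→L[ℝ] ℝ) :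
    HasFDerivAt (fun α => toBilin E α) (toBilin E) α := by
  apply ContinuousLinearMap.hasFDerivAt

theorem fderiv_toBilin {α : E → E [⋀^Fin 2]→L[ℝ] ℝ} {y : E} (h : DifferentiableAt ℝ α y)
    (X : E) : fderiv ℝ (fun z => toBilin E (α z)) y X = toBilin E (fderiv ℝ α y X) := by
  have h0 := hasFDerivAt_toBilin (α y)
  have h1 := HasFDerivAt.comp (E := E) (F := E [⋀^Fin 2]→L[ℝ] ℝ) (G := E →L[ℝ] E →L[ℝ] ℝ)
    (g := fun α => toBilin E α) y h0 h.hasFDerivAt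
  exact DFunLike.congr_fun h1.fderiv X

end ToBilin

/-! ### Smooth tensor fields in charts and the 1-jet of a complex structure -/

section SmoothFields

variable {E M F : Type*} [NormedAddCommGroup E] [NormedSpace ℝ E]
  [TopologicalSpace M] [ChartedSpace E M] [NormedAddCommGroup F] [NormedSpace ℝ F]

/-- Smoothness of an endomorphism field in all charts. -/
def SmoothEnd (J : EndField E M) : Prop :=
  ∀ x : M, ContDiffOn ℝ ∞ (endInChart J x) (extChartAt 𝓘(ℝ, E) x).target

/-- Smoothness of a field of bilinear forms in all charts. -/
def ChartSmoothBilin (g : BilinField E M) : Prop :=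
  ∀ x : M, ContDiffOn ℝ ∞ (bilinInChart g x) (extChartAt 𝓘(ℝ, E) x).target

/-- A field of 2-forms in the chart around `x`, as a bilinear form. -/
def bilinFormInChart (η : FormField E M ℝ 2) (x : M) (y : E) : E →L[ℝ] E →L[ℝ] ℝ :=
  toBilin E (formInChart η x y)

theorem bilinFormInChart_apply (η : FormField E M ℝ 2) (x : M) (y v w : E) :
    bilinFormInChart η x y v w = η ((extChartAt 𝓘(ℝ, E) x).symm y)
      ![(dChartSymm x y v : TangentSpace 𝓘(ℝ, E) _), dChartSymm x y w] := by
  rw [bilinFormInChart, toBilin_apply, formInChart_apply]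
  congr 1
  ext i; fin_cases i <;> rfl

theorem target_mem_nhds (p : M) :
    (extChartAt 𝓘(ℝ, E) p).target ∈ nhds (extChartAt 𝓘(ℝ, E) p p) :=
  (isOpen_extChartAt_target p).mem_nhds (mem_extChartAt_target p)

theorem SmoothEnd.differentiableAt {J : EndField E M} (hJ : SmoothEnd J) (p : M) :
    DifferentiableAt ℝ (endInChart J p) (extChartAt 𝓘(ℝ, E) p p) :=
  ((hJ p).contDiffAt (target_mem_nhds p)).differentiableAt (by simp)

theorem ChartSmoothBilin.differentiableAt {g : BilinField E M} (hg : ChartSmoothBilin g) (p : M) :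
    DifferentiableAt ℝ (bilinInChart g p) (extChartAt 𝓘(ℝ, E) p p) :=
  ((hg p).contDiffAt (target_mem_nhds p)).differentiableAt (by simp)

theorem smoothFormOn_univ_iff {k : ℕ} {η : FormField E M F k} : SmoothFormOn Set.univ η ↔
    ∀ x : M, ContDiffOn ℝ ∞ (formInChart η x) (extChartAt 𝓘(ℝ, E) x).target := by
  rw [SmoothFormOn]
  simp only [Set.preimage_univ, Set.inter_univ]

theorem SmoothFormOn.differentiableAt {k : ℕ} {η : FormField E M F k} {U : Set M}
    (hη : SmoothFormOn U η) (hU : IsOpen U) {p : M} (hp : p ∈ U) :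
    DifferentiableAt ℝ (formInChart η p) (extChartAt 𝓘(ℝ, E) p p) :=
  ((hη p).contDiffAt ((isOpen_chartDomain p hU).mem_nhds
    (mem_chartDomain_self p hp))).differentiableAt (by simp)

theorem SmoothFormOn.contDiffOn_bilin {η : FormField E M ℝ 2} (hη : SmoothFormOn Set.univ η)
    (x : M) : ContDiffOn ℝ ∞ (bilinFormInChart η x) (extChartAt 𝓘(ℝ, E) x).target :=
  contDiff_toBilin.comp_contDiffOn (smoothFormOn_univ_iff.1 hη x)

theorem SmoothFormOn.differentiableAt_bilin {η : FormField E M ℝ 2}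
    (hη : SmoothFormOn Set.univ η) (p : M) :
    DifferentiableAt ℝ (bilinFormInChart η p) (extChartAt 𝓘(ℝ, E) p p) :=
  ((hη.contDiffOn_bilin p).contDiffAt (target_mem_nhds p)).differentiableAt (by simp)

theorem smoothFormOn_of_bilin [FiniteDimensional ℝ E] {η : FormField E M ℝ 2}
    (h : ∀ (x : M) (v w : E), ContDiffOn ℝ ∞ (fun y => bilinFormInChart η x y v w)
      (extChartAt 𝓘(ℝ, E) x).target) : SmoothFormOn Set.univ η := by
  rw [smoothFormOn_univ_iff]
  intro x
  refine contDiffOn_form_of_apply fun v => ?_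
  have : v = ![v 0, v 1] := by ext i; fin_cases i <;> rfl
  rw [this]
  simpa only [bilinFormInChart, toBilin_apply] using h x (v 0) (v 1)

variable [IsManifold 𝓘(ℝ, E) ∞ M]

/-- The exterior derivative of a 2-form in terms of the derivatives of its components. -/
theorem extD_apply_eq {η : FormField E M ℝ 2} (hη : SmoothFormOn Set.univ η) (p : M)
    (X Y Z : E) : extD η p ![X, Y, Z] = altSum (fun X Y Z =>
      fderiv ℝ (fun y => bilinFormInChart η p y Y Z) (extChartAt 𝓘(ℝ, E) p p) X) X Y Z := by
  rw [extD_eq]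
  refine (extDeriv_two_form (E := E) X Y Z).trans ?_
  have hd := hη.differentiableAt isOpen_univ (Set.mem_univ p)
  have key : ∀ X Y Z : E, toBilin E (fderiv ℝ (formInChart η p) (extChartAt 𝓘(ℝ, E) p p) X) Y Z =
      fderiv ℝ (fun y => bilinFormInChart η p y Y Z) (extChartAt 𝓘(ℝ, E) p p) X := by
    intro X Y Z
    have h1 : fderiv ℝ (bilinFormInChart η p) (extChartAt 𝓘(ℝ, E) p p) X =
        toBilin E (fderiv ℝ (formInChart η p) (extChartAt 𝓘(ℝ, E) p p) X) :=
      fderiv_toBilin hd X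
    have h2 := fderiv_bilin_apply (hη.differentiableAt_bilin p) (differentiableAt_const Y)
      (differentiableAt_const Z) X
    rw [h2, h1]
    simp
  simp only [key]

/-- The value of an endomorphism field at `p`. -/
def endAt (J : EndField E M) (p : M) : E →ₗ[ℝ] E :=
  (endInChart J p (extChartAt 𝓘(ℝ, E) p p) : E →L[ℝ] E)

/-- The derivative of an endomorphism field at `p` in the chart around `p`. -/
def dEndAt (J : EndField E M) (p : M) : E →ₗ[ℝ] E →ₗ[ℝ] E :=
  lin₂ (fderiv ℝ (endInChart J p) (extChartAt 𝓘(ℝ, E) p p))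

/-- The value of a field of bilinear forms at `p`. -/
def bilinAt (g : BilinField E M) (p : M) : E →ₗ[ℝ] E →ₗ[ℝ] ℝ :=
  lin₂ (bilinInChart g p (extChartAt 𝓘(ℝ, E) p p))

/-- The derivative of a field of bilinear forms at `p` in the chart around `p`. -/
def dBilinAt (g : BilinField E M) (p : M) : E →ₗ[ℝ] E →ₗ[ℝ] E →ₗ[ℝ] ℝ :=
  lin₃ (fderiv ℝ (bilinInChart g p) (extChartAt 𝓘(ℝ, E) p p))

theorem endAt_apply (J : EndField E M) (p : M) (v : E) : endAt J p v = J p v :=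
  DFunLike.congr_fun (endInChart_self J p) v

theorem bilinAt_apply (g : BilinField E M) (p : M) (v w : E) : bilinAt g p v w = g p v w :=
  DFunLike.congr_fun (DFunLike.congr_fun (bilinInChart_self g p) v) w

theorem constField_spec (p : M) (v : E) {q : M} (hq : q ∈ (chartAt E p).source) :
    dChart p q (constField p v q) = v := by
  have hq' : q ∈ (extChartAt 𝓘(ℝ, E) p).source := by rwa [extChartAt_source]
  have h := dChart_dChartSymm p ((extChartAt 𝓘(ℝ, E) p).map_source hq') v
  have key : ∀ r : M, r = q → ∀ w : E, dChart p r w = v → dChart p q w = v := by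
    rintro r rfl w h; exact h
  exact key _ ((extChartAt 𝓘(ℝ, E) p).left_inv hq') _ h

theorem smoothVOn_constField (p : M) (v : E) :
    SmoothVOn (chartAt E p).source (constField p v : VField E M) := by
  have h := Bundle.Trivialization.contMDiffOn_section_iff (n := ∞) (IB := 𝓘(ℝ, E))
    (trivializationAt E (TangentSpace 𝓘(ℝ, E)) p) (s := constField p v)
    (chartAt E p).open_source (by simp)
  refine h.2 ?_
  refine (contMDiffOn_const (c := v)).congr fun q hq => ?_
  rw [trivializationAt_eq_dChart p q hq]
  exact constField_spec p v hq

theorem vecInChart_constField (p : M) (v : E) {y : E} (hy : y ∈ (extChartAt 𝓘(ℝ, E) p).target) :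
    vecInChart (constField p v) p y = v :=
  constField_spec p v (extChartAt_symm_mem_source hy)

theorem dChartSymm_vecInChart (X : VField E M) (x : M) {y : E}
    (hy : y ∈ (extChartAt 𝓘(ℝ, E) x).target) :
    dChartSymm x y (vecInChart X x y) = X ((extChartAt 𝓘(ℝ, E) x).symm y) :=
  dChartSymm_dChart x hy _

theorem vecInChart_end (J : EndField E M) (X : VField E M) (x : M) {y : E}
    (hy : y ∈ (extChartAt 𝓘(ℝ, E) x).target) :
    vecInChart (fun q => J q (X q)) x y = endInChart J x y (vecInChart X x y) := by
  rw [endInChart_apply, dChartSymm_vecInChart X x hy]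
  rfl

theorem endInChart_sq {J : EndField E M} (hJ : ∀ p v, J p (J p v) = -v) (x : M) {y : E}
    (hy : y ∈ (extChartAt 𝓘(ℝ, E) x).target) (v : E) :
    endInChart J x y (endInChart J x y v) = -v := by
  rw [endInChart_apply, endInChart_apply, dChartSymm_dChart x hy, hJ, map_neg,
    dChart_dChartSymm x hy]

theorem ComplexStructure.smoothEnd (T : ComplexStructure E M) : SmoothEnd T.J :=
  contDiffOn_endInChart T.smooth

/-- The 1-jet of a complex structure. -/
theorem ComplexStructure.isComplexJet (T : ComplexStructure E M) (p : M) :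
    IsComplexJet (endAt T.J p) (dEndAt T.J p) where
  sq v := endInChart_sq T.sq p (mem_extChartAt_target p) v
  sq' X v := by
    have hd := T.smoothEnd.differentiableAt p
    have h1 : (fun y => endInChart T.J p y (endInChart T.J p y v)) =ᶠ[nhds
        (extChartAt 𝓘(ℝ, E) p p)] fun _ => -v := by
      filter_upwards [target_mem_nhds p] with y hy
      exact endInChart_sq T.sq p hy v
    have h2 := h1.fderiv_eq (𝕜 := ℝ)
    rw [fderiv_clm_apply hd (hd.clm_apply (differentiableAt_const v)),
      fderiv_clm_apply hd (differentiableAt_const v)] at h2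
    have h3 := DFunLike.congr_fun h2 X
    simp at h3
    exact eq_neg_of_add_eq_zero_right h3
  nijenhuis X Y := by
    have hd := T.smoothEnd.differentiableAt p
    -- The Nijenhuis tensor is tested on fields constant in the chart: they commute, so only
    -- derivatives of `J` survive in the brackets.
    have hc : ∀ v : E, vecInChart (constField p v) p =ᶠ[nhds (extChartAt 𝓘(ℝ, E) p p)]
        fun _ => v := by
      intro v
      filter_upwards [target_mem_nhds p] with y hy using vecInChart_constField p v hy
    have hJc : ∀ v : E, vecInChart (fun q => T.J q (constField p v q)) p
        =ᶠ[nhds (extChartAt 𝓘(ℝ, E) p p)] fun y => endInChart T.J p y v := by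
      intro v
      filter_upwards [target_mem_nhds p] with y hy
      rw [vecInChart_end _ _ _ hy, vecInChart_constField p v hy]
    have h := T.integrable (chartAt E p).source (chartAt E p).open_source _ _
      (smoothVOn_constField p X) (smoothVOn_constField p Y) p (mem_chart_source E p)
    rw [mlieBracket_eq, mlieBracket_eq, mlieBracket_eq, mlieBracket_eq,
      (hJc X).lieBracket_vectorField_eq (𝕜 := ℝ) (E := E) (hJc Y),
      (hJc X).lieBracket_vectorField_eq (𝕜 := ℝ) (E := E) (hc Y),
      (hc X).lieBracket_vectorField_eq (𝕜 := ℝ) (E := E) (hJc Y),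
      (hc X).lieBracket_vectorField_eq (𝕜 := ℝ) (E := E) (hc Y)] at h
    simp only [VectorField.lieBracket, fderiv_apply_const hd] at h
    simp at h
    change dEndAt T.J p (endAt T.J p X) Y - dEndAt T.J p (endAt T.J p Y) X =
      endAt T.J p (dEndAt T.J p X Y - dEndAt T.J p Y X)
    rw [map_sub]
    have h' : dEndAt T.J p (endAt T.J p X) Y - dEndAt T.J p (endAt T.J p Y) X
      + endAt T.J p (dEndAt T.J p Y X) - endAt T.J p (dEndAt T.J p X Y) = 0 := by
      rw [endAt_apply T.J p (dEndAt T.J p Y X), endAt_apply T.J p (dEndAt T.J p X Y)]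
      have key : ∀ (K : E →L[ℝ] E) (a b c d : E), a - b - K (-c) - K d - 0 = 0 →
          a - b + K c - K d = 0 := by
        intro K a b c d h
        rwa [sub_zero, map_neg, sub_neg_eq_add] at h
      exact key (T.J p) _ _ _ _ h
    rw [sub_eq_zero] at h'
    rw [← h']
    abel

end SmoothFields

/-! ## Operations on forms -/

section FormOperations

variable {V : Type*} [AddCommGroup V] [Module ℝ V] [TopologicalSpace V]

theorem two_form_add_left (α : V [⋀^Fin 2]→L[ℝ] ℝ) (X X' Y : V) :
    α ![X + X', Y] = α ![X, Y] + α ![X', Y] :=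
  α.toMultilinearMap.cons_add ![Y] X X'

theorem two_form_add_right (α : V [⋀^Fin 2]→L[ℝ] ℝ) (X Y Y' : V) :
    α ![X, Y + Y'] = α ![X, Y] + α ![X, Y'] := by
  rw [two_form_swap, two_form_add_left, two_form_swap α Y X, two_form_swap α Y' X]
  ring

theorem two_form_neg_left (α : V [⋀^Fin 2]→L[ℝ] ℝ) (X Y : V) : α ![-X, Y] = -α ![X, Y] := by
  have h := α.toMultilinearMap.cons_smul ![Y] (-1) X
  simpa using h

theorem two_form_neg_right (α : V [⋀^Fin 2]→L[ℝ] ℝ) (X Y : V) : α ![X, -Y] = -α ![X, Y] := by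
  rw [two_form_swap, two_form_neg_left, two_form_swap α Y X, neg_neg]

theorem compContinuousLinearMap_apply₂ {F : Type*} [AddCommGroup F] [Module ℝ F]
    [TopologicalSpace F] (α : V [⋀^Fin 2]→L[ℝ] F) (J : V →L[ℝ] V) (X Y : V) :
    α.compContinuousLinearMap J ![X, Y] = α ![J X, J Y] := by
  rw [ContinuousAlternatingMap.compContinuousLinearMap_apply]
  congr 1
  ext i; fin_cases i <;> rfl

theorem compContinuousLinearMap_apply₃ {F : Type*} [AddCommGroup F] [Module ℝ F]
    [TopologicalSpace F] (α : V [⋀^Fin 3]→L[ℝ] F) (J : V →L[ℝ] V) (X Y Z : V) :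
    α.compContinuousLinearMap J ![X, Y, Z] = α ![J X, J Y, J Z] := by
  rw [ContinuousAlternatingMap.compContinuousLinearMap_apply]
  congr 1
  ext i; fin_cases i <;> rfl

/-- The 2-form `F(J·, ·) + F(·, J·)`. -/
def insertForm [ContinuousAdd V] (J : V →L[ℝ] V) (F : V [⋀^Fin 2]→L[ℝ] ℝ) : V [⋀^Fin 2]→L[ℝ] ℝ :=
  F.compContinuousLinearMap (ContinuousLinearMap.id ℝ V + J) - F - F.compContinuousLinearMap J

theorem insertForm_apply [ContinuousAdd V] (J : V →L[ℝ] V) (F : V [⋀^Fin 2]→L[ℝ] ℝ) (X Y : V) :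
    insertForm J F ![X, Y] = F ![J X, Y] + F ![X, J Y] := by
  have h : insertForm J F ![X, Y] = F.compContinuousLinearMap (ContinuousLinearMap.id ℝ V + J) ![X, Y]
    - F ![X, Y] - F.compContinuousLinearMap J ![X, Y] := rfl
  rw [h, compContinuousLinearMap_apply₂, compContinuousLinearMap_apply₂]
  have h2 : ∀ v, (ContinuousLinearMap.id ℝ V + J) v = v + J v := fun _ => rfl
  rw [h2, h2, two_form_add_left, two_form_add_right, two_form_add_right]
  ring

theorem omegaPart_apply (J : V →L[ℝ] V) (F : V [⋀^Fin 2]→L[ℝ] ℝ) (X Y : V) :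
    omegaPart J F ![X, Y] = (1 / 2) * (F ![X, Y] + F ![J X, J Y]) := by
  rw [← compContinuousLinearMap_apply₂ F J]; rfl

theorem betaPart_apply (J : V →L[ℝ] V) (F : V [⋀^Fin 2]→L[ℝ] ℝ) (X Y : V) :
    betaPart J F ![X, Y] = (1 / 2) * (F ![X, Y] - F ![J X, J Y]) := by
  rw [← compContinuousLinearMap_apply₂ F J]; rfl

theorem two_form_ext {α β : V [⋀^Fin 2]→L[ℝ] ℝ} (h : ∀ X Y, α ![X, Y] = β ![X, Y]) : α = β := by
  ext v
  have : v = ![v 0, v 1] := by ext i; fin_cases i <;> rfl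
  rw [this]
  exact h _ _

theorem three_form_ext {F : Type*} [AddCommGroup F] [Module ℝ F]
    [TopologicalSpace F] {α β : V [⋀^Fin 3]→L[ℝ] F}
    (h : ∀ X Y Z, α ![X, Y, Z] = β ![X, Y, Z]) : α = β := by
  ext v
  have : v = ![v 0, v 1, v 2] := by ext i; fin_cases i <;> rfl
  rw [this]
  exact h _ _ _

theorem three_form_neg (α : V [⋀^Fin 3]→L[ℝ] ℝ) (X Y Z : V) :
    α ![-X, -Y, -Z] = -α ![X, Y, Z] := by
  have h := α.toMultilinearMap.map_smul_univ (fun _ => (-1 : ℝ)) ![X, Y, Z]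
  have e : (fun i => (-1 : ℝ) • ![X, Y, Z] i) = ![-X, -Y, -Z] := by
    ext i; fin_cases i <;> simp
  rw [e] at h
  refine h.trans ?_
  rw [Finset.prod_const, Finset.card_univ, Fintype.card_fin, smul_eq_mul]
  change (-1 : ℝ) ^ 3 * α ![X, Y, Z] = -α ![X, Y, Z]
  ring

end FormOperations

/-! ### Linearity of the exterior derivative -/

section ExtD

variable {E M F G : Type*} [NormedAddCommGroup E] [NormedSpace ℝ E]
  [TopologicalSpace M] [ChartedSpace E M] [NormedAddCommGroup F] [NormedSpace ℝ F]
  [NormedAddCommGroup G] [NormedSpace ℝ G]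

theorem contDiff_compContinuousAlternatingMap (k : ℕ) (L : F →L[ℝ] G) :
    ContDiff ℝ ∞ (fun α : E [⋀^Fin k]→L[ℝ] F => L.compContinuousAlternatingMap α) := by
  apply ContinuousLinearMap.contDiff (𝕜 := ℝ)
    (ContinuousLinearMap.compContinuousAlternatingMapCLM ℝ E F G (Fin k) L)

/-- Applied with real part and real and imaginary embeddings for `L`, this lets `d` pass through the
splitting of complex forms. -/
theorem extDeriv_clm_comp {k : ℕ} (L : F →L[ℝ] G) {α : E → E [⋀^Fin k]→L[ℝ] F} {y : E}
    (h : DifferentiableAt ℝ α y) :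
    extDeriv (fun z => L.compContinuousAlternatingMap (α z)) y =
      L.compContinuousAlternatingMap (extDeriv α y) := by
  have h1 : DifferentiableAt ℝ (fun z => L.compContinuousAlternatingMap (α z)) y :=
    ((contDiff_compContinuousAlternatingMap k L).differentiable (by simp)).differentiableAt.comp y h
  ext v
  rw [extDeriv_apply h1, ContinuousLinearMap.compContinuousAlternatingMap_coe,
    Function.comp_apply, extDeriv_apply h, map_sum]
  refine Finset.sum_congr rfl fun i _ => ?_
  rw [map_zsmul]
  congr 1
  have h2 : DifferentiableAt ℝ (fun z => α z (i.removeNth v)) y :=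
    (ContinuousAlternatingMap.apply ℝ E F (i.removeNth v)).differentiableAt.comp y h
  exact DFunLike.congr_fun (L.hasFDerivAt.comp y h2.hasFDerivAt).fderiv (v i)

theorem SmoothFormOn.clm_comp {k : ℕ} {η : FormField E M F k} {U : Set M}
    (hη : SmoothFormOn U η) (L : F →L[ℝ] G) :
    SmoothFormOn U (fun q => L.compContinuousAlternatingMap (η q)) := fun x =>
  (contDiff_compContinuousAlternatingMap k L).comp_contDiffOn (hη x)

theorem SmoothFormOn.add {k : ℕ} {η θ : FormField E M F k} {U : Set M}
    (hη : SmoothFormOn U η) (hθ : SmoothFormOn U θ) :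
    SmoothFormOn U (fun q => η q + θ q) := fun x => ContDiffOn.add (hη x) (hθ x)

theorem SmoothFormOn.const_smul {k : ℕ} {η : FormField E M F k} {U : Set M}
    (hη : SmoothFormOn U η) (c : ℝ) :
    SmoothFormOn U (fun q => c • η q) := fun x => ContDiffOn.const_smul c (hη x)

variable [IsManifold 𝓘(ℝ, E) ∞ M]

theorem extD_clm_comp {k : ℕ} {η : FormField E M F k} {U : Set M} (hU : IsOpen U)
    (hη : SmoothFormOn U η) (L : F →L[ℝ] G) {p : M} (hp : p ∈ U) :
    extD (fun q => L.compContinuousAlternatingMap (η q)) p =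
      L.compContinuousAlternatingMap (extD η p) := by
  rw [extD_eq, extD_eq]
  exact extDeriv_clm_comp L (hη.differentiableAt hU hp)

theorem extD_add {k : ℕ} {η θ : FormField E M F k} {U : Set M} (hU : IsOpen U)
    (hη : SmoothFormOn U η) (hθ : SmoothFormOn U θ) {p : M} (hp : p ∈ U) :
    extD (fun q => η q + θ q) p = extD η p + extD θ p := by
  rw [extD_eq, extD_eq, extD_eq]
  exact extDeriv_add (hη.differentiableAt hU hp) (hθ.differentiableAt hU hp)

theorem extD_smul {k : ℕ} (η : FormField E M F k) (c : ℝ) (p : M) :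
    extD (fun q => c • η q) p = c • extD η p := by
  rw [extD_eq, extD_eq]
  exact extDeriv_smul c (formInChart η p)

end ExtD

/-! ### The 1-jet of a Hermitian metric -/

section Hermitian

variable {E M : Type*} [NormedAddCommGroup E] [NormedSpace ℝ E]
  [TopologicalSpace M] [ChartedSpace E M] [IsManifold 𝓘(ℝ, E) ∞ M]

theorem dChartSymm_endInChart (J : EndField E M) (x : M) {y : E}
    (hy : y ∈ (extChartAt 𝓘(ℝ, E) x).target) (v : E) :
    dChartSymm x y (endInChart J x y v) = J _ (dChartSymm x y v) :=
  dChartSymm_dChart x hy _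

/-- The 1-jet of a Hermitian metric. -/
theorem isHermitianJet {T : ComplexStructure E M} {g : BilinField E M} (hg : ChartSmoothBilin g)
    (symm : ∀ p X Y, g p X Y = g p Y X) (skew : ∀ p X Y, g p (T.J p X) Y = -g p X (T.J p Y))
    (p : M) : IsHermitianJet (bilinAt g p) (dBilinAt g p) (endAt T.J p) (dEndAt T.J p) where
  toIsComplexJet := T.isComplexJet p
  symm X Y := by rw [bilinAt_apply, bilinAt_apply]; exact symm p X Y
  symm' W X Y := by
    have hd := hg.differentiableAt p
    -- The symmetry holds at every point of the chart, hence may be differentiated; the skewness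
    -- below is treated in the same way.
    have h1 : (fun y => bilinInChart g p y X Y) = fun y => bilinInChart g p y Y X :=
      funext fun y => symm _ _ _
    have h2 := congrArg (fun f => fderiv ℝ f (extChartAt 𝓘(ℝ, E) p p) W) h1
    have h3 := fderiv_bilin_apply hd (differentiableAt_const X) (differentiableAt_const Y) W
    have h4 := fderiv_bilin_apply hd (differentiableAt_const Y) (differentiableAt_const X) W
    simp only [h3, h4] at h2
    simp at h2
    exact h2
  skew X Y := by
    have := skew p X Y
    rwa [bilinAt_apply, bilinAt_apply, endAt_apply, endAt_apply]
  skew' W X Y := by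
    have hd := hg.differentiableAt p
    have hJ := T.smoothEnd.differentiableAt p
    have h1 : (fun y => bilinInChart g p y (endInChart T.J p y X) Y) =ᶠ[nhds
        (extChartAt 𝓘(ℝ, E) p p)] fun y => -bilinInChart g p y X (endInChart T.J p y Y) := by
      filter_upwards [target_mem_nhds p] with y hy
      rw [bilinInChart_apply, bilinInChart_apply, dChartSymm_endInChart T.J p hy,
        dChartSymm_endInChart T.J p hy, skew]
    have h2 := DFunLike.congr_fun (h1.fderiv_eq (𝕜 := ℝ)) W
    have h3 := fderiv_bilin_apply hd (hJ.clm_apply (differentiableAt_const X))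
      (differentiableAt_const Y) W
    have h4 := fderiv_bilin_apply hd (differentiableAt_const X)
      (hJ.clm_apply (differentiableAt_const Y)) W
    rw [fderiv_fun_neg, neg_apply, h3, h4, fderiv_apply_const hJ, fderiv_apply_const hJ] at h2
    simp at h2
    rw [neg_add_rev]
    exact h2

end Hermitian

/-! ## The operator `d^c` in terms of jets -/

section DC

variable {E M : Type*} [NormedAddCommGroup E] [NormedSpace ℝ E]
  [TopologicalSpace M] [ChartedSpace E M] [IsManifold 𝓘(ℝ, E) ∞ M]

/-- The bilinear form `(B(·, J·) - B(J·, ·)) / 2`. -/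
def symmPart (B : E →L[ℝ] E →L[ℝ] ℝ) (J : E →L[ℝ] E) : E →L[ℝ] E →L[ℝ] ℝ :=
  (1 / 2 : ℝ) • (B.bilinearComp (ContinuousLinearMap.id ℝ E) J -
    B.bilinearComp J (ContinuousLinearMap.id ℝ E))

omit [IsManifold 𝓘(ℝ, E) ∞ M] in
theorem symmPart_apply (B : E →L[ℝ] E →L[ℝ] ℝ) (J : E →L[ℝ] E) (X Y : E) :
    symmPart B J X Y = (1 / 2) * (B X (J Y) - B (J X) Y) := rfl

/-- The bilinear field `(F(·, J·) - F(J·, ·)) / 2`. -/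
def metricOf (J : EndField E M) (F : FormField E M ℝ 2) : BilinField E M := fun p =>
  let α : E [⋀^Fin 2]→L[ℝ] ℝ := F p
  symmPart (E := E) (toBilin E α) (J p)

omit [IsManifold 𝓘(ℝ, E) ∞ M] in
theorem metricOf_apply (J : EndField E M) (F : FormField E M ℝ 2) (p : M)
    (X Y : TangentSpace 𝓘(ℝ, E) p) :
    metricOf J F p X Y = (1 / 2) * (F p ![X, J p Y] - F p ![J p X, Y]) := by
  have h : ∀ (α : E [⋀^Fin 2]→L[ℝ] ℝ) (J : E →L[ℝ] E) (X Y : E),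
      symmPart (toBilin E α) J X Y = (1 / 2) * (α ![X, J Y] - α ![J X, Y]) := by
    intro α J X Y
    rw [symmPart_apply, toBilin_apply, toBilin_apply]
  exact h _ _ _ _

theorem bilinInChart_metricOf (J : EndField E M) (F : FormField E M ℝ 2) (x : M) {y : E}
    (hy : y ∈ (extChartAt 𝓘(ℝ, E) x).target) (v w : E) :
    bilinInChart (metricOf J F) x y v w = (1 / 2) *
      (bilinFormInChart F x y v (endInChart J x y w) -
        bilinFormInChart F x y (endInChart J x y v) w) := by
  rw [bilinInChart_apply, metricOf_apply, bilinFormInChart_apply, bilinFormInChart_apply,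
    dChartSymm_endInChart J x hy, dChartSymm_endInChart J x hy]

theorem bilinFormInChart_pullback (J : EndField E M) (F : FormField E M ℝ 2) (x : M) {y : E}
    (hy : y ∈ (extChartAt 𝓘(ℝ, E) x).target) (v w : E) :
    bilinFormInChart (fun q => (F q).compContinuousLinearMap (J q)) x y v w =
      bilinFormInChart F x y (endInChart J x y v) (endInChart J x y w) := by
  rw [bilinFormInChart_apply, bilinFormInChart_apply, compContinuousLinearMap_apply₂,
    dChartSymm_endInChart J x hy, dChartSymm_endInChart J x hy]

theorem bilinFormInChart_insertForm (J : EndField E M) (F : FormField E M ℝ 2) (x : M) {y : E}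
    (hy : y ∈ (extChartAt 𝓘(ℝ, E) x).target) (v w : E) :
    bilinFormInChart (fun q => insertForm (J q) (F q)) x y v w =
      bilinFormInChart F x y (endInChart J x y v) w +
        bilinFormInChart F x y v (endInChart J x y w) := by
  rw [bilinFormInChart_apply, bilinFormInChart_apply, bilinFormInChart_apply, insertForm_apply,
    dChartSymm_endInChart J x hy, dChartSymm_endInChart J x hy]

variable {J : EndField E M} {F : FormField E M ℝ 2}

/-- In finite dimension it suffices to test on constant vectors, where the component is polynomial
in those of `F` and `J`. -/
theorem chartSmooth_metricOf [FiniteDimensional ℝ E] (hJ : SmoothEnd J)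
    (hF : SmoothFormOn Set.univ F) : ChartSmoothBilin (metricOf J F) := by
  intro x
  have hB := hF.contDiffOn_bilin x
  rw [contDiffOn_clm_apply]
  intro v
  rw [contDiffOn_clm_apply]
  intro w
  have hJc : ∀ v : E, ContDiffOn ℝ ∞ (fun y => endInChart J x y v)
    (extChartAt 𝓘(ℝ, E) x).target := fun v => (hJ x).clm_apply contDiffOn_const
  have hc : ∀ v : E, ContDiffOn ℝ ∞ (fun _ : E => v)
    (extChartAt 𝓘(ℝ, E) x).target := fun v => contDiffOn_const
  refine ((contDiffOn_const (c := (1 / 2 : ℝ))).mul (((hB.clm_apply (hc v)).clm_apply (hJc w)).sub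
    ((hB.clm_apply (hJc v)).clm_apply (hc w)))).congr fun y hy => ?_
  exact bilinInChart_metricOf J F x hy v w

theorem SmoothFormOn.pullback [FiniteDimensional ℝ E] (hJ : SmoothEnd J)
    (hF : SmoothFormOn Set.univ F) :
    SmoothFormOn Set.univ (fun q => (F q).compContinuousLinearMap (J q)) := by
  refine smoothFormOn_of_bilin fun x v w => ?_
  have hB := hF.contDiffOn_bilin x
  have hJc : ∀ v : E, ContDiffOn ℝ ∞ (fun y => endInChart J x y v)
    (extChartAt 𝓘(ℝ, E) x).target := fun v => (hJ x).clm_apply contDiffOn_const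
  refine ((hB.clm_apply (hJc v)).clm_apply (hJc w)).congr fun y hy => ?_
  exact bilinFormInChart_pullback J F x hy v w

theorem SmoothFormOn.insertForm [FiniteDimensional ℝ E] (hJ : SmoothEnd J)
    (hF : SmoothFormOn Set.univ F) :
    SmoothFormOn Set.univ (fun q => insertForm (J q) (F q)) := by
  refine smoothFormOn_of_bilin fun x v w => ?_
  have hB := hF.contDiffOn_bilin x
  have hJc : ∀ v : E, ContDiffOn ℝ ∞ (fun y => endInChart J x y v)
    (extChartAt 𝓘(ℝ, E) x).target := fun v => (hJ x).clm_apply contDiffOn_const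
  have hc : ∀ v : E, ContDiffOn ℝ ∞ (fun _ : E => v)
    (extChartAt 𝓘(ℝ, E) x).target := fun v => contDiffOn_const
  refine (((hB.clm_apply (hJc v)).clm_apply (hc w)).add
    ((hB.clm_apply (hc v)).clm_apply (hJc w))).congr fun y hy => ?_
  exact bilinFormInChart_insertForm J F x hy v w

/-- The derivative of a 2-form at `p` in the chart around `p`. -/
def dFormAt (F : FormField E M ℝ 2) (p : M) : E →ₗ[ℝ] E →ₗ[ℝ] E →ₗ[ℝ] ℝ :=
  lin₃ (fderiv ℝ (bilinFormInChart F p) (extChartAt 𝓘(ℝ, E) p p))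

/-- A 2-form at `p` as a bilinear form. -/
def formAt (F : FormField E M ℝ 2) (p : M) : E →ₗ[ℝ] E →ₗ[ℝ] ℝ :=
  lin₂ (bilinFormInChart F p (extChartAt 𝓘(ℝ, E) p p))

theorem formAt_apply (F : FormField E M ℝ 2) (p : M) (X Y : E) : formAt F p X Y = F p ![X, Y] :=
  (toBilin_apply _ X Y).trans (DFunLike.congr_fun (formInChart_self F p) _)

theorem extD_apply_eq' (hF : SmoothFormOn Set.univ F) (p : M) (X Y Z : E) :
    extD F p ![X, Y, Z] = altSum (fun X Y Z => dFormAt F p X Y Z) X Y Z := by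
  rw [extD_apply_eq hF]
  have hd := hF.differentiableAt_bilin p
  have key : ∀ X Y Z : E, fderiv ℝ (fun y => bilinFormInChart F p y Y Z)
      (extChartAt 𝓘(ℝ, E) p p) X = dFormAt F p X Y Z := by
    intro X Y Z
    have := fderiv_bilin_apply hd (differentiableAt_const Y) (differentiableAt_const Z) X
    rw [this]
    simp
    rfl
  simp only [key]

/-- The Leibniz rule in the chart, in the shape of the left side of `altSum_pull_eq`. -/
theorem extD_pullback_apply [FiniteDimensional ℝ E] (hJ : SmoothEnd J)
    (hF : SmoothFormOn Set.univ F) (p : M) (X Y Z : E) :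
    extD (fun q => (F q).compContinuousLinearMap (J q)) p ![X, Y, Z] =
      altSum (fun X Y Z => dFormAt F p X (endAt J p Y) (endAt J p Z) +
        formAt F p (dEndAt J p X Y) (endAt J p Z) +
        formAt F p (endAt J p Y) (dEndAt J p X Z)) X Y Z := by
  rw [extD_apply_eq (SmoothFormOn.pullback hJ hF)]
  have hd := hF.differentiableAt_bilin p
  have hJd := hJ.differentiableAt p
  have hJc : ∀ v : E, DifferentiableAt ℝ (fun y => endInChart J p y v)
    (extChartAt 𝓘(ℝ, E) p p) := fun v => hJd.clm_apply (differentiableAt_const v)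
  have key : ∀ X Y Z : E, fderiv ℝ (fun y => bilinFormInChart
      (fun q => (F q).compContinuousLinearMap (J q)) p y Y Z) (extChartAt 𝓘(ℝ, E) p p) X =
      dFormAt F p X (endAt J p Y) (endAt J p Z) +
        formAt F p (dEndAt J p X Y) (endAt J p Z) +
        formAt F p (endAt J p Y) (dEndAt J p X Z) := by
    intro X Y Z
    have h1 : (fun y => bilinFormInChart
      (fun q => (F q).compContinuousLinearMap (J q)) p y Y Z) =ᶠ[nhds
        (extChartAt 𝓘(ℝ, E) p p)] fun y => bilinFormInChart F p y
          (endInChart J p y Y) (endInChart J p y Z) := by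
      filter_upwards [target_mem_nhds p] with y hy
      exact bilinFormInChart_pullback J F p hy Y Z
    rw [h1.fderiv_eq, fderiv_bilin_apply hd (hJc Y) (hJc Z), fderiv_apply_const hJd,
      fderiv_apply_const hJd]
    rfl
  simp only [key]

/-- The counterpart for `d i_J F`, the last term of `altSum_pull_eq`. -/
theorem extD_insertForm_apply [FiniteDimensional ℝ E] (hJ : SmoothEnd J)
    (hF : SmoothFormOn Set.univ F) (p : M) (X Y Z : E) :
    extD (fun q => insertForm (J q) (F q)) p ![X, Y, Z] =
      altSum (fun X Y Z => dFormAt F p X (endAt J p Y) Z + dFormAt F p X Y (endAt J p Z) +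
        formAt F p (dEndAt J p X Y) Z + formAt F p Y (dEndAt J p X Z)) X Y Z := by
  rw [extD_apply_eq (SmoothFormOn.insertForm hJ hF)]
  have hd := hF.differentiableAt_bilin p
  have hJd := hJ.differentiableAt p
  have hJc : ∀ v : E, DifferentiableAt ℝ (fun y => endInChart J p y v)
    (extChartAt 𝓘(ℝ, E) p p) := fun v => hJd.clm_apply (differentiableAt_const v)
  have hc : ∀ v : E, DifferentiableAt ℝ (fun _ : E => v) (extChartAt 𝓘(ℝ, E) p p) :=
    fun v => differentiableAt_const v
  have key : ∀ X Y Z : E, fderiv ℝ (fun y => bilinFormInChart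
      (fun q => insertForm (J q) (F q)) p y Y Z) (extChartAt 𝓘(ℝ, E) p p) X =
      dFormAt F p X (endAt J p Y) Z + dFormAt F p X Y (endAt J p Z) +
        formAt F p (dEndAt J p X Y) Z + formAt F p Y (dEndAt J p X Z) := by
    intro X Y Z
    have h1 : (fun y => bilinFormInChart
      (fun q => insertForm (J q) (F q)) p y Y Z) =ᶠ[nhds
        (extChartAt 𝓘(ℝ, E) p p)] fun y => bilinFormInChart F p y (endInChart J p y Y) Z +
          bilinFormInChart F p y Y (endInChart J p y Z) := by
      filter_upwards [target_mem_nhds p] with y hy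
      exact bilinFormInChart_insertForm J F p hy Y Z
    rw [h1.fderiv_eq, fderiv_fun_add ((hd.clm_apply (hJc Y)).clm_apply (hc Z))
      ((hd.clm_apply (hc Y)).clm_apply (hJc Z)), add_apply,
      fderiv_bilin_apply hd (hJc Y) (hc Z), fderiv_bilin_apply hd (hc Y) (hJc Z),
      fderiv_apply_const hJd, fderiv_apply_const hJd]
    simp only [fderiv_fun_const, Pi.zero_apply, zero_apply, map_zero, add_zero]
    change dFormAt F p X (endAt J p Y) Z + formAt F p (dEndAt J p X Y) Z +
      (dFormAt F p X Y (endAt J p Z) + formAt F p Y (dEndAt J p X Z)) = _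
    ring
  simp only [key]

/-- The operator `d^c` on the `(1,1)`-part of a 2-form. -/
theorem dc_omegaPart [FiniteDimensional ℝ E] (T : ComplexStructure E M)
    (hF : SmoothFormOn Set.univ F) (p : M) (X Y Z : TangentSpace 𝓘(ℝ, E) p) :
    dc T.J (fun q => omegaPart (T.J q) (F q)) p ![X, Y, Z] =
      (1 / 2) * extD (fun q => insertForm (T.J q) (F q)) p ![X, Y, Z] -
      (1 / 2) * (extD F p ![T.J p X, Y, Z] + extD F p ![X, T.J p Y, Z] +
        extD F p ![X, Y, T.J p Z] + extD F p ![T.J p X, T.J p Y, T.J p Z]) := by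
  have hJ := T.smoothEnd
  -- Because `J² = -1`, pullback by `J` exchanges the two summands of `ω`.
  have h1 : (fun q => (omegaPart (T.J q) (F q)).compContinuousLinearMap (T.J q)) =
      fun q => (1 / 2 : ℝ) • (F q + (F q).compContinuousLinearMap (T.J q)) := by
    funext q
    refine two_form_ext fun X Y => ?_
    rw [compContinuousLinearMap_apply₂, omegaPart_apply, T.sq, T.sq, two_form_neg_left,
      two_form_neg_right, neg_neg]
    have := omegaPart_apply (T.J q) (F q) X Y
    rw [omegaPart] at this
    rw [this]
    ring
  have hP := SmoothFormOn.pullback hJ hF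
  have h2 : dc T.J (fun q => omegaPart (T.J q) (F q)) p ![X, Y, Z] =
      (1 / 2) * (-extD F p ![T.J p X, T.J p Y, T.J p Z] -
        extD (fun q => (F q).compContinuousLinearMap (T.J q)) p
          ![T.J p X, T.J p Y, T.J p Z]) := by
    rw [dc, h1, extD_smul, extD_add isOpen_univ hF hP (Set.mem_univ p),
      compContinuousLinearMap_apply₃]
    have h := three_form_neg ((1 / 2 : ℝ) • (extD F p +
      extD (fun q => (F q).compContinuousLinearMap (T.J q)) p)) (T.J p X) (T.J p Y) (T.J p Z)
    refine h.trans ?_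
    change -((1 / 2) * (extD F p ![T.J p X, T.J p Y, T.J p Z] + extD (fun q =>
      (F q).compContinuousLinearMap (T.J q)) p ![T.J p X, T.J p Y, T.J p Z])) = _
    ring
  -- Integrability enters here: `J^* d J^* F` is traded for `i_J dF - d i_J F`.
  have key : ∀ (X Y Z X' Y' Z' : E), endAt T.J p X = X' → endAt T.J p Y = Y' →
      endAt T.J p Z = Z' →
      extD (fun q => (F q).compContinuousLinearMap (T.J q)) p ![X', Y', Z'] =
        extD F p ![X', Y, Z] + extD F p ![X, Y', Z] + extD F p ![X, Y, Z'] -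
          extD (fun q => insertForm (T.J q) (F q)) p ![X, Y, Z] := by
    rintro X Y Z _ _ _ rfl rfl rfl
    have h := altSum_pull_eq (T.isComplexJet p) (formAt F p) (dFormAt F p) (fun X Y => by
      rw [formAt_apply, formAt_apply]; exact two_form_swap (F p) X Y) X Y Z
    linarith [extD_pullback_apply hJ hF p (endAt T.J p X) (endAt T.J p Y) (endAt T.J p Z),
      extD_insertForm_apply hJ hF p X Y Z, extD_apply_eq' hF p (endAt T.J p X) Y Z,
      extD_apply_eq' hF p X (endAt T.J p Y) Z, extD_apply_eq' hF p X Y (endAt T.J p Z)]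
  have h3 : extD (fun q => (F q).compContinuousLinearMap (T.J q)) p
        ![T.J p X, T.J p Y, T.J p Z] =
      extD F p ![T.J p X, Y, Z] + extD F p ![X, T.J p Y, Z] + extD F p ![X, Y, T.J p Z] -
        extD (fun q => insertForm (T.J q) (F q)) p ![X, Y, Z] :=
    key X Y Z _ _ _ (endAt_apply _ _ _) (endAt_apply _ _ _) (endAt_apply _ _ _)
  rw [h2, h3]
  ring

end DC

/-! ### The type of `ℋ` and the resulting formula for `d^c ω` -/

section Types

variable {E M : Type*} [NormedAddCommGroup E] [NormedSpace ℝ E]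
  [TopologicalSpace M] [ChartedSpace E M] [IsManifold 𝓘(ℝ, E) ∞ M]

/-- `i_J + J^*` is a real operator acting on `ℋ` as `2i`, and `Im(2iℋ) = 2 Re ℋ`. -/
theorem HolManinTriple.insert_imForm (T : HolManinTriple E M) (p : M)
    (X Y Z : TangentSpace 𝓘(ℝ, E) p) :
    imForm (T.H p) ![T.J p X, Y, Z] + imForm (T.H p) ![X, T.J p Y, Z] +
      imForm (T.H p) ![X, Y, T.J p Z] + imForm (T.H p) ![T.J p X, T.J p Y, T.J p Z] =
      2 * reForm (T.H p) ![X, Y, Z] := by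
  have h1 := insert_add_pull_of_mem (Or.inl (T.type21 p)) X Y Z
  have h2 := insert_add_pull_of_mem (Or.inr (T.type30 p)) X Y Z
  have h : ∀ v, T.H p v = T.H21 p v + T.H30 p v := fun _ => rfl
  change (T.H p ![T.J p X, Y, Z]).im + (T.H p ![X, T.J p Y, Z]).im +
    (T.H p ![X, Y, T.J p Z]).im + (T.H p ![T.J p X, T.J p Y, T.J p Z]).im =
    2 * (T.H p ![X, Y, Z]).re
  have h3 := congrArg Complex.im (congrArg₂ (· + ·) h1 h2)
  simp only [Complex.add_im, Complex.mul_im, Complex.mul_re] at h3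
  simp only [h, Complex.add_im, Complex.add_re]
  simp at h3
  linarith

theorem HolManinTriple.smoothH (T : HolManinTriple E M) : SmoothFormOn Set.univ T.H :=
  T.smooth21.add T.smooth30

theorem extD_I_smul_toC {k : ℕ} {F : FormField E M ℝ k} (hF : SmoothFormOn Set.univ F) (p : M) :
    extD (fun q => Complex.I • toC (F q)) p = Complex.I • toC (extD F p) :=
  extD_clm_comp isOpen_univ hF (Complex.I • Complex.ofRealCLM) (Set.mem_univ p)

/-- If `dF = c Im ℋ`, then `d^c ω = d(ι_J F) / 2 - c Re ℋ` for the `(1,1)`-part `ω` of `F`. -/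
theorem HolManinTriple.dc_omegaPart [FiniteDimensional ℝ E] (T : HolManinTriple E M)
    {F : FormField E M ℝ 2} (hF : SmoothFormOn Set.univ F) (c : ℝ) (p : M)
    (h : extD F p = c • imForm (T.H p)) :
    dc T.J (fun q => omegaPart (T.J q) (F q)) p =
      (1 / 2 : ℝ) • extD (fun q => insertForm (T.J q) (F q)) p - c • reForm (T.H p) := by
  refine three_form_ext fun X Y Z => ?_
  rw [_root_.dc_omegaPart T.toComplexStructure hF p X Y Z, h]
  have h1 := T.insert_imForm p X Y Z
  simp only [ContinuousAlternatingMap.smul_apply, ContinuousAlternatingMap.sub_apply, smul_eq_mul]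
  linear_combination (-c / 2) * h1

end Types

/-! ### The symmetric and skew parts of `-F J` -/

section MetricOf

variable {E M : Type*} [NormedAddCommGroup E] [NormedSpace ℝ E]
  [TopologicalSpace M] [ChartedSpace E M] [IsManifold 𝓘(ℝ, E) ∞ M]
  (T : ComplexStructure E M) (F : FormField E M ℝ 2) (p : M)
  (X Y : TangentSpace 𝓘(ℝ, E) p)

theorem metricOf_symm : metricOf T.J F p X Y = metricOf T.J F p Y X := by
  rw [metricOf_apply, metricOf_apply, two_form_swap (F p) Y (T.J p X),
    two_form_swap (F p) (T.J p Y) X]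
  ring

theorem metricOf_skew : metricOf T.J F p (T.J p X) Y = -metricOf T.J F p X (T.J p Y) := by
  rw [metricOf_apply, metricOf_apply, T.sq, T.sq, two_form_neg_left, two_form_neg_right]
  ring

theorem metricOf_hermitian : metricOf T.J F p (T.J p X) (T.J p Y) = metricOf T.J F p X Y := by
  rw [metricOf_skew, T.sq, map_neg, neg_neg]

theorem omegaPart_eq_metricOf :
    omegaPart (T.J p) (F p) ![X, Y] = metricOf T.J F p (T.J p X) Y := by
  rw [metricOf_apply, omegaPart_apply, T.sq, two_form_neg_left]
  ring

theorem neg_omegaPart_comp :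
    -(omegaPart (T.J p) (F p) ![T.J p X, Y]) = metricOf T.J F p X Y := by
  rw [metricOf_apply, omegaPart_apply, T.sq, two_form_neg_left]
  ring

/-- The skew part of `-F J` is minus half of the derivation `i_J F`; this identifies `b` with the
potential appearing in the formula for `d^c ω`. -/
theorem neg_betaPart_comp : -(betaPart (T.J p) (F p) ![T.J p X, Y]) =
    -(1 / 2) * insertForm (T.J p) (F p) ![X, Y] := by
  rw [insertForm_apply, betaPart_apply, T.sq, two_form_neg_left]
  ring

end MetricOf

/-! ### From `±d^c ω = H` to parallel complex structures -/

section Parallel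

variable {E M : Type*} [NormedAddCommGroup E] [NormedSpace ℝ E] [FiniteDimensional ℝ E]
  [TopologicalSpace M] [ChartedSpace E M] [IsManifold 𝓘(ℝ, E) ∞ M]

/-- A 3-form as a trilinear form. -/
def toTrilinear (α : E [⋀^Fin 3]→L[ℝ] ℝ) : E →ₗ[ℝ] E →ₗ[ℝ] E →ₗ[ℝ] ℝ :=
  lin₃ ((toBilin E).comp α.curryLeft)

omit [FiniteDimensional ℝ E] in
theorem toTrilinear_apply (α : E [⋀^Fin 3]→L[ℝ] ℝ) (X Y Z : E) :
    toTrilinear α X Y Z = α ![X, Y, Z] :=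
  toBilin_apply (α.curryLeft X) Y Z

/-- A field of 3-forms at `p` as a trilinear form. -/
def triAt (H : FormField E M ℝ 3) (p : M) : E →ₗ[ℝ] E →ₗ[ℝ] E →ₗ[ℝ] ℝ :=
  toTrilinear (E := E) (H p)

omit [FiniteDimensional ℝ E] [IsManifold 𝓘(ℝ, E) ∞ M] in
theorem triAt_apply (H : FormField E M ℝ 3) (p : M) (X Y Z : E) :
    triAt H p X Y Z = H p ![X, Y, Z] := toTrilinear_apply _ X Y Z

variable (T : ComplexStructure E M) {F : FormField E M ℝ 2} (hF : SmoothFormOn Set.univ F)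

include hF in
theorem isHermitianJet_metricOf (p : M) :
    IsHermitianJet (bilinAt (metricOf T.J F) p) (dBilinAt (metricOf T.J F) p)
      (endAt T.J p) (dEndAt T.J p) :=
  isHermitianJet (chartSmooth_metricOf T.smoothEnd hF) (metricOf_symm T F) (metricOf_skew T F) p

-- A `(1,1)`-form is invariant under `J^*`, so `d^c ω` is `-dω(J·, J·, J·)`; then `ω = g(J·, ·)` is
-- differentiated by the Leibniz rule.
include hF in
theorem dc_omegaPart_eq_altSum (p : M) (X Y Z : E) :
    dc T.J (fun q => omegaPart (T.J q) (F q)) p ![X, Y, Z] =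
      -altSum (fun X Y Z => dBilinAt (metricOf T.J F) p X (endAt T.J p Y) Z +
        bilinAt (metricOf T.J F) p (dEndAt T.J p X Y) Z)
        (endAt T.J p X) (endAt T.J p Y) (endAt T.J p Z) := by
  have hJ := T.smoothEnd
  have h1 : (fun q => (omegaPart (T.J q) (F q)).compContinuousLinearMap (T.J q)) =
      fun q => omegaPart (T.J q) (F q) := by
    funext q
    refine two_form_ext fun X Y => ?_
    rw [compContinuousLinearMap_apply₂, omegaPart_apply, omegaPart_apply, T.sq, T.sq,
      two_form_neg_left, two_form_neg_right]
    ring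
  have hω : SmoothFormOn Set.univ fun q => omegaPart (T.J q) (F q) :=
    (hF.add (SmoothFormOn.pullback hJ hF)).const_smul (1 / 2)
  have h2 : dc T.J (fun q => omegaPart (T.J q) (F q)) p ![X, Y, Z] =
      -extD (fun q => omegaPart (T.J q) (F q)) p ![T.J p X, T.J p Y, T.J p Z] := by
    rw [dc, h1]
    exact (compContinuousLinearMap_apply₃ _ (-T.J p) X Y Z).trans (three_form_neg _ _ _ _)
  have hd := (chartSmooth_metricOf hJ hF).differentiableAt p
  have hJd := hJ.differentiableAt p
  have key : ∀ X Y Z : E, fderiv ℝ (fun y => bilinFormInChart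
      (fun q => omegaPart (T.J q) (F q)) p y Y Z) (extChartAt 𝓘(ℝ, E) p p) X =
      dBilinAt (metricOf T.J F) p X (endAt T.J p Y) Z +
        bilinAt (metricOf T.J F) p (dEndAt T.J p X Y) Z := by
    intro X Y Z
    have h1 : (fun y => bilinFormInChart (fun q => omegaPart (T.J q) (F q)) p y Y Z) =ᶠ[nhds
        (extChartAt 𝓘(ℝ, E) p p)] fun y => bilinInChart (metricOf T.J F) p y
          (endInChart T.J p y Y) Z := by
      filter_upwards [target_mem_nhds p] with y hy
      rw [bilinFormInChart_apply, bilinInChart_apply, dChartSymm_endInChart T.J p hy,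
        omegaPart_eq_metricOf]
    rw [h1.fderiv_eq, fderiv_bilin_apply hd (hJd.clm_apply (differentiableAt_const Y))
      (differentiableAt_const Z), fderiv_apply_const hJd]
    simp only [fderiv_fun_const, Pi.zero_apply, zero_apply, map_zero, add_zero]
    rfl
  have h3 : ∀ X' Y' Z' : E, endAt T.J p X = X' → endAt T.J p Y = Y' → endAt T.J p Z = Z' →
      extD (fun q => omegaPart (T.J q) (F q)) p ![X', Y', Z'] =
      altSum (fun X Y Z => dBilinAt (metricOf T.J F) p X (endAt T.J p Y) Z +
        bilinAt (metricOf T.J F) p (dEndAt T.J p X Y) Z)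
        (endAt T.J p X) (endAt T.J p Y) (endAt T.J p Z) := by
    rintro _ _ _ rfl rfl rfl
    rw [extD_apply_eq hω]
    simp only [key]
  rw [← h3 _ _ _ (endAt_apply _ _ _) (endAt_apply _ _ _) (endAt_apply _ _ _)]
  exact h2

include hF in
/-- If `d^c ω = H`, then `J` is parallel for the metric connection with torsion `H`. -/
theorem isParallelJet_of_dc_eq {H : FormField E M ℝ 3} (p : M)
    (h : dc T.J (fun q => omegaPart (T.J q) (F q)) p = H p) :
    IsParallelJet (bilinAt (metricOf T.J F) p) (dBilinAt (metricOf T.J F) p)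
      (fun X Y Z => triAt H p X Y Z) (endAt T.J p) (dEndAt T.J p) := by
  refine (isHermitianJet_metricOf T hF p).isParallelJet (triAt H p) fun X Y Z => ?_
  rw [triAt_apply, ← dc_omegaPart_eq_altSum T hF, h]

include hF in
/-- If `-d^c ω = H`, then `J` is parallel for the connection of the metric `-g` with torsion
`H`. -/
theorem isParallelJet_of_neg_dc_eq {H : FormField E M ℝ 3} (p : M)
    (h : -dc T.J (fun q => omegaPart (T.J q) (F q)) p = H p) :
    IsParallelJet ((-1 : ℝ) • bilinAt (metricOf T.J F) p)
      ((-1 : ℝ) • dBilinAt (metricOf T.J F) p)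
      (fun X Y Z => triAt H p X Y Z) (endAt T.J p) (dEndAt T.J p) := by
  refine (isHermitianJet_metricOf T hF p).neg_left.isParallelJet (triAt H p) fun X Y Z => ?_
  have h1 := dc_omegaPart_eq_altSum T hF p X Y Z
  have h2 : H p ![X, Y, Z] = -dc T.J (fun q => omegaPart (T.J q) (F q)) p ![X, Y, Z] := by
    rw [← h]; rfl
  rw [triAt_apply, h2, h1]
  simp only [altSum, LinearMap.smul_apply, smul_eq_mul]
  ring

end Parallel

/-! ## Linear algebra of generalized tangent vectors -/

section GenLinear

variable {V : Type*} [AddCommGroup V] [Module ℝ V] [TopologicalSpace V]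

theorem pair_apply (x y : Gen V) : pair x y = y.2 ![x.1] + x.2 ![y.1] := rfl

theorem one_form_add (α : V [⋀^Fin 1]→L[ℝ] ℝ) (X Y : V) : α ![X + Y] = α ![X] + α ![Y] :=
  α.toMultilinearMap.cons_add ![] X Y

theorem one_form_smul (α : V [⋀^Fin 1]→L[ℝ] ℝ) (c : ℝ) (X : V) : α ![c • X] = c * α ![X] :=
  α.toMultilinearMap.cons_smul ![] c X

theorem one_form_ext {F : Type*} [AddCommGroup F] [Module ℝ F] [TopologicalSpace F]
    {α β : V [⋀^Fin 1]→L[ℝ] F} (h : ∀ X, α ![X] = β ![X]) : α = β := by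
  ext v
  have : v = ![v 0] := by ext i; fin_cases i; rfl
  rw [this]
  exact h _

theorem flat_apply (g : V →L[ℝ] V →L[ℝ] ℝ) (X Y : V) : flat g X ![Y] = g X Y := rfl

theorem pair_comm (x y : Gen V) : pair x y = pair y x := by
  rw [pair_apply, pair_apply, add_comm]

theorem pair_add_left (x y z : Gen V) : pair (x + y) z = pair x z + pair y z := by
  have h : (x + y).2 ![z.1] = x.2 ![z.1] + y.2 ![z.1] := rfl
  rw [pair_apply, pair_apply, pair_apply, h, Prod.fst_add, one_form_add]
  ring

theorem pair_smul_left (c : ℝ) (x z : Gen V) : pair (c • x) z = c * pair x z := by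
  have h : (c • x).2 ![z.1] = c * x.2 ![z.1] := rfl
  rw [pair_apply, pair_apply, h, Prod.smul_fst, one_form_smul]
  ring

theorem gen_neg_one_smul (x : Gen V) : (-1 : ℝ) • x = -x :=
  Prod.ext (neg_one_smul ℝ x.1) (one_form_ext fun _ => neg_one_mul _)

theorem pair_neg_left (x z : Gen V) : pair (-x) z = -pair x z := by
  rw [← gen_neg_one_smul, pair_smul_left, neg_one_mul]

theorem pair_sub_left (x y z : Gen V) : pair (x - y) z = pair x z - pair y z := by
  rw [sub_eq_add_neg, pair_add_left, pair_neg_left, sub_eq_add_neg]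

/-- A metric whose musical map is bijective. -/
structure IsMetric (g : V →L[ℝ] V →L[ℝ] ℝ) : Prop where
  symm : ∀ X Y, g X Y = g Y X
  pos : ∀ X, X ≠ 0 → 0 < g X X
  surjective : ∀ α : V [⋀^Fin 1]→L[ℝ] ℝ, ∃ X, flat g X = α

variable {g : V →L[ℝ] V →L[ℝ] ℝ}

theorem IsMetric.nondeg (hg : IsMetric g) {X : V} (h : ∀ Y, g X Y = 0) : X = 0 := by
  by_contra hX
  exact (hg.pos X hX).ne' (h X)

theorem IsMetric.flat_injective (hg : IsMetric g) {X Y : V} (h : flat g X = flat g Y) : X = Y := by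
  rw [← sub_eq_zero]
  refine hg.nondeg fun Z => ?_
  have h1 := DFunLike.congr_fun h ![Z]
  rw [flat_apply, flat_apply] at h1
  simp [h1]

/-- The inverse of the musical map (with value `0` if there is none). -/
def sharp (g : V →L[ℝ] V →L[ℝ] ℝ) (α : V [⋀^Fin 1]→L[ℝ] ℝ) : V :=
  open Classical in if h : ∃ X, flat g X = α then h.choose else 0

theorem IsMetric.flat_sharp (hg : IsMetric g) (α : V [⋀^Fin 1]→L[ℝ] ℝ) :
    flat g (sharp g α) = α := by
  rw [sharp, dif_pos (hg.surjective α)]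
  exact (hg.surjective α).choose_spec

theorem IsMetric.sharp_flat (hg : IsMetric g) (X : V) : sharp g (flat g X) = X :=
  hg.flat_injective (hg.flat_sharp _)

theorem IsMetric.apply_sharp (hg : IsMetric g) (α : V [⋀^Fin 1]→L[ℝ] ℝ) (Y : V) :
    g (sharp g α) Y = α ![Y] := by
  rw [← flat_apply, hg.flat_sharp]

/-- The element `(X + g X) + (Y - g Y)`. -/
def graphSum (g : V →L[ℝ] V →L[ℝ] ℝ) (X Y : V) : Gen V := (X + Y, flat g (X - Y))

/-- The component of an element in the graph of `g`. -/
def plusPart (g : V →L[ℝ] V →L[ℝ] ℝ) (x : Gen V) : V := (1 / 2 : ℝ) • (x.1 + sharp g x.2)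

/-- The component of an element in the graph of `-g`. -/
def minusPart (g : V →L[ℝ] V →L[ℝ] ℝ) (x : Gen V) : V := (1 / 2 : ℝ) • (x.1 - sharp g x.2)

theorem IsMetric.graphSum_parts (hg : IsMetric g) (x : Gen V) :
    graphSum g (plusPart g x) (minusPart g x) = x := by
  refine Prod.ext ?_ ?_
  · change (1 / 2 : ℝ) • (x.1 + sharp g x.2) + (1 / 2 : ℝ) • (x.1 - sharp g x.2) = x.1
    module
  · change flat g ((1 / 2 : ℝ) • (x.1 + sharp g x.2) - (1 / 2 : ℝ) • (x.1 - sharp g x.2)) = x.2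
    have : (1 / 2 : ℝ) • (x.1 + sharp g x.2) - (1 / 2 : ℝ) • (x.1 - sharp g x.2) = sharp g x.2 := by
      module
    rw [this, hg.flat_sharp]

theorem IsMetric.plusPart_graphSum (hg : IsMetric g) (X Y : V) :
    plusPart g (graphSum g X Y) = X := by
  rw [plusPart, graphSum]
  simp only [hg.sharp_flat]
  module

theorem IsMetric.minusPart_graphSum (hg : IsMetric g) (X Y : V) :
    minusPart g (graphSum g X Y) = Y := by
  rw [minusPart, graphSum]
  simp only [hg.sharp_flat]
  module

theorem graphSum_add (X Y X' Y' : V) :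
    graphSum g (X + X') (Y + Y') = graphSum g X Y + graphSum g X' Y' := by
  refine Prod.ext ?_ (one_form_ext fun Z => ?_)
  · change X + X' + (Y + Y') = X + Y + (X' + Y')
    abel
  · change g (X + X' - (Y + Y')) Z = g (X - Y) Z + g (X' - Y') Z
    rw [← add_apply, ← map_add]
    congr 2
    abel

theorem graphSum_smul (c : ℝ) (X Y : V) : graphSum g (c • X) (c • Y) = c • graphSum g X Y := by
  refine Prod.ext ?_ (one_form_ext fun Z => ?_)
  · change c • X + c • Y = c • (X + Y)
    module
  · change g (c • X - c • Y) Z = c * g (X - Y) Z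
    rw [← smul_sub, map_smul, smul_apply, smul_eq_mul]

theorem graphSum_neg (X Y : V) : graphSum g (-X) (-Y) = -graphSum g X Y := by
  rw [← gen_neg_one_smul, ← graphSum_smul, neg_one_smul, neg_one_smul]

/-- The graphs of `g` and `-g` are orthogonal, with pairing `2g` on the first and `-2g` on the
second. All pointwise algebra below rests on this decomposition. -/
theorem IsMetric.pair_graphSum (hg : IsMetric g) (X Y X' Y' : V) :
    pair (graphSum g X Y) (graphSum g X' Y') = 2 * g X X' - 2 * g Y Y' := by
  rw [pair_apply]
  change g (X' - Y') (X + Y) + g (X - Y) (X' + Y') = _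
  simp only [map_sub, map_add, sub_apply]
  rw [hg.symm X' X, hg.symm X' Y, hg.symm Y' X, hg.symm Y' Y]
  ring

theorem IsMetric.pair_nondeg (hg : IsMetric g) {x : Gen V} (h : ∀ y, pair x y = 0) : x = 0 := by
  rw [← hg.graphSum_parts x] at h ⊢
  have h1 : plusPart g x = 0 := hg.nondeg fun Y => by
    have := h (graphSum g Y 0)
    rw [hg.pair_graphSum] at this
    simpa using this
  have h2 : minusPart g x = 0 := hg.nondeg fun Y => by
    have := h (graphSum g 0 Y)
    rw [hg.pair_graphSum] at this
    simpa using this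
  rw [h1, h2]
  have := graphSum_smul (g := g) 0 (0 : V) 0
  simpa using this

/-- The endomorphism of `V ⊕ V^*` acting by `J` on the graph of `g` and by `K` on the graph of
`-g`. -/
def graphEnd (hg : IsMetric g) (J K : V →L[ℝ] V) : Gen V →ₗ[ℝ] Gen V where
  toFun x := graphSum g (J (plusPart g x)) (K (minusPart g x))
  map_add' x y := by
    obtain ⟨X, Y, rfl⟩ : ∃ X Y, x = graphSum g X Y := ⟨_, _, (hg.graphSum_parts x).symm⟩
    obtain ⟨X', Y', rfl⟩ : ∃ X Y, y = graphSum g X Y := ⟨_, _, (hg.graphSum_parts y).symm⟩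
    rw [← graphSum_add]
    simp only [hg.plusPart_graphSum, hg.minusPart_graphSum]
    rw [← graphSum_add, map_add, map_add]
  map_smul' c x := by
    obtain ⟨X, Y, rfl⟩ : ∃ X Y, x = graphSum g X Y := ⟨_, _, (hg.graphSum_parts x).symm⟩
    rw [← graphSum_smul]
    simp only [hg.plusPart_graphSum, hg.minusPart_graphSum, RingHom.id_apply]
    rw [← graphSum_smul, map_smul, map_smul]

theorem graphEnd_graphSum (hg : IsMetric g) (J K : V →L[ℝ] V) (X Y : V) :
    graphEnd hg J K (graphSum g X Y) = graphSum g (J X) (K Y) := by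
  change graphSum g (J (plusPart g _)) (K (minusPart g _)) = _
  rw [hg.plusPart_graphSum, hg.minusPart_graphSum]

variable {J K : V →L[ℝ] V}

theorem graphEnd_sq (hg : IsMetric g) (hJ : ∀ v, J (J v) = -v) (hK : ∀ v, K (K v) = -v)
    (x : Gen V) : graphEnd hg J K (graphEnd hg J K x) = -x := by
  rw [← hg.graphSum_parts x, graphEnd_graphSum, graphEnd_graphSum, hJ, hK, graphSum_neg]

theorem pair_graphEnd_left (hg : IsMetric g) (hJ : ∀ X Y, g (J X) Y = -g X (J Y))
    (hK : ∀ X Y, g (K X) Y = -g X (K Y)) (x y : Gen V) :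
    pair (graphEnd hg J K x) y = -pair x (graphEnd hg J K y) := by
  rw [← hg.graphSum_parts x, ← hg.graphSum_parts y, graphEnd_graphSum, graphEnd_graphSum,
    hg.pair_graphSum, hg.pair_graphSum, hJ, hK]
  ring

end GenLinear

/-! ### Eigenbundles in the complexification -/

section PlusEigen

variable {V : Type*} [AddCommGroup V] [Module ℝ V] [TopologicalSpace V]

/-- The element `x + i y` of the complexification. -/
def mkGen (x y : Gen V) : GenC V := (Cplx.mk x.1 y.1, toC x.2 + Complex.I • toC y.2)

theorem reGen_mkGen (x y : Gen V) : reGen (mkGen x y) = x := by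
  refine Prod.ext rfl (one_form_ext fun Z => ?_)
  change ((x.2 ![Z] : ℂ) + Complex.I * (y.2 ![Z] : ℂ)).re = x.2 ![Z]
  simp

theorem imGen_mkGen (x y : Gen V) : imGen (mkGen x y) = y := by
  refine Prod.ext rfl (one_form_ext fun Z => ?_)
  change ((x.2 ![Z] : ℂ) + Complex.I * (y.2 ![Z] : ℂ)).im = y.2 ![Z]
  simp

theorem pairC_re (x y : GenC V) :
    (pairC x y).re = pair (reGen x) (reGen y) - pair (imGen x) (imGen y) := by
  change ((y.2 ![x.1.re] + Complex.I * y.2 ![x.1.im]) +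
    (x.2 ![y.1.re] + Complex.I * x.2 ![y.1.im])).re = ((y.2 ![x.1.re]).re + (x.2 ![y.1.re]).re) -
    ((y.2 ![x.1.im]).im + (x.2 ![y.1.im]).im)
  simp
  ring

theorem pairC_im (x y : GenC V) :
    (pairC x y).im = pair (reGen x) (imGen y) + pair (imGen x) (reGen y) := by
  change ((y.2 ![x.1.re] + Complex.I * y.2 ![x.1.im]) +
    (x.2 ![y.1.re] + Complex.I * x.2 ![y.1.im])).im = ((y.2 ![x.1.re]).im + (x.2 ![y.1.im]).re) +
    ((y.2 ![x.1.im]).re + (x.2 ![y.1.re]).im)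
  simp
  ring

/-- The `i`-eigenspace of an orthogonal complex structure for a nondegenerate pairing is maximal
isotropic. -/
theorem maximal_plusEigen {𝕁 : Gen V →ₗ[ℝ] Gen V} (sq : ∀ x, 𝕁 (𝕁 x) = -x)
    (skew : ∀ x y, pair (𝕁 x) y = -pair x (𝕁 y))
    (nondeg : ∀ x : Gen V, (∀ y, pair x y = 0) → x = 0) :
    Maximal IsIsotropic (plusEigen 𝕁) := by
  have orth : ∀ x y, pair (𝕁 x) (𝕁 y) = pair x y := fun x y => by
    rw [skew, sq, pair_comm, pair_neg_left, neg_neg, pair_comm]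
  refine ⟨?_, ?_⟩
  · rintro x ⟨-, hx⟩ y ⟨-, hy⟩
    refine Complex.ext ?_ ?_
    · rw [pairC_re, ← hx, ← hy, orth, sub_self]; rfl
    · rw [pairC_im, ← hx, ← hy, skew, neg_add_cancel]; rfl
  · intro L hL hle x hx
    -- The vectors `𝕁w + iw` lie in the eigenspace. Orthogonality of `x` to all of them, split into
    -- real and imaginary parts, is the eigenvalue equation for `x` paired with `w`.
    have hy : ∀ w, mkGen (𝕁 w) w ∈ L := fun w => hle ⟨by
      rw [reGen_mkGen, imGen_mkGen, sq], by rw [reGen_mkGen, imGen_mkGen]⟩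
    refine ⟨?_, ?_⟩
    · rw [eq_neg_iff_add_eq_zero]
      refine nondeg _ fun w => ?_
      have h := congrArg Complex.re (hL x hx _ (hy w))
      rw [pairC_re, reGen_mkGen, imGen_mkGen, Complex.zero_re] at h
      rw [pair_add_left, skew]
      linarith
    · rw [← sub_eq_zero]
      refine nondeg _ fun w => ?_
      have h := congrArg Complex.im (hL x hx _ (hy w))
      rw [pairC_im, reGen_mkGen, imGen_mkGen, Complex.zero_im] at h
      rw [pair_sub_left, skew]
      linarith

end PlusEigen

/-! ### Algebra of the commuting pair and the matrix formulas -/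

section GraphEndAlgebra

variable {V : Type*} [AddCommGroup V] [Module ℝ V] [TopologicalSpace V] [IsTopologicalAddGroup V]
  {g : V →L[ℝ] V →L[ℝ] ℝ} {J K : V →L[ℝ] V}

theorem graphEnd_comm (hg : IsMetric g) (x : Gen V) :
    graphEnd hg J K (graphEnd hg J (-K) x) = graphEnd hg J (-K) (graphEnd hg J K x) := by
  rw [← hg.graphSum_parts x]
  simp only [graphEnd_graphSum, neg_apply, map_neg]

/-- The sign of `-K` cancels the negative sign of the pairing on the graph of `-g`, leaving the sum
of `2g` on both graphs. -/
theorem pair_graphEnd_graphEnd (hg : IsMetric g) (hJ : ∀ X Y, g (J X) (J Y) = g X Y)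
    (hK : ∀ X Y, g (K X) (K Y) = g X Y) (X Y X' Y' : V) :
    pair (graphEnd hg J K (graphSum g X Y)) (graphEnd hg J (-K) (graphSum g X' Y')) =
      2 * g X X' + 2 * g Y Y' := by
  rw [graphEnd_graphSum, graphEnd_graphSum, hg.pair_graphSum, hJ, neg_apply, map_neg, hK]
  ring

theorem pair_graphEnd_symm (hg : IsMetric g) (hJ : ∀ X Y, g (J X) (J Y) = g X Y)
    (hK : ∀ X Y, g (K X) (K Y) = g X Y) (x y : Gen V) :
    pair (graphEnd hg J K x) (graphEnd hg J (-K) y) =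
      pair (graphEnd hg J K y) (graphEnd hg J (-K) x) := by
  rw [← hg.graphSum_parts x, ← hg.graphSum_parts y, pair_graphEnd_graphEnd hg hJ hK,
    pair_graphEnd_graphEnd hg hJ hK, hg.symm (plusPart g x), hg.symm (minusPart g x)]

theorem pair_graphEnd_pos (hg : IsMetric g) (hJ : ∀ X Y, g (J X) (J Y) = g X Y)
    (hK : ∀ X Y, g (K X) (K Y) = g X Y) {x : Gen V} (hx : x ≠ 0) :
    0 < pair (graphEnd hg J K x) (graphEnd hg J (-K) x) := by
  have nonneg : ∀ X, 0 ≤ g X X := fun X => by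
    by_cases hX : X = 0
    · simp [hX]
    · exact (hg.pos X hX).le
  have h := pair_graphEnd_graphEnd hg hJ hK (plusPart g x) (minusPart g x) (plusPart g x)
    (minusPart g x)
  rw [hg.graphSum_parts] at h
  rw [h]
  by_cases h1 : plusPart g x = 0
  · by_cases h2 : minusPart g x = 0
    · refine absurd ?_ hx
      rw [← hg.graphSum_parts x, h1, h2]
      have := graphSum_smul (g := g) 0 (0 : V) 0
      simpa using this
    · linarith [nonneg (plusPart g x), hg.pos _ h2]
  · linarith [nonneg (minusPart g x), hg.pos _ h1]

omit [IsTopologicalAddGroup V] in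
theorem eq_graphSum (X Y : V) :
    ((X, flat g Y) : Gen V) = graphSum g ((1 / 2 : ℝ) • (X + Y)) ((1 / 2 : ℝ) • (X - Y)) := by
  refine Prod.ext ?_ ?_
  · change X = (1 / 2 : ℝ) • (X + Y) + (1 / 2 : ℝ) • (X - Y)
    module
  · change flat g Y = flat g ((1 / 2 : ℝ) • (X + Y) - (1 / 2 : ℝ) • (X - Y))
    congr 1
    module

/-- `X + gY` has graph components `(X ± Y)/2`; skewness of `J` and `K` converts `gJ` into `-J^*g`,
which produces the lower right block. -/
theorem graphEnd_eq_formulaA (hg : IsMetric g) (hJ : ∀ X Y, g (J X) Y = -g X (J Y))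
    (hK : ∀ X Y, g (K X) Y = -g X (K Y)) (X Y : V) :
    graphEnd hg J K (X, flat g Y) = formulaA g J K X Y := by
  rw [eq_graphSum, graphEnd_graphSum]
  simp only [map_smul, map_add, map_sub]
  refine Prod.ext ?_ (one_form_ext fun Z => ?_)
  · change (1 / 2 : ℝ) • (J X + J Y) + (1 / 2 : ℝ) • (K X - K Y) =
      (1 / 2 : ℝ) • ((J X + K X) + (J Y - K Y))
    module
  · change g ((1 / 2 : ℝ) • (J X + J Y) - (1 / 2 : ℝ) • (K X - K Y)) Z =
      (1 / 2 : ℝ) * (g (J X - K X) Z - (g Y (J Z) + g Y (K Z)))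
    simp only [map_sub, map_smul, map_add, sub_apply, smul_apply, add_apply, smul_eq_mul]
    linarith [hJ Y Z, hK Y Z]

theorem graphEnd_eq_formulaB (hg : IsMetric g) (hJ : ∀ X Y, g (J X) Y = -g X (J Y))
    (hK : ∀ X Y, g (K X) Y = -g X (K Y)) (X Y : V) :
    graphEnd hg J (-K) (X, flat g Y) = formulaB g J K X Y := by
  rw [eq_graphSum, graphEnd_graphSum]
  simp only [map_smul, map_add, map_sub, neg_apply]
  refine Prod.ext ?_ (one_form_ext fun Z => ?_)
  · change (1 / 2 : ℝ) • (J X + J Y) + (1 / 2 : ℝ) • (-K X - -K Y) =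
      (1 / 2 : ℝ) • ((J X - K X) + (J Y + K Y))
    module
  · change g ((1 / 2 : ℝ) • (J X + J Y) - (1 / 2 : ℝ) • (-K X - -K Y)) Z =
      (1 / 2 : ℝ) * (g (J X + K X) Z - (g Y (J Z) - g Y (K Z)))
    simp only [map_sub, map_smul, map_add, map_neg, sub_apply, smul_apply, add_apply, neg_apply,
      smul_eq_mul]
    linarith [hJ Y Z, hK Y Z]

end GraphEndAlgebra

/-! ## Smoothness of the generalized complex structures -/

section GraphSmoothness

variable {E M : Type*} [NormedAddCommGroup E] [NormedSpace ℝ E]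
  [TopologicalSpace M] [ChartedSpace E M] [IsManifold 𝓘(ℝ, E) ∞ M]

omit [IsManifold 𝓘(ℝ, E) ∞ M] in
/-- On a finite-dimensional space positive definite forms have bijective musical maps. -/
theorem isMetric_of_pos [FiniteDimensional ℝ E] {g : BilinField E M} {p : M}
    (symm : ∀ X Y, g p X Y = g p Y X) (pos : ∀ X, X ≠ 0 → 0 < g p X X) : IsMetric (g p) where
  symm := symm
  pos := pos
  surjective := by
    have h : ∀ B : E →L[ℝ] E →L[ℝ] ℝ, (∀ X, X ≠ 0 → 0 < B X X) →
        ∀ α : E [⋀^Fin 1]→L[ℝ] ℝ, ∃ X, flat B X = α := by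
      intro B hB α
      have hinj : Function.Injective (B : E →ₗ[ℝ] E →L[ℝ] ℝ) := by
        rw [← LinearMap.ker_eq_bot, LinearMap.ker_eq_bot']
        intro X hX
        by_contra h0
        have := hB X h0
        have h1 : B X X = 0 := DFunLike.congr_fun hX X
        linarith
      have hdim : Module.finrank ℝ E = Module.finrank ℝ (E →L[ℝ] ℝ) := by
        rw [← (LinearMap.toContinuousLinearMap (𝕜 := ℝ) (E := E) (F' := ℝ)).finrank_eq]
        exact (Subspace.dual_finrank_eq (K := ℝ) (V := E)).symm
      obtain ⟨X, hX⟩ := (LinearMap.injective_iff_surjective_of_finrank_eq_finrank hdim).1 hinj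
        (toDual E α)
      refine ⟨X, ?_⟩
      rw [flat_eq]
      exact (toDual E).symm_apply_eq.2 hX
    exact h (g p) pos

theorem SmoothVOn.add {U : Set M} (hU : IsOpen U) {X Y : VField E M} (hX : SmoothVOn U X)
    (hY : SmoothVOn U Y) : SmoothVOn U (fun q => X q + Y q) := by
  rw [smoothVOn_iff _ hU] at hX hY ⊢
  exact fun x => ((hX x).add (hY x)).congr fun y _ => map_add (dChart x _) _ _

theorem SmoothVOn.sub {U : Set M} (hU : IsOpen U) {X Y : VField E M} (hX : SmoothVOn U X)
    (hY : SmoothVOn U Y) : SmoothVOn U (fun q => X q - Y q) := by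
  rw [smoothVOn_iff _ hU] at hX hY ⊢
  exact fun x => ((hX x).sub (hY x)).congr fun y _ => map_sub (dChart x _) _ _

theorem SmoothVOn.const_smul {U : Set M} (hU : IsOpen U) {X : VField E M} (hX : SmoothVOn U X)
    (c : ℝ) : SmoothVOn U (fun q => c • X q) := by
  rw [smoothVOn_iff _ hU] at hX ⊢
  exact fun x => ((hX x).const_smul c).congr fun y _ => map_smul (dChart x _) _ _

theorem SmoothVOn.endo {U : Set M} (hU : IsOpen U) {X : VField E M} (hX : SmoothVOn U X)
    {J : EndField E M} (hJ : SmoothEnd J) : SmoothVOn U (fun q => J q (X q)) := by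
  rw [smoothVOn_iff _ hU] at hX ⊢
  exact fun x => (((hJ x).mono Set.inter_subset_left).clm_apply (hX x)).congr
    fun y hy => vecInChart_end J X x hy.1

variable {g : BilinField E M}

theorem formInChart_flat (g : BilinField E M) (X : VField E M) (x : M) {y : E}
    (hy : y ∈ (extChartAt 𝓘(ℝ, E) x).target) (v : E) :
    formInChart (fun q => flat (g q) (X q)) x y ![v] = bilinInChart g x y (vecInChart X x y) v := by
  rw [bilinInChart_apply, dChartSymm_vecInChart X x hy]
  rfl

theorem SmoothVOn.flat [FiniteDimensional ℝ E] {U : Set M} (hU : IsOpen U) {X : VField E M}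
    (hX : SmoothVOn U X) (hg : ChartSmoothBilin g) :
    SmoothFormOn U (fun q => flat (g q) (X q)) := by
  rw [smoothVOn_iff _ hU] at hX
  intro x
  refine contDiffOn_form_of_apply fun v => ?_
  have : v = ![v 0] := by ext i; fin_cases i; rfl
  rw [this]
  have hc : ContDiffOn ℝ ∞ (fun _ : E => v 0) (chartDomain E x U) := contDiffOn_const
  exact ((((hg x).mono Set.inter_subset_left).clm_apply (hX x)).clm_apply hc).congr
    fun y hy => formInChart_flat g X x hy.1 (v 0)

/-- The field `g⁻¹ α` in a chart. -/
theorem vecInChart_sharp [FiniteDimensional ℝ E] (hg : ∀ p, IsMetric (g p))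
    (α : FormField E M ℝ 1) (x : M) {y : E} (hy : y ∈ (extChartAt 𝓘(ℝ, E) x).target) :
    ∃ e : E ≃L[ℝ] (E →L[ℝ] ℝ), bilinInChart g x y = e ∧
      vecInChart (fun q => sharp (g q) (α q)) x y =
        ContinuousLinearMap.inverse (bilinInChart g x y) (toDual E (formInChart α x y)) := by
  have h1 : ∀ β : E →L[ℝ] ℝ, ∃ v, bilinInChart g x y v = β := by
    intro β
    obtain ⟨X, hX⟩ := (hg ((extChartAt 𝓘(ℝ, E) x).symm y)).surjective
      (((toDual E).symm β).compContinuousLinearMap (dChart x _))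
    refine ⟨dChart x _ X, ?_⟩
    ext w
    rw [bilinInChart_apply, dChartSymm_dChart x hy]
    have h2 := DFunLike.congr_fun hX ![dChartSymm x y w]
    rw [flat_apply] at h2
    refine h2.trans ?_
    change β (dChart x _ (dChartSymm x y w)) = β w
    rw [dChart_dChartSymm x hy]
  have h2 : Function.Injective (bilinInChart g x y : E →ₗ[ℝ] E →L[ℝ] ℝ) := by
    rw [← LinearMap.ker_eq_bot, LinearMap.ker_eq_bot']
    intro v hv
    have h3 : dChartSymm x y v = 0 := (hg _).nondeg fun w => by
      have := DFunLike.congr_fun hv (dChart x _ w)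
      change bilinInChart g x y v (dChart x _ w) = 0 at this
      rwa [bilinInChart_apply, dChartSymm_dChart x hy] at this
    rw [← dChart_dChartSymm x hy v, h3, map_zero]
  let e : E ≃L[ℝ] (E →L[ℝ] ℝ) :=
    (LinearEquiv.ofBijective (bilinInChart g x y : E →ₗ[ℝ] E →L[ℝ] ℝ) ⟨h2, h1⟩).toContinuousLinearEquiv
  have he : bilinInChart g x y = e := rfl
  refine ⟨e, he, ?_⟩
  rw [he, ContinuousLinearMap.inverse_equiv]
  refine (e.symm_apply_eq.2 ?_).symm
  ext w
  rw [toDual_apply]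
  change _ = bilinInChart g x y _ w
  rw [bilinInChart_apply, dChartSymm_vecInChart _ x hy, (hg _).apply_sharp]
  rw [formInChart_apply]
  congr 1
  ext i; fin_cases i; rfl

theorem SmoothFormOn.sharp [FiniteDimensional ℝ E] {U : Set M} (hU : IsOpen U)
    {α : FormField E M ℝ 1} (hα : SmoothFormOn U α) (hg : ChartSmoothBilin g)
    (hm : ∀ p, IsMetric (g p)) : SmoothVOn U (fun q => sharp (g q) (α q)) := by
  rw [smoothVOn_iff _ hU]
  intro x
  -- Inversion of operators is smooth at invertible ones, and nondegeneracy makes `g` invertible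
  -- throughout the chart.
  have h1 : ContDiffOn ℝ ∞ (fun y => ContinuousLinearMap.inverse (bilinInChart g x y))
      (chartDomain E x U) := by
    intro y hy
    obtain ⟨e, he, -⟩ := vecInChart_sharp hm α x hy.1
    have h2 : ContDiffAt ℝ ∞ ContinuousLinearMap.inverse (bilinInChart g x y) := by
      rw [he]; exact contDiffAt_map_inverse e
    exact h2.comp_contDiffWithinAt y ((hg x).mono Set.inter_subset_left y hy)
  have h3 : ContDiffOn ℝ ∞ (fun y => toDual E (formInChart α x y)) (chartDomain E x U) :=
    (toDual E).contDiff.comp_contDiffOn (hα x)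
  refine (h1.clm_apply h3).congr fun y hy => ?_
  obtain ⟨e, -, h⟩ := vecInChart_sharp hm α x hy.1
  exact h

theorem SmoothGenOn.plusPart [FiniteDimensional ℝ E] {U : Set M} (hU : IsOpen U)
    {s : GenField E M} (hs : SmoothGenOn U s) (hg : ChartSmoothBilin g)
    (hm : ∀ p, IsMetric (g p)) : SmoothVOn U (fun q => plusPart (g q) (s q)) :=
  (hs.1.add hU (hs.2.sharp hU hg hm)).const_smul hU (1 / 2)

theorem SmoothGenOn.minusPart [FiniteDimensional ℝ E] {U : Set M} (hU : IsOpen U)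
    {s : GenField E M} (hs : SmoothGenOn U s) (hg : ChartSmoothBilin g)
    (hm : ∀ p, IsMetric (g p)) : SmoothVOn U (fun q => minusPart (g q) (s q)) :=
  (hs.1.sub hU (hs.2.sharp hU hg hm)).const_smul hU (1 / 2)

theorem SmoothGenOn.graphEnd [FiniteDimensional ℝ E] {U : Set M} (hU : IsOpen U)
    {s : GenField E M} (hs : SmoothGenOn U s) (hg : ChartSmoothBilin g)
    (hm : ∀ p, IsMetric (g p)) {J K : EndField E M} (hJ : SmoothEnd J) (hK : SmoothEnd K) :
    SmoothGenOn U (fun q => graphEnd (hm q) (J q) (K q) (s q)) := by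
  have h1 := (hs.plusPart hU hg hm).endo hU hJ
  have h2 := (hs.minusPart hU hg hm).endo hU hK
  exact ⟨h1.add hU h2, (h1.sub hU h2).flat hU hg⟩

end GraphSmoothness

/-! ## The Courant bracket and involutivity -/

section CourantReal

variable {E M : Type*} [NormedAddCommGroup E] [NormedSpace ℝ E]
  [TopologicalSpace M] [ChartedSpace E M] [IsManifold 𝓘(ℝ, E) ∞ M]

/-- The `H`-twisted Courant bracket on real sections. -/
def courantReal (H : FormField E M ℝ 3) (s t : GenField E M) : GenField E M := fun p =>
  (VectorField.mlieBracket 𝓘(ℝ, E) (fun q => (s q).1) (fun q => (t q).1) p,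
    extD (fun q => contractR (s q).1 (t q).2) p + contractR (s p).1 (extD (fun q => (t q).2) p)
      - contractR (t p).1 (extD (fun q => (s q).2) p)
      + contractR (s p).1 (contractR (t p).1 (H p)))

theorem mkGen_reGen_imGen {V : Type*} [AddCommGroup V] [Module ℝ V] [TopologicalSpace V]
    (x : GenC V) : mkGen (reGen x) (imGen x) = x := by
  refine Prod.ext rfl (one_form_ext fun Z => ?_)
  change ((x.2 ![Z]).re : ℂ) + Complex.I * ((x.2 ![Z]).im : ℂ) = x.2 ![Z]
  rw [mul_comm, Complex.re_add_im]

theorem contract_mk_toC {V : Type*} [AddCommGroup V] [Module ℝ V] [TopologicalSpace V] {k : ℕ}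
    (X Y : V) (α β : V [⋀^Fin (k + 1)]→L[ℝ] ℝ) :
    contract (Cplx.mk X Y) (toC α + Complex.I • toC β) =
      toC (contractR X α - contractR Y β) + Complex.I • toC (contractR X β + contractR Y α) := by
  ext v
  change ((α (Matrix.vecCons X v) : ℂ) + Complex.I * (β (Matrix.vecCons X v) : ℂ)) +
    Complex.I * ((α (Matrix.vecCons Y v) : ℂ) + Complex.I * (β (Matrix.vecCons Y v) : ℂ)) =
    (((α (Matrix.vecCons X v) - β (Matrix.vecCons Y v) : ℝ)) : ℂ) +
      Complex.I * ((β (Matrix.vecCons X v) + α (Matrix.vecCons Y v) : ℝ) : ℂ)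
  push_cast
  linear_combination (β (Matrix.vecCons Y v) : ℂ) * Complex.I_sq

theorem SmoothFormOn.contractR [FiniteDimensional ℝ E] {U : Set M} (hU : IsOpen U)
    {X : VField E M} (hX : SmoothVOn U X) {α : FormField E M ℝ 1} (hα : SmoothFormOn U α) :
    SmoothFormOn U (fun q => contractR (X q) (α q)) := by
  rw [smoothVOn_iff _ hU] at hX
  intro x
  refine contDiffOn_form_of_apply fun v => ?_
  have h3 : ContDiffOn ℝ ∞ (fun y => toDual E (formInChart α x y)) (chartDomain E x U) :=
    (toDual E).contDiff.comp_contDiffOn (hα x)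
  refine (h3.clm_apply (hX x)).congr fun y hy => ?_
  rw [toDual_apply, formInChart_apply, formInChart_apply, contractR_apply]
  congr 1
  ext i; fin_cases i
  exact (dChartSymm_vecInChart X x hy.1).symm

omit [IsManifold 𝓘(ℝ, E) ∞ M] in
theorem SmoothFormOn.sub {F : Type*} [NormedAddCommGroup F] [NormedSpace ℝ F] {k : ℕ}
    {η θ : FormField E M F k} {U : Set M} (hη : SmoothFormOn U η) (hθ : SmoothFormOn U θ) :
    SmoothFormOn U (fun q => η q - θ q) := fun x => ContDiffOn.sub (hη x) (hθ x)

theorem extD_sub {F : Type*} [NormedAddCommGroup F] [NormedSpace ℝ F] {k : ℕ}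
    {η θ : FormField E M F k} {U : Set M} (hU : IsOpen U)
    (hη : SmoothFormOn U η) (hθ : SmoothFormOn U θ) {p : M} (hp : p ∈ U) :
    extD (fun q => η q - θ q) p = extD η p - extD θ p := by
  have h := extD_add hU (hη.sub hθ) hθ hp
  simp only [sub_add_cancel] at h
  exact eq_sub_of_add_eq h.symm

theorem extD_toC_add {k : ℕ} {α β : FormField E M ℝ k} {U : Set M} (hU : IsOpen U)
    (hα : SmoothFormOn U α) (hβ : SmoothFormOn U β) {p : M} (hp : p ∈ U) :
    extD (fun q => toC (α q) + Complex.I • toC (β q)) p =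
      toC (extD α p) + Complex.I • toC (extD β p) := by
  have h1 := extD_clm_comp hU hα Complex.ofRealCLM hp
  have h2 := extD_clm_comp hU hβ (Complex.I • Complex.ofRealCLM) hp
  have h3 := extD_add hU (hα.clm_comp Complex.ofRealCLM)
    (hβ.clm_comp (Complex.I • Complex.ofRealCLM)) hp
  rw [h1, h2] at h3
  exact h3

/-- The Courant bracket of complex sections in terms of that of real sections. -/
theorem courant_mkGen [FiniteDimensional ℝ E] {H : FormField E M ℝ 3} {U : Set M} (hU : IsOpen U)
    {a b c d : GenField E M} (ha : SmoothGenOn U a) (hb : SmoothGenOn U b) (hc : SmoothGenOn U c)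
    (hd : SmoothGenOn U d) {p : M} (hp : p ∈ U) :
    courant (fun q => toC (H q)) (fun q => mkGen (a q) (b q)) (fun q => mkGen (c q) (d q)) p =
      mkGen (courantReal H a c p - courantReal H b d p)
        (courantReal H a d p + courantReal H b c p) := by
  have sac := SmoothFormOn.contractR hU ha.1 hc.2
  have sbd := SmoothFormOn.contractR hU hb.1 hd.2
  have sad := SmoothFormOn.contractR hU ha.1 hd.2
  have sbc := SmoothFormOn.contractR hU hb.1 hc.2
  refine Prod.ext (Cplx.ext rfl rfl) ?_
  have e1 : (fun q => contract (mkGen (a q) (b q)).1 (mkGen (c q) (d q)).2) = fun q =>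
      toC (contractR (a q).1 (c q).2 - contractR (b q).1 (d q).2) +
      Complex.I • toC (contractR (a q).1 (d q).2 + contractR (b q).1 (c q).2) :=
    funext fun q => contract_mk_toC _ _ _ _
  have e2 : extD (fun q => (mkGen (a q) (b q)).2) p =
      toC (extD (fun q => (a q).2) p) + Complex.I • toC (extD (fun q => (b q).2) p) :=
    extD_toC_add hU ha.2 hb.2 hp
  have e3 : extD (fun q => (mkGen (c q) (d q)).2) p =
      toC (extD (fun q => (c q).2) p) + Complex.I • toC (extD (fun q => (d q).2) p) :=
    extD_toC_add hU hc.2 hd.2 hp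
  have e4 : contract (mkGen (c p) (d p)).1 (toC (H p)) =
      toC (contractR (c p).1 (H p)) + Complex.I • toC (contractR (d p).1 (H p)) := rfl
  change extD (fun q => contract (mkGen (a q) (b q)).1 (mkGen (c q) (d q)).2) p +
    contract (mkGen (a p) (b p)).1 (extD (fun q => (mkGen (c q) (d q)).2) p) -
    contract (mkGen (c p) (d p)).1 (extD (fun q => (mkGen (a q) (b q)).2) p) +
    contract (mkGen (a p) (b p)).1 (contract (mkGen (c p) (d p)).1 (toC (H p))) = _
  rw [e1, extD_toC_add hU (sac.sub sbd) (sad.add sbc) hp, extD_sub hU sac sbd hp,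
    extD_add hU sad sbc hp, e2, e3, e4]
  have m : ∀ x y : Gen (TangentSpace 𝓘(ℝ, E) p), (mkGen x y).1 = Cplx.mk x.1 y.1 := fun _ _ => rfl
  rw [m, m, contract_mk_toC, contract_mk_toC, contract_mk_toC]
  ext v
  simp only [courantReal, mkGen, toC, ContinuousAlternatingMap.add_apply,
    ContinuousAlternatingMap.sub_apply, ContinuousAlternatingMap.smul_apply,
    ContinuousLinearMap.compContinuousAlternatingMap_coe, Function.comp_apply, Prod.snd_add,
    Prod.snd_sub, Complex.ofRealCLM_apply, smul_eq_mul]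
  push_cast
  ring

end CourantReal

/-! ### The Courant bracket in terms of 1-jets -/

section CourantJets

variable {E M : Type*} [NormedAddCommGroup E] [NormedSpace ℝ E]
  [TopologicalSpace M] [ChartedSpace E M]

/-- The derivative of a vector field at `p` in the chart around `p`. -/
def dVecAt (X : VField E M) (p : M) : E →ₗ[ℝ] E :=
  (fderiv ℝ (vecInChart X p) (extChartAt 𝓘(ℝ, E) p p) : E →L[ℝ] E)

/-- The value of a vector field at `p`. -/
def vecAt (X : VField E M) (p : M) : E := X p

variable [IsManifold 𝓘(ℝ, E) ∞ M] {U : Set M} {p : M}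

theorem SmoothVOn.differentiableAt (hU : IsOpen U) (hp : p ∈ U) {X : VField E M}
    (hX : SmoothVOn U X) : DifferentiableAt ℝ (vecInChart X p) (extChartAt 𝓘(ℝ, E) p p) :=
  (((smoothVOn_iff X hU).1 hX p).contDiffAt ((isOpen_chartDomain p hU).mem_nhds
    (mem_chartDomain_self p hp))).differentiableAt (by simp)

theorem dVecAt_add (hU : IsOpen U) (hp : p ∈ U) {X Y : VField E M}
    (hX : SmoothVOn U X) (hY : SmoothVOn U Y) (W : E) :
    dVecAt (fun q => X q + Y q) p W = dVecAt X p W + dVecAt Y p W := by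
  have h : vecInChart (fun q => X q + Y q) p = fun y => vecInChart X p y + vecInChart Y p y :=
    funext fun y => map_add (dChart p _) _ _
  have h2 := fderiv_fun_add (hX.differentiableAt hU hp) (hY.differentiableAt hU hp)
  rw [← h] at h2
  exact DFunLike.congr_fun h2 W

theorem dVecAt_sub (hU : IsOpen U) (hp : p ∈ U) {X Y : VField E M}
    (hX : SmoothVOn U X) (hY : SmoothVOn U Y) (W : E) :
    dVecAt (fun q => X q - Y q) p W = dVecAt X p W - dVecAt Y p W := by
  have h : vecInChart (fun q => X q - Y q) p = fun y => vecInChart X p y - vecInChart Y p y :=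
    funext fun y => map_sub (dChart p _) _ _
  have h2 := fderiv_fun_sub (hX.differentiableAt hU hp) (hY.differentiableAt hU hp)
  rw [← h] at h2
  exact DFunLike.congr_fun h2 W

/-- The Leibniz rule; the relation between `Y` and `X` is only needed near `p`, since `U` is open.
-/
theorem dVecAt_endo (hU : IsOpen U) (hp : p ∈ U) {X Y : VField E M} (hX : SmoothVOn U X)
    {J : EndField E M} (hJ : SmoothEnd J) (h : ∀ q ∈ U, Y q = J q (X q)) (W : E) :
    dVecAt Y p W = dEndAt J p W (vecAt X p) + endAt J p (dVecAt X p W) := by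
  have h1 : vecInChart Y p =ᶠ[nhds (extChartAt 𝓘(ℝ, E) p p)]
      fun y => endInChart J p y (vecInChart X p y) := by
    filter_upwards [(isOpen_chartDomain p hU).mem_nhds (mem_chartDomain_self p hp)] with y hy
    rw [← vecInChart_end J X p hy.1, vecInChart, vecInChart, h _ hy.2]
  have h2 := h1.fderiv_eq (𝕜 := ℝ)
  rw [fderiv_clm_apply (hJ.differentiableAt p) (hX.differentiableAt hU hp)] at h2
  have h3 := DFunLike.congr_fun h2 W
  have h4 : vecInChart X p (extChartAt 𝓘(ℝ, E) p p) = vecAt X p := vecInChart_self X p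
  rw [h4] at h3
  rw [add_comm]
  exact h3

theorem mlieBracket_eq_dVecAt (X Y : VField E M) (p : M) :
    VectorField.mlieBracket 𝓘(ℝ, E) X Y p =
      dVecAt Y p (vecAt X p) - dVecAt X p (vecAt Y p) := by
  have h4 : ∀ X : VField E M, vecInChart X p (extChartAt 𝓘(ℝ, E) p p) = vecAt X p :=
    fun X => vecInChart_self X p
  have h := mlieBracket_eq X Y p
  rw [VectorField.lieBracket, h4, h4] at h
  exact h

theorem extDeriv_zero_form {α : E → E [⋀^Fin 0]→L[ℝ] ℝ} {y : E} (h : DifferentiableAt ℝ α y)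
    (Z : E) : extDeriv α y ![Z] = fderiv ℝ (fun z => α z ![]) y Z := by
  rw [extDeriv_apply h, Fin.sum_univ_one]
  have e : (0 : Fin 1).removeNth ![Z] = ![] := Subsingleton.elim _ _
  rw [e]
  simp

variable {g : BilinField E M}

theorem extD_flat [FiniteDimensional ℝ E] (hU : IsOpen U) (hp : p ∈ U) {A : VField E M}
    (hA : SmoothVOn U A) (hg : ChartSmoothBilin g) (X Y : E) :
    extD (fun q => flat (g q) (A q)) p ![X, Y] =
      dBilinAt g p X (vecAt A p) Y + bilinAt g p (dVecAt A p X) Y -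
        (dBilinAt g p Y (vecAt A p) X + bilinAt g p (dVecAt A p Y) X) := by
  rw [extD_eq]
  refine (extDeriv_one_form (E := E) X Y).trans ?_
  have hs := (hA.flat hU hg).differentiableAt hU hp
  have key : ∀ X Y : E, toDual E (fderiv ℝ (formInChart (fun q => flat (g q) (A q)) p)
      (extChartAt 𝓘(ℝ, E) p p) X) Y =
      dBilinAt g p X (vecAt A p) Y + bilinAt g p (dVecAt A p X) Y := by
    intro X Y
    rw [toDual_apply]
    have h1 : (fun y => formInChart (fun q => flat (g q) (A q)) p y ![Y]) =ᶠ[nhds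
        (extChartAt 𝓘(ℝ, E) p p)] fun y => bilinInChart g p y (vecInChart A p y) Y := by
      filter_upwards [target_mem_nhds p] with y hy
      exact formInChart_flat g A p hy Y
    have h2 := fderiv_bilin_apply (hg.differentiableAt p) (hA.differentiableAt hU hp)
      (differentiableAt_const Y) X
    have h3 := DFunLike.congr_fun (((ContinuousAlternatingMap.apply ℝ E ℝ ![Y]).hasFDerivAt.comp _
      hs.hasFDerivAt).fderiv) X
    have h4 : vecInChart A p (extChartAt 𝓘(ℝ, E) p p) = vecAt A p := vecInChart_self A p
    have h5 := DFunLike.congr_fun (h1.fderiv_eq (𝕜 := ℝ)) X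
    rw [h4] at h2
    refine (h3.symm.trans (h5.trans h2)).trans ?_
    simp only [fderiv_fun_const, Pi.zero_apply, zero_apply, map_zero, add_zero]
    rfl
  rw [key, key]

theorem extD_contractR_flat [FiniteDimensional ℝ E] (hU : IsOpen U) (hp : p ∈ U)
    {X A : VField E M} (hX : SmoothVOn U X) (hA : SmoothVOn U A) (hg : ChartSmoothBilin g) (Z : E) :
    extD (fun q => contractR (X q) (flat (g q) (A q))) p ![Z] =
      dBilinAt g p Z (vecAt A p) (vecAt X p) + bilinAt g p (dVecAt A p Z) (vecAt X p) +
        bilinAt g p (vecAt A p) (dVecAt X p Z) := by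
  rw [extD_eq]
  have hs := (SmoothFormOn.contractR hU hX (hA.flat hU hg)).differentiableAt hU hp
  refine (extDeriv_zero_form hs Z).trans ?_
  have h1 : (fun y => formInChart (fun q => contractR (X q) (flat (g q) (A q))) p y ![]) =ᶠ[nhds
      (extChartAt 𝓘(ℝ, E) p p)] fun y => bilinInChart g p y (vecInChart A p y)
        (vecInChart X p y) := by
    filter_upwards [target_mem_nhds p] with y hy
    rw [bilinInChart_apply, dChartSymm_vecInChart X p hy, dChartSymm_vecInChart A p hy]
    rfl
  have h2 := fderiv_bilin_apply (hg.differentiableAt p) (hA.differentiableAt hU hp)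
    (hX.differentiableAt hU hp) Z
  have h4 : ∀ A : VField E M, vecInChart A p (extChartAt 𝓘(ℝ, E) p p) = vecAt A p :=
    fun A => vecInChart_self A p
  rw [h4, h4] at h2
  exact (DFunLike.congr_fun (h1.fderiv_eq (𝕜 := ℝ)) Z).trans h2

/-- The Courant bracket of `X + g A` and `Y + g B` paired with `Z + g W`. -/
theorem pair_courantReal_flat [FiniteDimensional ℝ E] (hU : IsOpen U) (hp : p ∈ U)
    (H : FormField E M ℝ 3) (hg : ChartSmoothBilin g)
    {X A Y B : VField E M} (hX : SmoothVOn U X) (hA : SmoothVOn U A)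
    (hB : SmoothVOn U B) (Z W : E) :
    pair (courantReal H (fun q => (X q, flat (g q) (A q))) (fun q => (Y q, flat (g q) (B q))) p)
      (Z, flat (g p) W) =
      bilinAt g p W (dVecAt Y p (vecAt X p) - dVecAt X p (vecAt Y p)) +
      ((dBilinAt g p Z (vecAt B p) (vecAt X p) + bilinAt g p (dVecAt B p Z) (vecAt X p) +
        bilinAt g p (vecAt B p) (dVecAt X p Z)) +
      (dBilinAt g p (vecAt X p) (vecAt B p) Z + bilinAt g p (dVecAt B p (vecAt X p)) Z -
        (dBilinAt g p Z (vecAt B p) (vecAt X p) + bilinAt g p (dVecAt B p Z) (vecAt X p))) -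
      (dBilinAt g p (vecAt Y p) (vecAt A p) Z + bilinAt g p (dVecAt A p (vecAt Y p)) Z -
        (dBilinAt g p Z (vecAt A p) (vecAt Y p) + bilinAt g p (dVecAt A p Z) (vecAt Y p))) +
      triAt H p (vecAt Y p) (vecAt X p) Z) := by
  rw [← extD_flat hU hp hA hg, ← extD_flat hU hp hB hg, ← extD_contractR_flat hU hp hX hB hg,
    triAt_apply, bilinAt_apply, ← mlieBracket_eq_dVecAt]
  rfl

end CourantJets

/-! ### Involutivity for a pair of parallel complex structures -/

section Involutivity

variable {E M : Type*} [NormedAddCommGroup E] [NormedSpace ℝ E] [FiniteDimensional ℝ E]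
  [TopologicalSpace M] [ChartedSpace E M] [IsManifold 𝓘(ℝ, E) ∞ M] {U : Set M} {p : M}
  {g : BilinField E M}

/-- `courantJet` for the 1-jets at `p` of `X + a g X` and `Y + b g Y`. -/
def courantJetAt (g : BilinField E M) (H : FormField E M ℝ 3) (p : M) (a b c : ℝ)
    (X Y : VField E M) (Z : E) : ℝ :=
  courantJet (bilinAt g p) (dBilinAt g p) (fun X Y Z => triAt H p X Y Z) a b c
    (vecAt X p) (dVecAt X p) (vecAt Y p) (dVecAt Y p) Z

omit [FiniteDimensional ℝ E] [IsManifold 𝓘(ℝ, E) ∞ M] in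
theorem triAt_swap (H : FormField E M ℝ 3) (p : M) (X Y Z : E) :
    triAt H p X Y Z = -triAt H p Y X Z := by
  rw [triAt_apply, triAt_apply]
  exact three_form_swap (H p) X Y Z

omit [FiniteDimensional ℝ E] [IsManifold 𝓘(ℝ, E) ∞ M] in
theorem triAt_rotate (H : FormField E M ℝ 3) (p : M) (X Y Z : E) :
    triAt H p X Y Z = triAt H p Y Z X := by
  rw [triAt_apply, triAt_apply]
  exact three_form_rotate (H p) X Y Z

/-- The vector parts are `X + A`, `Y + B` and the covectors come from `X - A`, `Y - B`. Expanding
bilinearly gives one Courant expression for each choice of graphs. -/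
theorem pair_courantReal_graphSum (hU : IsOpen U) (hp : p ∈ U)
    (H : FormField E M ℝ 3) (hg : ChartSmoothBilin g) (symm : ∀ X Y, g p X Y = g p Y X)
    {X A Y B : VField E M} (hX : SmoothVOn U X) (hA : SmoothVOn U A) (hY : SmoothVOn U Y)
    (hB : SmoothVOn U B) (c : ℝ) (Z : E) :
    pair (courantReal H (fun q => graphSum (g q) (X q) (A q))
      (fun q => graphSum (g q) (Y q) (B q)) p) (Z, flat (g p) (c • Z : E)) =
      courantJetAt g H p 1 1 c X Y Z + courantJetAt g H p 1 (-1) c X B Z +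
      courantJetAt g H p (-1) 1 c A Y Z + courantJetAt g H p (-1) (-1) c A B Z := by
  have h := pair_courantReal_flat hU hp H hg (hX.add hU hA) (hX.sub hU hA) (Y := fun q => Y q + B q)
    (hY.sub hU hB) Z (c • Z)
  refine h.trans ?_
  have hs : ∀ X Y, bilinAt g p X Y = bilinAt g p Y X := fun X Y => by
    rw [bilinAt_apply, bilinAt_apply]; exact symm X Y
  have va : ∀ X Y : VField E M, vecAt (fun q => X q + Y q) p = vecAt X p + vecAt Y p :=
    fun _ _ => rfl
  have vs : ∀ X Y : VField E M, vecAt (fun q => X q - Y q) p = vecAt X p - vecAt Y p :=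
    fun _ _ => rfl
  simp only [va, vs, dVecAt_add hU hp hX hA, dVecAt_sub hU hp hX hA, dVecAt_add hU hp hY hB,
    dVecAt_sub hU hp hY hB, courantJetAt, courantJet]
  -- `ι_X ι_Y H` evaluates `H` on `Y` first, whence the minus sign of `H` in `courantJet`.
  rw [triAt_swap H p (vecAt Y p + vecAt B p)]
  simp only [map_add, map_sub, LinearMap.add_apply, LinearMap.sub_apply, map_smul,
    LinearMap.smul_apply, smul_eq_mul]
  simp only [hs (vecAt Y p), hs (vecAt B p), hs Z]
  ring

/-- A pair of complex structures which are parallel for the connections with torsions `H` and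
`-H` of a common Hermitian metric. -/
structure BismutPair (g : BilinField E M) (H : FormField E M ℝ 3) (J K : EndField E M) :
    Prop where
  smooth : ChartSmoothBilin g
  metric : ∀ p, IsMetric (g p)
  smoothJ : SmoothEnd J
  smoothK : SmoothEnd K
  sqJ : ∀ p v, J p (J p v) = -v
  sqK : ∀ p v, K p (K p v) = -v
  skewJ : ∀ p X Y, g p (J p X) Y = -g p X (J p Y)
  skewK : ∀ p X Y, g p (K p X) Y = -g p X (K p Y)
  hermitianJ : ∀ p, IsHermitianJet (bilinAt g p) (dBilinAt g p) (endAt J p) (dEndAt J p)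
  hermitianK : ∀ p, IsHermitianJet (bilinAt g p) (dBilinAt g p) (endAt K p) (dEndAt K p)
  parallelJ : ∀ p, IsParallelJet (bilinAt g p) (dBilinAt g p) (fun X Y Z => triAt H p X Y Z)
    (endAt J p) (dEndAt J p)
  parallelK : ∀ p, IsParallelJet ((-1 : ℝ) • bilinAt g p) ((-1 : ℝ) • dBilinAt g p)
    (fun X Y Z => triAt H p X Y Z) (endAt K p) (dEndAt K p)

variable {H : FormField E M ℝ 3} {J K : EndField E M}

-- With this sign change, one integrability theorem serves both `𝕁_A` and `𝕁_B`.
omit [FiniteDimensional ℝ E] [IsManifold 𝓘(ℝ, E) ∞ M] in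
theorem BismutPair.neg (h : BismutPair g H J K) : BismutPair g H J (fun p => -K p) := by
  have e : ∀ x, endInChart (fun p => -K p) x = fun y => -endInChart K x y := by
    intro x
    funext y
    ext v
    exact map_neg (dChart x _) _
  have e1 : ∀ p, endAt (fun p => -K p) p = -endAt K p := by
    intro p
    rw [endAt, e]
    rfl
  have e2 : ∀ p, dEndAt (fun p => -K p) p = -dEndAt K p := by
    intro p
    rw [dEndAt, e, fderiv_fun_neg]
    rfl
  exact
    { smooth := h.smooth
      metric := h.metric
      smoothJ := h.smoothJ
      smoothK := fun x => by rw [e]; exact (h.smoothK x).neg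
      sqJ := h.sqJ
      sqK := fun p v => by
        rw [neg_apply, neg_apply, map_neg, h.sqK, neg_neg]
      skewJ := h.skewJ
      skewK := fun p X Y => by
        rw [neg_apply, neg_apply, map_neg, map_neg, neg_apply, h.skewK]
      hermitianJ := h.hermitianJ
      hermitianK := fun p => by rw [e1, e2]; exact (h.hermitianK p).neg_right
      parallelJ := h.parallelJ
      parallelK := fun p => by rw [e1, e2]; exact (h.parallelK p).neg }

omit [FiniteDimensional ℝ E] in
theorem nijenhuisJet_smul (g : E →ₗ[ℝ] E →ₗ[ℝ] ℝ) (g' : E →ₗ[ℝ] E →ₗ[ℝ] E →ₗ[ℝ] ℝ)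
    (H : E → E → E → ℝ) (a b c : ℝ) (Ja : E →ₗ[ℝ] E) (Ja' : E →ₗ[ℝ] E →ₗ[ℝ] E) (Jb : E →ₗ[ℝ] E)
    (Jb' : E →ₗ[ℝ] E →ₗ[ℝ] E) (Jc : E →ₗ[ℝ] E)
    (X : E) (X' : E → E) (Y : E) (Y' : E → E) (Z : E) :
    nijenhuisJet ((-1 : ℝ) • g) ((-1 : ℝ) • g') H a b c Ja Ja' Jb Jb' Jc X X' Y Y' Z =
      nijenhuisJet g g' H (-a) (-b) (-c) Ja Ja' Jb Jb' Jc X X' Y Y' Z := by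
  simp only [nijenhuisJet, courantJet_smul]

omit [FiniteDimensional ℝ E] in
/-- The Courant-Nijenhuis tensor of `graphEnd J K` vanishes. -/
theorem BismutPair.sum_courantJetAt (h : BismutPair g H J K) (hU : IsOpen U) (hp : p ∈ U)
    {X A Y B X₁ A₁ Y₁ B₁ : VField E M} (hX : SmoothVOn U X) (hA : SmoothVOn U A)
    (hY : SmoothVOn U Y) (hB : SmoothVOn U B) (hX₁ : ∀ q ∈ U, X₁ q = J q (X q))
    (hA₁ : ∀ q ∈ U, A₁ q = K q (A q)) (hY₁ : ∀ q ∈ U, Y₁ q = J q (Y q))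
    (hB₁ : ∀ q ∈ U, B₁ q = K q (B q)) (c : ℝ) (L : E →ₗ[ℝ] E)
    (hc : c = 1 ∧ L = endAt J p ∨ c = -1 ∧ L = endAt K p) (Z : E) :
    (courantJetAt g H p 1 1 c X₁ Y₁ Z + courantJetAt g H p 1 (-1) c X₁ B₁ Z +
      courantJetAt g H p (-1) 1 c A₁ Y₁ Z + courantJetAt g H p (-1) (-1) c A₁ B₁ Z) -
    (courantJetAt g H p 1 1 c X Y Z + courantJetAt g H p 1 (-1) c X B Z +
      courantJetAt g H p (-1) 1 c A Y Z + courantJetAt g H p (-1) (-1) c A B Z) +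
    (courantJetAt g H p 1 1 c X₁ Y (L Z) + courantJetAt g H p 1 (-1) c X₁ B (L Z) +
      courantJetAt g H p (-1) 1 c A₁ Y (L Z) + courantJetAt g H p (-1) (-1) c A₁ B (L Z)) +
    (courantJetAt g H p 1 1 c X Y₁ (L Z) + courantJetAt g H p 1 (-1) c X B₁ (L Z) +
      courantJetAt g H p (-1) 1 c A Y₁ (L Z) + courantJetAt g H p (-1) (-1) c A B₁ (L Z)) = 0 := by
  have hv : ∀ {X Y : VField E M} {J : EndField E M}, (∀ q ∈ U, Y q = J q (X q)) →
      vecAt Y p = endAt J p (vecAt X p) := fun {X Y J} h => by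
    rw [endAt_apply]; exact h p hp
  have hd : ∀ {X Y : VField E M} {J : EndField E M}, SmoothVOn U X → SmoothEnd J →
      (∀ q ∈ U, Y q = J q (X q)) → ⇑(dVecAt Y p) =
      fun W => dEndAt J p W (vecAt X p) + endAt J p (dVecAt X p W) :=
    fun hX hJ h => funext fun W => dVecAt_endo hU hp hX hJ h W
  have H1 : ∀ X Y Z : E, triAt H p X Y Z = -triAt H p X Z Y := fun X Y Z => by
    rw [triAt_rotate, triAt_swap, ← triAt_rotate]
  have H2 := triAt_rotate H p
  have hJ := h.hermitianJ p
  have hK := (h.hermitianK p).neg_left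
  have pJ := h.parallelJ p
  have pK := h.parallelK p
  have key : nijenhuisJet (bilinAt g p) (dBilinAt g p) (fun X Y Z => triAt H p X Y Z) 1 1 c
        (endAt J p) (dEndAt J p) (endAt J p) (dEndAt J p) L (vecAt X p) (dVecAt X p)
        (vecAt Y p) (dVecAt Y p) Z +
      nijenhuisJet (bilinAt g p) (dBilinAt g p) (fun X Y Z => triAt H p X Y Z) 1 (-1) c
        (endAt J p) (dEndAt J p) (endAt K p) (dEndAt K p) L (vecAt X p) (dVecAt X p)
        (vecAt B p) (dVecAt B p) Z +
      nijenhuisJet (bilinAt g p) (dBilinAt g p) (fun X Y Z => triAt H p X Y Z) (-1) 1 c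
        (endAt K p) (dEndAt K p) (endAt J p) (dEndAt J p) L (vecAt A p) (dVecAt A p)
        (vecAt Y p) (dVecAt Y p) Z +
      nijenhuisJet (bilinAt g p) (dBilinAt g p) (fun X Y Z => triAt H p X Y Z) (-1) (-1) c
        (endAt K p) (dEndAt K p) (endAt K p) (dEndAt K p) L (vecAt A p) (dVecAt A p)
        (vecAt B p) (dVecAt B p) Z = 0 := by
    -- Among three signs two agree, and the majority decides: for `+` the parallelism of `J` is
    -- used, for `-` that of `K` after replacing `g` by `-g`, which flips all signs.
    rcases hc with ⟨rfl, rfl⟩ | ⟨rfl, rfl⟩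
    · have h1 := nijenhuisJet_eq_zero₁ hK pK (endAt J p) (vecAt A p) (dVecAt A p)
        (vecAt B p) (dVecAt B p) Z
      rw [nijenhuisJet_smul, neg_neg] at h1
      rw [nijenhuisJet_eq_zero₄ hJ pJ, nijenhuisJet_eq_zero₂ hJ pJ H1,
        nijenhuisJet_eq_zero₃ hJ pJ H2, h1]
      ring
    · have h1 := nijenhuisJet_eq_zero₄ hK pK (vecAt A p) (dVecAt A p)
        (vecAt B p) (dVecAt B p) Z
      have h2 := nijenhuisJet_eq_zero₂ hK pK H1 (endAt J p) (dEndAt J p) (vecAt A p) (dVecAt A p)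
        (vecAt Y p) (dVecAt Y p) Z
      have h3 := nijenhuisJet_eq_zero₃ hK pK H2 (endAt J p) (dEndAt J p) (vecAt X p) (dVecAt X p)
        (vecAt B p) (dVecAt B p) Z
      rw [nijenhuisJet_smul] at h1 h2 h3
      rw [neg_neg] at h2 h3
      rw [nijenhuisJet_eq_zero₁ hJ pJ, h1, h2, h3]
      ring
  simp only [nijenhuisJet] at key
  simp only [courantJetAt, hv hX₁, hv hA₁, hv hY₁, hv hB₁, hd hX h.smoothJ hX₁,
    hd hA h.smoothK hA₁, hd hY h.smoothJ hY₁, hd hB h.smoothK hB₁]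
  linarith

omit [FiniteDimensional ℝ E] in
theorem SmoothGenCOn.reGen {s : GenFieldC E M} (hs : SmoothGenCOn U s) :
    SmoothGenOn U (fun q => reGen (s q)) := ⟨hs.1.1, hs.2.clm_comp Complex.reCLM⟩

omit [FiniteDimensional ℝ E] in
theorem SmoothGenCOn.imGen {s : GenFieldC E M} (hs : SmoothGenCOn U s) :
    SmoothGenOn U (fun q => imGen (s q)) := ⟨hs.1.2, hs.2.clm_comp Complex.imCLM⟩

theorem pair_add_right {V : Type*} [AddCommGroup V] [Module ℝ V] [TopologicalSpace V]
    (x y z : Gen V) : pair x (y + z) = pair x y + pair x z := by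
  rw [pair_comm, pair_add_left, pair_comm y, pair_comm z]

theorem pair_courantReal (hU : IsOpen U) (hp : p ∈ U) (H : FormField E M ℝ 3)
    (hg : ChartSmoothBilin g) (hm : ∀ p, IsMetric (g p)) {s t : GenField E M}
    (hs : SmoothGenOn U s) (ht : SmoothGenOn U t) (c : ℝ) (Z : E) :
    pair (courantReal H s t p) (Z, flat (g p) (c • Z : E)) =
      courantJetAt g H p 1 1 c (fun q => plusPart (g q) (s q)) (fun q => plusPart (g q) (t q)) Z +
      courantJetAt g H p 1 (-1) c (fun q => plusPart (g q) (s q))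
        (fun q => minusPart (g q) (t q)) Z +
      courantJetAt g H p (-1) 1 c (fun q => minusPart (g q) (s q))
        (fun q => plusPart (g q) (t q)) Z +
      courantJetAt g H p (-1) (-1) c (fun q => minusPart (g q) (s q))
        (fun q => minusPart (g q) (t q)) Z := by
  have eg : ∀ s : GenField E M,
      s = fun q => graphSum (g q) (plusPart (g q) (s q)) (minusPart (g q) (s q)) :=
    fun s => funext fun q => ((hm q).graphSum_parts _).symm
  rw [← pair_courantReal_graphSum hU hp H hg (hm p).symm (hs.plusPart hU hg hm)
    (hs.minusPart hU hg hm) (ht.plusPart hU hg hm) (ht.minusPart hU hg hm), ← eg s, ← eg t]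

/-- Eigensections have the form `𝕁b + ib` and `𝕁d + id`. Their bracket has real part `[𝕁b, 𝕁d] - [b,
d]` and imaginary part `[𝕁b, d] + [b, 𝕁d]`, so involutivity is the vanishing of the
Courant-Nijenhuis tensor. -/
theorem BismutPair.isGeneralizedComplex (h : BismutPair g H J K) :
    IsGeneralizedComplex H (fun p => graphEnd (h.metric p) (J p) (K p)) where
  smooth U hU s hs := hs.graphEnd hU h.smooth h.metric h.smoothJ h.smoothK
  sq p x := graphEnd_sq (h.metric p) (h.sqJ p) (h.sqK p) x
  maximal p := maximal_plusEigen (graphEnd_sq (h.metric p) (h.sqJ p) (h.sqK p))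
    (pair_graphEnd_left (h.metric p) (h.skewJ p) (h.skewK p)) fun _ => (h.metric p).pair_nondeg
  involutive U hU s t hs ht hse hte p hp := by
    have hm := h.metric
    have e : ∀ s : GenFieldC E M, s = fun q => mkGen (reGen (s q)) (imGen (s q)) :=
      fun s => funext fun q => (mkGen_reGen_imGen _).symm
    have hP : ∀ {s : GenField E M}, SmoothGenOn U s →
      SmoothVOn U (fun q => plusPart (g q) (s q)) := fun hs => hs.plusPart hU h.smooth hm
    have hM : ∀ {s : GenField E M}, SmoothGenOn U s →
      SmoothVOn U (fun q => minusPart (g q) (s q)) := fun hs => hs.minusPart hU h.smooth hm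
    rw [e s, e t, courant_mkGen hU hs.reGen hs.imGen ht.reGen ht.imGen hp]
    have hss := hs.imGen
    have htt := ht.imGen
    have hs1 := hs.reGen
    have ht1 := ht.reGen
    set a : GenField E M := fun q => reGen (s q)
    set b : GenField E M := fun q => imGen (s q)
    set c : GenField E M := fun q => reGen (t q)
    set d : GenField E M := fun q => imGen (t q)
    have hab : ∀ q ∈ U, a q = graphEnd (hm q) (J q) (K q) (b q) := fun q hq => ((hse q hq).2).symm
    have hcd : ∀ q ∈ U, c q = graphEnd (hm q) (J q) (K q) (d q) := fun q hq => ((hte q hq).2).symm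
    have hplus : ∀ {a b : GenField E M}, (∀ q ∈ U, a q = graphEnd (hm q) (J q) (K q) (b q)) →
        ∀ q ∈ U, plusPart (g q) (a q) = J q (plusPart (g q) (b q)) := fun h q hq => by
      rw [h q hq]; exact (hm q).plusPart_graphSum _ _
    have hminus : ∀ {a b : GenField E M}, (∀ q ∈ U, a q = graphEnd (hm q) (J q) (K q) (b q)) →
        ∀ q ∈ U, minusPart (g q) (a q) = K q (minusPart (g q) (b q)) := fun h q hq => by
      rw [h q hq]; exact (hm q).minusPart_graphSum _ _
    -- The tensor is tested against the graph of `εg`, on which `𝕁` acts by `L`.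
    have hsum : ∀ (ε : ℝ) (L : E →ₗ[ℝ] E)
        (_ : ε = 1 ∧ L = endAt J p ∨ ε = -1 ∧ L = endAt K p) (Z : E),
        pair (courantReal H a c p - courantReal H b d p) (Z, flat (g p) (ε • Z : E)) +
        pair (courantReal H a d p + courantReal H b c p) (L Z, flat (g p) (ε • L Z : E)) = 0 := by
      intro ε L hε Z
      rw [pair_sub_left, pair_add_left,
        pair_courantReal hU hp H h.smooth hm hs1 ht1,
        pair_courantReal hU hp H h.smooth hm hss htt,
        pair_courantReal hU hp H h.smooth hm hs1 htt,
        pair_courantReal hU hp H h.smooth hm hss ht1]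
      have := h.sum_courantJetAt hU hp (hP hss) (hM hss) (hP htt) (hM htt) (hplus hab)
        (hminus hab) (hplus hcd) (hminus hcd) ε L hε Z
      linarith
    set R := courantReal H a c p - courantReal H b d p 
    set I := courantReal H a d p + courantReal H b c p 
    set 𝕁 := graphEnd (hm p) (J p) (K p)
    have hskew := pair_graphEnd_left (hm p) (h.skewJ p) (h.skewK p)
    -- By nondegeneracy and skewness of `𝕁` this says `⟨R, z⟩ + ⟨I, 𝕁z⟩ = 0` for all `z`, and `z`
    -- splits into its two graph components. The other eigenvalue equation follows from `𝕁² = -1`.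
    have hmain : 𝕁 I = R := by
      rw [eq_comm, ← sub_eq_zero]
      refine (hm p).pair_nondeg fun z => ?_
      rw [pair_sub_left, hskew]
      have hz : ∀ Z W : TangentSpace 𝓘(ℝ, E) p, graphSum (g p) Z W =
          (Z, flat (g p) ((1 : ℝ) • Z)) + (W, flat (g p) ((-1 : ℝ) • W)) := by
        intro Z W
        refine Prod.ext rfl (one_form_ext fun Y => ?_)
        change g p (Z - W) Y = g p ((1 : ℝ) • Z) Y + g p ((-1 : ℝ) • W) Y
        simp [sub_eq_add_neg]
      rw [← (hm p).graphSum_parts z, graphEnd_graphSum, hz, hz, pair_add_right, pair_add_right]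
      have h1 := hsum 1 _ (Or.inl ⟨rfl, rfl⟩) (plusPart (g p) z)
      have h2 := hsum (-1) _ (Or.inr ⟨rfl, rfl⟩) (minusPart (g p) z)
      rw [endAt_apply] at h1 h2
      have key : ∀ {a b c d : ℝ}, a + b = 0 → c + d = 0 → a + c - -(b + d) = 0 := by
        intro a b c d h1 h2; linarith
      exact key h1 h2
    refine ⟨?_, ?_⟩
    · rw [reGen_mkGen, imGen_mkGen, ← hmain]
      exact graphEnd_sq (hm p) (h.sqJ p) (h.sqK p) I
    · rw [reGen_mkGen, imGen_mkGen]
      exact hmain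

end Involutivity

end

/-- `Tp`, `Tm` are the triples over `(M, I₊)`, `(M, I₋)`, and `Fp`, `Fm` are
`F_± = (-F₁ ± F₂) / 2`. -/
theorem mainTheorem6
    {E M : Type*} [NormedAddCommGroup E] [NormedSpace ℝ E] [FiniteDimensional ℝ E]
    [TopologicalSpace M] [T2Space M] [SecondCountableTopology M]
    [ChartedSpace E M] [IsManifold 𝓘(ℝ, E) ∞ M]
    (Tp Tm : HolManinTriple E M)
    (F₁ F₂ : FormField E M ℝ 2)
    (hF₁ : SmoothFormOn Set.univ F₁) (hF₂ : SmoothFormOn Set.univ F₂)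
    (hH₁ : ∀ p, Tp.H p - Tm.H p = extD (fun q => Complex.I • toC (F₁ q)) p)
    (hH₂ : ∀ p, conjForm (Tm.H p) - Tp.H p = extD (fun q => Complex.I • toC (F₂ q)) p)
    (hA : ∀ p, matchedPair (Tp.J p) (Tp.A p) =
      (matchedPair (Tm.J p) (Tm.A p)).map (gaugeMap (Complex.I • toC (F₁ p))))
    (hB : ∀ p, (matchedPair (Tm.J p) (Tm.B p)).map conjGen =
      (matchedPair (Tp.J p) (Tp.B p)).map (gaugeMap (Complex.I • toC (F₂ p))))
    (Fp Fm : FormField E M ℝ 2)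
    (hFp : ∀ p, Fp p = (1 / 2 : ℝ) • (-F₁ p + F₂ p))
    (hFm : ∀ p, Fm p = (1 / 2 : ℝ) • (-F₁ p - F₂ p)) :
    ∃ (g : BilinField E M) (b : FormField E M ℝ 2) (H : FormField E M ℝ 3),
      -- `g` is a smooth symmetric tensor and `b` a smooth 2-form
      SmoothBilin g ∧ (∀ p X Y, g p X Y = g p Y X) ∧ SmoothFormOn Set.univ b ∧
      -- `-F_± I_± = g ± b`
      (∀ p X Y, -(Fp p ![Tp.J p X, Y]) = g p X Y + b p ![X, Y]) ∧
      (∀ p X Y, -(Fm p ![Tm.J p X, Y]) = g p X Y - b p ![X, Y]) ∧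
      -- `-ω_± I_± = g`
      (∀ p X Y, -(omegaPart (Tp.J p) (Fp p) ![Tp.J p X, Y]) = g p X Y) ∧
      (∀ p X Y, -(omegaPart (Tm.J p) (Fm p) ![Tm.J p X, Y]) = g p X Y) ∧
      -- `-β_± I_± = ± b`
      (∀ p X Y, -(betaPart (Tp.J p) (Fp p) ![Tp.J p X, Y]) = b p ![X, Y]) ∧
      (∀ p X Y, -(betaPart (Tm.J p) (Fm p) ![Tm.J p X, Y]) = -(b p ![X, Y])) ∧
      -- `g` is compatible with `I_±`, with `ω_± = g I_±`
      (∀ p X Y, g p (Tp.J p X) (Tp.J p Y) = g p X Y) ∧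
      (∀ p X Y, g p (Tm.J p X) (Tm.J p Y) = g p X Y) ∧
      (∀ p X Y, omegaPart (Tp.J p) (Fp p) ![X, Y] = g p (Tp.J p X) Y) ∧
      (∀ p X Y, omegaPart (Tm.J p) (Fm p) ![X, Y] = g p (Tm.J p X) Y) ∧
      -- `H = Re ℋ₊ - db = Re ℋ₋ - db`
      (∀ p, H p = reForm (Tp.H p) - extD b p) ∧
      (∀ p, H p = reForm (Tm.H p) - extD b p) ∧
      -- `± d^c_± ω_± = H`
      (∀ p, dc Tp.J (fun q => omegaPart (Tp.J q) (Fp q)) p = H p) ∧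
      (∀ p, -dc Tm.J (fun q => omegaPart (Tm.J q) (Fm q)) p = H p) ∧
      -- the generalized Kähler structure, when `g` is positive definite
      ((∀ p X, X ≠ 0 → 0 < g p X X) →
        ∃ 𝕁A 𝕁B : (p : M) → Gen (TangentSpace 𝓘(ℝ, E) p) →ₗ[ℝ] Gen (TangentSpace 𝓘(ℝ, E) p),
          IsGeneralizedKahler H 𝕁A 𝕁B ∧
          (∀ p X Y, 𝕁A p (X, flat (g p) Y) = formulaA (g p) (Tp.J p) (Tm.J p) X Y) ∧
          (∀ p X Y, 𝕁B p (X, flat (g p) Y) = formulaB (g p) (Tp.J p) (Tm.J p) X Y)) := by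
  have hTp := Tp.sq
  have hTm := Tm.sq
  have hFp' : Fp = fun p => (1 / 2 : ℝ) • ((-1 : ℝ) • F₁ p + F₂ p) :=
    funext fun p => by rw [hFp, neg_one_smul]
  have hFm' : Fm = fun p => (1 / 2 : ℝ) • ((-1 : ℝ) • F₁ p - F₂ p) :=
    funext fun p => by rw [hFm, neg_one_smul]
  have sFp : SmoothFormOn Set.univ Fp := by
    rw [hFp']; exact ((hF₁.const_smul (-1)).add hF₂).const_smul (1 / 2)
  have sFm : SmoothFormOn Set.univ Fm := by
    rw [hFm']; exact ((hF₁.const_smul (-1)).sub hF₂).const_smul (1 / 2)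
  have dFp : ∀ p, extD Fp p = (1 / 2 : ℝ) • ((-1 : ℝ) • extD F₁ p + extD F₂ p) := fun p => by
    rw [hFp', extD_smul, extD_add isOpen_univ (hF₁.const_smul (-1)) hF₂ (Set.mem_univ p),
      extD_smul]
  have dFm : ∀ p, extD Fm p = (1 / 2 : ℝ) • ((-1 : ℝ) • extD F₁ p - extD F₂ p) := fun p => by
    rw [hFm', extD_smul, extD_sub isOpen_univ (hF₁.const_smul (-1)) hF₂ (Set.mem_univ p),
      extD_smul]
  -- the relation between `F₊` and `F₋`
  have hrel : ∀ p X Y, Fp p ![Tp.J p X, Y] = -Fm p ![X, Tm.J p Y] := by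
    intro p X Y
    have h1 := gauge_relation (hTp p) (Tm.diracA.maximal p).prop.1 (F₁ p) (hA p) X Y
    have h2 := gauge_conj_relation (hTp p) (Tm.diracB.maximal p).prop.1 (F₂ p) (hB p) X Y
    rw [hFp, hFm]
    change (1 / 2 : ℝ) * (-F₁ p ![Tp.J p X, Y] + F₂ p ![Tp.J p X, Y]) =
      -((1 / 2 : ℝ) * (-F₁ p ![X, Tm.J p Y] - F₂ p ![X, Tm.J p Y]))
    -- Moving the complex structure across changes the sign of `F₁` but not of `F₂`, so `-F₁ + F₂`
    -- turns into `F₁ + F₂`, which is `-2F₋`.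
    rw [h1, h2]
    ring
  have hrel' : ∀ p X Y, Fp p ![X, Tp.J p Y] = -Fm p ![Tm.J p X, Y] := by
    intro p X Y
    rw [two_form_swap, hrel, two_form_swap (Fm p) Y, neg_neg]
  -- the real and imaginary parts of the 3-forms
  have him : ∀ p X Y Z, extD F₁ p ![X, Y, Z] = imForm (Tp.H p) ![X, Y, Z] -
      imForm (Tm.H p) ![X, Y, Z] ∧ extD F₂ p ![X, Y, Z] = -imForm (Tm.H p) ![X, Y, Z] -
      imForm (Tp.H p) ![X, Y, Z] ∧ reForm (Tp.H p) ![X, Y, Z] = reForm (Tm.H p) ![X, Y, Z] := by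
    intro p X Y Z
    have h1 := DFunLike.congr_fun ((hH₁ p).trans (extD_I_smul_toC hF₁ p)) ![X, Y, Z]
    have h2 := DFunLike.congr_fun ((hH₂ p).trans (extD_I_smul_toC hF₂ p)) ![X, Y, Z]
    change Tp.H p ![X, Y, Z] - Tm.H p ![X, Y, Z] =
      Complex.I * ((extD F₁ p ![X, Y, Z] : ℝ) : ℂ) at h1
    change (starRingEnd ℂ) (Tm.H p ![X, Y, Z]) - Tp.H p ![X, Y, Z] =
      Complex.I * ((extD F₂ p ![X, Y, Z] : ℝ) : ℂ) at h2
    have h1r := congrArg Complex.re h1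
    have h1i := congrArg Complex.im h1
    have h2i := congrArg Complex.im h2
    simp only [Complex.sub_re, Complex.sub_im, Complex.mul_re, Complex.mul_im, Complex.I_re,
      Complex.I_im, Complex.ofReal_re, Complex.ofReal_im, Complex.conj_im] at h1r h1i h2i
    change _ = (Tp.H p ![X, Y, Z]).im - (Tm.H p ![X, Y, Z]).im ∧
      _ = -(Tm.H p ![X, Y, Z]).im - (Tp.H p ![X, Y, Z]).im ∧
      (Tp.H p ![X, Y, Z]).re = (Tm.H p ![X, Y, Z]).re
    refine ⟨?_, ?_, ?_⟩ <;> linarith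
  have hre : ∀ p, reForm (Tp.H p) = reForm (Tm.H p) := fun p =>
    three_form_ext fun X Y Z => (him p X Y Z).2.2
  have dFp' : ∀ p, extD Fp p = (-1 : ℝ) • imForm (Tp.H p) := fun p => by
    refine three_form_ext fun X Y Z => ?_
    rw [dFp]
    change (1 / 2 : ℝ) * (-1 * extD F₁ p ![X, Y, Z] + extD F₂ p ![X, Y, Z]) =
      -1 * imForm (Tp.H p) ![X, Y, Z]
    rw [(him p X Y Z).1, (him p X Y Z).2.1]
    ring
  have dFm' : ∀ p, extD Fm p = (1 : ℝ) • imForm (Tm.H p) := fun p => by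
    refine three_form_ext fun X Y Z => ?_
    rw [dFm]
    change (1 / 2 : ℝ) * (-1 * extD F₁ p ![X, Y, Z] - extD F₂ p ![X, Y, Z]) =
      1 * imForm (Tm.H p) ![X, Y, Z]
    rw [(him p X Y Z).1, (him p X Y Z).2.1]
    ring
  -- the tensors `g`, `b` and `H`
  have hg : metricOf Tm.J Fm = metricOf Tp.J Fp := by
    funext p
    ext X Y
    rw [metricOf_apply, metricOf_apply, hrel, hrel']
    ring
  -- The skew part of `-F₊I₊`. By `hrel` it is also half of `i_{I₋} F₋`, the form of `b` required on
  -- the minus side.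
  let b : FormField E M ℝ 2 := fun p => (-(1 / 2) : ℝ) • insertForm (Tp.J p) (Fp p)
  have hb : ∀ p X Y, b p ![X, Y] = -(1 / 2) * insertForm (Tp.J p) (Fp p) ![X, Y] :=
    fun _ _ _ => rfl
  have hb' : b = fun p => (1 / 2 : ℝ) • insertForm (Tm.J p) (Fm p) := by
    funext p
    refine two_form_ext fun X Y => ?_
    change -(1 / 2) * insertForm (Tp.J p) (Fp p) ![X, Y] =
      (1 / 2) * insertForm (Tm.J p) (Fm p) ![X, Y]
    rw [insertForm_apply, insertForm_apply, hrel, hrel']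
    ring
  have sb : SmoothFormOn Set.univ b :=
    (SmoothFormOn.insertForm Tp.smoothEnd sFp).const_smul (-(1 / 2))
  have sg := chartSmooth_metricOf Tp.smoothEnd sFp
  let H : FormField E M ℝ 3 := fun p => reForm (Tp.H p) - extD b p
  have sR : SmoothFormOn Set.univ (fun p => reForm (Tp.H p)) := Tp.smoothH.clm_comp Complex.reCLM
  have sH : SmoothFormOn Set.univ H := sR.sub (sb.extD isOpen_univ)
  have cH : extD H = 0 := by
    funext p
    have h1 : extD (fun q => reForm (Tp.H q)) p = reForm (extD Tp.H p) :=
      extD_clm_comp isOpen_univ Tp.smoothH Complex.reCLM (Set.mem_univ p)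
    have h2 : extD Tp.H p = 0 := congrFun Tp.closed p
    rw [extD_sub isOpen_univ sR (sb.extD isOpen_univ) (Set.mem_univ p), extD_extD sb, h1, h2,
      sub_zero]
    ext v
    simp [reForm]
  -- The constant `-1` is the coefficient in `dF₊ = -Im ℋ₊`; on the minus side it is `+1`, which
  -- accounts for the sign in front of `d^c_-`.
  have dcp : ∀ p, dc Tp.J (fun q => omegaPart (Tp.J q) (Fp q)) p = H p := by
    intro p
    rw [Tp.dc_omegaPart sFp (-1) p (dFp' p)]
    change _ = reForm (Tp.H p) - extD b p
    rw [extD_smul]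
    module
  have dcm : ∀ p, -dc Tm.J (fun q => omegaPart (Tm.J q) (Fm q)) p = H p := by
    intro p
    rw [Tm.dc_omegaPart sFm 1 p (dFm' p)]
    change _ = reForm (Tp.H p) - extD b p
    rw [hb', extD_smul, hre]
    module
  have symm := metricOf_symm Tp.toComplexStructure Fp
  have skewp := metricOf_skew Tp.toComplexStructure Fp
  have skewm := metricOf_skew Tm.toComplexStructure Fm
  have hermp := metricOf_hermitian Tp.toComplexStructure Fp
  have hermm := metricOf_hermitian Tm.toComplexStructure Fm
  -- Since both triples define the same `g`, the compatibility with `I₋` transfers to the tensor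
  -- built from `F₊`.
  rw [hg] at skewm hermm
  refine ⟨metricOf Tp.J Fp, b, H, smoothBilin_of_contDiffOn sg, symm, sb, ?_, ?_,
    neg_omegaPart_comp Tp.toComplexStructure Fp, ?_, neg_betaPart_comp Tp.toComplexStructure Fp,
    ?_, hermp, hermm, omegaPart_eq_metricOf Tp.toComplexStructure Fp, ?_, fun p => rfl, ?_, dcp,
    dcm, ?_⟩
  · intro p X Y
    rw [hb, metricOf_apply, insertForm_apply]
    ring
  · intro p X Y
    rw [hb, metricOf_apply, insertForm_apply, hrel']
    ring
  · rw [← hg]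
    exact neg_omegaPart_comp Tm.toComplexStructure Fm
  · intro p X Y
    rw [neg_betaPart_comp Tm.toComplexStructure Fm, hb']
    change _ = -((1 / 2) * insertForm (Tm.J p) (Fm p) ![X, Y])
    ring
  · rw [← hg]
    exact omegaPart_eq_metricOf Tm.toComplexStructure Fm
  · intro p
    rw [← hre]
  · intro pos
    have hm : ∀ p, IsMetric (metricOf Tp.J Fp p) := fun p => isMetric_of_pos (symm p) (pos p)
    have hP : BismutPair (metricOf Tp.J Fp) H Tp.J Tm.J :=
      { smooth := sg
        metric := hm
        smoothJ := Tp.smoothEnd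
        smoothK := Tm.smoothEnd
        sqJ := Tp.sq
        sqK := Tm.sq
        skewJ := skewp
        skewK := skewm
        hermitianJ := isHermitianJet_metricOf Tp.toComplexStructure sFp
        hermitianK := by
          rw [← hg]; exact isHermitianJet_metricOf Tm.toComplexStructure sFm
        parallelJ := fun p => isParallelJet_of_dc_eq Tp.toComplexStructure sFp p (dcp p)
        parallelK := by
          rw [← hg]
          exact fun p => isParallelJet_of_neg_dc_eq Tm.toComplexStructure sFm p (dcm p) }
    exact ⟨_, _,
      { smoothH := sH
        closedH := cH
        complexA := hP.isGeneralizedComplex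
        complexB := hP.neg.isGeneralizedComplex
        comm := fun p => graphEnd_comm (hm p)
        symm := fun p => pair_graphEnd_symm (hm p) (hermp p) (hermm p)
        pos := fun p _ hx => pair_graphEnd_pos (hm p) (hermp p) (hermm p) hx },
      fun p => graphEnd_eq_formulaA (hm p) (skewp p) (skewm p),
      fun p => graphEnd_eq_formulaB (hm p) (skewp p) (skewm p)⟩
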